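/- \textbf{Conventions.} A (left) $(a,b)$-module is a free $\mathbb{C}[[b]]$-module $E$ of finite rank with a $\mathbb{C}$-linear operator $a$ such that $a\,S(b)=S(b)\,a+b^2S'(b)$ for all $S\in\mathbb{C}[[b]]$ (so $ab-ba=b^2$). It is \emph{regular} if it is contained in an $(a,b)$-module $M$ with $aM\subset bM$; its saturation $E^\sharp$ by $b^{-1}a$ is then an $(a,b)$-module. It is \emph{geometric} if it is regular and the eigenvalues of $b^{-1}a$ on $E^\sharp/bE^\sharp$ are positive rational numbers (i.e. the roots of its Bernstein polynomial are negative rationals). A \emph{fresco} is a geometric $(a,b)$-module generated by one element over $\mathbb{C}[[b]]$ and $a$. For $\mu\in\mathbb{Q}$ let $E_\mu=\mathbb{C}[[b]]e$ with $ae=\mu be$. Let $\tilde{\mathcal A}$ be the algebra of series $\sum_\nu P_\nu(a)b^\nu$, $P_\nu\in\mathbb{C}[a]$, with $ab-ba=b^2$. Fix a total order on $\mathbb{Q}/\mathbb{Z}$. The \emph{principal Jordan--H\"older sequence} of a rank $k$ fresco $E$ is the sequence $0=F_0\subset F_1\subset\dots\subset F_k=E$ of submodules with $E/F_j$ free over $\mathbb{C}[[b]]$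 and $F_j/F_{j-1}\simeq E_{\lambda_j}$, such that the classes of $\lambda_1,\dots,\lambda_k$ in $\mathbb{Q}/\mathbb{Z}$ are in weakly increasing order and $\lambda_j+j\le\lambda_{j+1}+j+1$ whenever $\lambda_j\equiv\lambda_{j+1}$ modulo $\mathbb{Z}$. The numbers $\lambda_1,\dots,\lambda_k$ are the \emph{fundamental invariants} of $E$, and $\mathcal{F}(\lambda_1,\dots,\lambda_k)$ is the set of isomorphism classes of frescos with these fundamental invariants. Put $p_j=\lambda_{j+1}-\lambda_j+1$ for $1\le j\le k-1$. If $E$ is a rank $3$ fresco with fundamental invariants $\lambda_1,\lambda_2,\lambda_3$ and $$E\simeq\tilde{\mathcal A}/\tilde{\mathcal A}(a-\lambda_1b)S_1^{-1}(a-\lambda_2b)S_2^{-1}(a-\lambda_3b),\qquad S_1(0)=S_2(0)=1,$$ put $\gamma(E)=(p_2-1)S_1'(0)-(p_1-1)S_2'(0)$. Let $\mathcal{G}(\lambda_1,\dots,\lambda_k)$ be the finite-dimensional affine space of all $(S_1,\dots,S_{k-1})$ where $S_j\in\mathbb{C}[[b]]$ has $S_j(0)=1$ and is a combination of the monomials $b^q$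 with $0\le q\le k-j-1$ or with $q=p_j+\dots+p_{j+l}\ge k-j$ for some $l\ge 0$ with $j+l+1\le k$ such that $\lambda_j,\dots,\lambda_{j+l+1}$ are congruent modulo $\mathbb{Z}$; let $I(s)$ be the isomorphism class of $\tilde{\mathcal A}/\tilde{\mathcal A}(a-\lambda_1b)S_1^{-1}\cdots S_{k-1}^{-1}(a-\lambda_kb)$ for $s=(S_1,\dots,S_{k-1})$. A function $f:\mathcal{F}_0\to\mathbb{C}$ on a subset $\mathcal{F}_0$ of $\mathcal{F}(\lambda_1,\dots,\lambda_k)$ is a \emph{holomorphic parameter} if there are a locally closed analytic subset $\mathcal{G}_0\supset I^{-1}(\mathcal{F}_0)$ of $\mathcal{G}(\lambda_1,\dots,\lambda_k)$ and a holomorphic function $\Phi:\mathcal{G}_0\to\mathbb{C}$ with $f(I(s))=\Phi(s)$ for all $s\in\mathcal{G}_0$ with $I(s)\in\mathcal{F}_0$. A \emph{change of variable} is $\theta\in\mathbb{C}[[a]]$ with $\theta(0)=0$ and $\chi(\theta):=\theta'(0)\ne0$; $\theta_*(E)$ is the vector space $E$ on which $a$ acts as $\theta(a)$ and $b$ acts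 as $b\,\theta'(a)$. A holomorphic parameter $f$ on $\mathcal{F}_0$ is \emph{quasi-invariant of weight $w\in\mathbb{N}$} if $\mathcal{F}_0$ is stable under all changes of variable and $f(E)=\chi(\theta)^w f(\theta_*(E))$ for every change of variable $\theta$ and every $[E]\in\mathcal{F}_0$. \textbf{Theorem.} Let $\lambda_1,\dots,\lambda_k$ be rational numbers and $1\le i<j\le k-2$. For $[E]\in\mathcal{F}(\lambda_1,\dots,\lambda_k)$ with principal Jordan--H\"older sequence $(F_h)$ put $\gamma_h(E)=\gamma(F_{h+2}/F_{h-1})$ for $1\le h\le k-2$ (the rank $3$ invariant $\gamma$ for the fundamental invariants $\lambda_h,\lambda_{h+1},\lambda_{h+2}$), and $$\pi_{i,j}(E)=(p_j-1)(p_{j+1}-1)(p_j+p_{j+1}-1)\,\gamma_i(E)-(p_i-1)(p_{i+1}-1)(p_i+p_{i+1}-1)\,\gamma_j(E).$$ Then $\pi_{i,j}$ is a well-defined function $\mathcal{F}(\lambda_1,\dots,\lambda_k)\to\mathbb{C}$: the value exists and does not depend on the representative of the class, on the principal Jordan--H\"older sequence, or on the presentations used. It is a holomorphic parameter on $\mathcal{F}(\lambda_1,\dots,\lambda_k)$,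 and it is quasi-invariant of weight $1$ under changes of variable. -/

import Mathlib

open scoped PowerSeries

noncomputable section

namespace Fresco

/-- A module over `ℂ⟦b⟧` (the variable `X` is `b`) with an additive operator `a` such that
`a S(b) = S(b) a + b² S'(b)`. This contains `ℂ`-linearity of `a` and `ab - ba = b²`. -/
structure PreABModule where
  carrier : Type
  [grp : AddCommGroup carrier]
  [mod : Module ℂ⟦X⟧ carrier]
  a : carrier →+ carrier
  a_smul : ∀ (S : ℂ⟦X⟧) (x : carrier),
    a (S • x) = S • a x + (PowerSeries.X ^ 2 * PowerSeries.derivative ℂ S) • x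

instance : CoeSort PreABModule Type := ⟨PreABModule.carrier⟩

instance (E : PreABModule) : AddCommGroup E := E.grp

instance (E : PreABModule) : Module ℂ⟦X⟧ E := E.mod

/-- The multiplication by `b`. -/
def bMul {E : PreABModule} (x : E) : E := (PowerSeries.X : ℂ⟦X⟧) • x

/-- The multiplication by a complex number. -/
def cMul {E : PreABModule} (c : ℂ) (x : E) : E := (PowerSeries.C c : ℂ⟦X⟧) • x

/-- An (a,b)-module: free of finite rank over `ℂ⟦b⟧`. -/
structure IsABModule (E : PreABModule) : Prop where
  free : Module.Free ℂ⟦X⟧ E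
  finite : Module.Finite ℂ⟦X⟧ E

/-- `E` and `E'` are isomorphic. -/
def Iso (E E' : PreABModule) : Prop :=
  ∃ φ : E ≃ₗ[ℂ⟦X⟧] E', ∀ x, φ (E.a x) = E'.a (φ x)

theorem Iso.refl (E : PreABModule) : Iso E E := ⟨LinearEquiv.refl _ _, fun _ => rfl⟩

theorem Iso.symm {E E' : PreABModule} : Iso E E' → Iso E' E := by
  rintro ⟨φ, h⟩
  refine ⟨φ.symm, fun x => ?_⟩
  apply φ.injective
  rw [h]
  simp

theorem Iso.trans {E E' E'' : PreABModule} : Iso E E' → Iso E' E'' → Iso E E'' := by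
  rintro ⟨φ, h⟩ ⟨ψ, h'⟩
  exact ⟨φ.trans ψ, fun x => by simp [h, h']⟩

instance isoSetoid : Setoid PreABModule := ⟨Iso, Iso.refl, Iso.symm, Iso.trans⟩

/-- Isomorphism classes. -/
def IsoClass : Type 1 := Quotient isoSetoid

/-- The isomorphism class of `E`. -/
def classOf (E : PreABModule) : IsoClass := Quotient.mk isoSetoid E

/-- A sub-module: a `ℂ⟦b⟧`-submodule stable by `a`. -/
structure ABSub (E : PreABModule) where
  carrier : Submodule ℂ⟦X⟧ E
  stable : ∀ x ∈ carrier, E.a x ∈ carrier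

/-- The operator induced by `a` on a sub-module. -/
def ABSub.subA {E : PreABModule} (F : ABSub E) : F.carrier →+ F.carrier where
  toFun x := ⟨E.a x, F.stable x x.2⟩
  map_zero' := by ext; simp
  map_add' x y := by ext; simp

/-- The quotient `F / (F ∩ G)`; it is used for `G ⊆ F`. -/
def subquot {E : PreABModule} (F G : ABSub E) : PreABModule where
  carrier := F.carrier ⧸ (G.carrier.comap F.carrier.subtype)
  a := QuotientAddGroup.map _ _ F.subA (fun x hx => G.stable _ hx)
  a_smul S x := by
    obtain ⟨y, rfl⟩ := Submodule.mkQ_surjective _ x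
    have h : F.subA (S • y) =
        S • F.subA y + (PowerSeries.X ^ 2 * PowerSeries.derivative ℂ S) • y := by
      ext
      exact E.a_smul S y
    exact congrArg (Submodule.mkQ (G.carrier.comap F.carrier.subtype)) h

/-! ### Geometric (a,b)-modules and frescos -/

/-- `a E ⊆ b E`. -/
def IsSimplePole (E : PreABModule) : Prop := ∀ x : E, ∃ y : E, E.a x = bMul y

/-- `M`, with the map `ι`, is the saturation `E♯` of `E` by `b⁻¹a`: the module `M` is a simple pole
(a,b)-module containing `E`, and is generated by `E` over `ℂ⟦b⟧` and `b⁻¹a`. -/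
structure IsSaturation (E M : PreABModule) (ι : E →ₗ[ℂ⟦X⟧] M) : Prop where
  abModule : IsABModule M
  simplePole : IsSimplePole M
  injective : Function.Injective ι
  map_a : ∀ x, ι (E.a x) = M.a (ι x)
  generated : ∀ N : Submodule ℂ⟦X⟧ M, (∀ x, ι x ∈ N) →
    (∀ x ∈ N, ∀ y, M.a x = bMul y → y ∈ N) → N = ⊤

/-- `μ` is an eigenvalue of `b⁻¹a` on `M / bM` (for a simple pole (a,b)-module `M`):
`b⁻¹a x = μ x + b z` for some `x ∉ bM` and some `z`. -/
def IsResidueEigenvalue (M : PreABModule) (μ : ℂ) : Prop :=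
  ∃ x : M, (¬ ∃ y : M, x = bMul y) ∧ ∃ z : M, M.a x = bMul (cMul μ x + bMul z)

/-- An (a,b)-module is geometric when it is regular (so that `E♯` is an (a,b)-module) and the roots
of its Bernstein polynomial, which are the opposites of the eigenvalues of `b⁻¹a` on `E♯ / bE♯`,
are negative rational numbers. -/
def IsGeometric (E : PreABModule) : Prop :=
  IsABModule E ∧ ∃ (M : PreABModule) (ι : E →ₗ[ℂ⟦X⟧] M), IsSaturation E M ι ∧
    ∀ μ : ℂ, IsResidueEigenvalue M μ → ∃ q : ℚ, 0 < q ∧ μ = q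

/-- `E` is generated by one element over `ℂ⟦b⟧` and `a`. -/
def IsMonogenic (E : PreABModule) : Prop :=
  ∃ e : E, ∀ N : ABSub E, e ∈ N.carrier → N.carrier = ⊤

/-- A fresco is a monogenic geometric (a,b)-module. -/
def IsFresco (E : PreABModule) : Prop := IsGeometric E ∧ IsMonogenic E

/-! ### The modules with a standard presentation -/

/-- The (a,b)-module `𝒜 / 𝒜 (a - λ₁b) S₁⁻¹ (a - λ₂b) ⋯ S_{k-1}⁻¹ (a - λ_k b)`
(for invertible `S_j`). Division by this operator, which is monic in `a` up to a unit of `ℂ⟦b⟧`,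
shows that the quotient is free over `ℂ⟦b⟧` with basis `e₁, …, e_k`, where `e_k` is the class of `1`
and `(a - λ_j b) e_j = S_{j-1} e_{j-1}` for `2 ≤ j`, `(a - λ₁b) e₁ = 0`. The coordinate `m : Fin k`
is the one on `e_{m+1}`. -/
def stdModule (k : ℕ) (lam : ℕ → ℚ) (S : ℕ → ℂ⟦X⟧) : PreABModule where
  carrier := Fin k → ℂ⟦X⟧
  a :=
    { toFun := fun x m =>
        PowerSeries.C (lam (m + 1) : ℂ) * PowerSeries.X * x m
          + PowerSeries.X ^ 2 * PowerSeries.derivative ℂ (x m)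
          + (if h : (m : ℕ) + 1 < k then S (m + 1) * x ⟨m + 1, h⟩ else 0)
      map_zero' := by ext1 m; simp
      map_add' := by
        intro x y
        ext1 m
        simp only [Pi.add_apply, map_add]
        split_ifs <;> ring }
  a_smul T x := by
    ext1 m
    simp only [AddMonoidHom.coe_mk, ZeroHom.coe_mk, Pi.add_apply, Pi.smul_apply, smul_eq_mul,
      Derivation.leibniz]
    split_ifs <;> ring

/-- The rank one module `E_μ`, with basis `e` such that `a e = μ b e`. -/
def rankOne (μ : ℚ) : PreABModule := stdModule 1 (fun _ => μ) (fun _ => 1)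

/-! ### The principal Jordan-Hölder sequence and the fundamental invariants -/

/-- `F 0 ⊆ F 1 ⊆ ⋯ ⊆ F k` is the principal Jordan-Hölder sequence of `E`, with successive
quotients `F j / F (j-1) ≃ E_{λ_j}`, for the total order `r` on `ℚ/ℤ`. A sequence with rank one
quotients `E_{λ_j}` is compatible with the primitive filtration when the classes of the `λ_j`
modulo `ℤ` are weakly increasing for `r`; it induces the principal sequence on each primitive
piece when `λ_j + j` is weakly increasing inside each class. -/
structure IsPrincipalJH (r : AddCircle (1 : ℚ) → AddCircle (1 : ℚ) → Prop) (k : ℕ) (lam : ℕ → ℚ)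
    (E : PreABModule) (F : ℕ → ABSub E) : Prop where
  bot : (F 0).carrier = ⊥
  top : (F k).carrier = ⊤
  mono : ∀ j < k, (F j).carrier ≤ (F (j + 1)).carrier
  normal : ∀ j ≤ k, Module.Free ℂ⟦X⟧ (E ⧸ (F j).carrier)
  quotient : ∀ j, 1 ≤ j → j ≤ k → Iso (subquot (F j) (F (j - 1))) (rankOne (lam j))
  classes : ∀ j, 1 ≤ j → j < k →
    ¬ r (lam (j + 1) : AddCircle (1 : ℚ)) (lam j : AddCircle (1 : ℚ))
  inside : ∀ j, 1 ≤ j → j < k →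
    (lam j : AddCircle (1 : ℚ)) = (lam (j + 1) : AddCircle (1 : ℚ)) →
      lam j + j ≤ lam (j + 1) + (j + 1)

/-- The set `ℱ(λ₁, …, λ_k)` of isomorphism classes of frescos with fundamental invariants
`λ₁, …, λ_k` (only the values `lam 1, …, lam k` are used). -/
def frescoClasses (r : AddCircle (1 : ℚ) → AddCircle (1 : ℚ) → Prop) (k : ℕ) (lam : ℕ → ℚ) :
    Set IsoClass :=
  {c | ∃ E : PreABModule, classOf E = c ∧ IsFresco E ∧ ∃ F, IsPrincipalJH r k lam E F}

/-- `p_j = λ_{j+1} - λ_j + 1`. -/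
def pNum (lam : ℕ → ℚ) (j : ℕ) : ℚ := lam (j + 1) - lam j + 1

/-! ### The standard family and holomorphic parameters -/

/-- The exponents `q ≥ 1` of the monomials of `Y(λ_j, …, λ_k)`: the `q` with `1 ≤ q ≤ k - j - 1`, and
the numbers `q = p_j + ⋯ + p_{j+l} ≥ k - j` for which `λ_j, …, λ_{j+l+1}` are equal modulo `ℤ`. -/
def versalExponents (k : ℕ) (lam : ℕ → ℚ) (j : ℕ) : Finset ℕ :=
  open Classical in
  Finset.Icc 1 (k - j - 1) ∪
    ((Finset.range (k - j)).filter (fun l =>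
      (∀ m ≤ l + 1, (lam (j + m) : AddCircle (1 : ℚ)) = (lam j : AddCircle (1 : ℚ))) ∧
        ((k - j : ℕ) : ℚ) ≤ ∑ m ∈ Finset.range (l + 1), pNum lam (j + m))).image
      (fun l => ⌊∑ m ∈ Finset.range (l + 1), pNum lam (j + m)⌋.toNat)

/-- The index set of the coordinates of the affine space `𝒢(λ₁, …, λ_k)`: the pairs `(j, q)`
with `1 ≤ j ≤ k - 1` and `q ≥ 1` an exponent occurring in `Y(λ_j, …, λ_k)`. -/
def versalIndex (k : ℕ) (lam : ℕ → ℚ) : Finset (Σ _ : ℕ, ℕ) :=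
  (Finset.Ico 1 k).sigma (versalExponents k lam)

/-- The affine space `𝒢(λ₁, …, λ_k)`, in its coordinates. -/
abbrev VersalBase (k : ℕ) (lam : ℕ → ℚ) : Type := versalIndex k lam → ℂ

/-- The series `S_j = 1 + ∑ s_{j,q} b^q` of the point `s`. -/
def versalSeries {k : ℕ} {lam : ℕ → ℚ} (s : VersalBase k lam) (j : ℕ) : ℂ⟦X⟧ :=
  PowerSeries.mk fun q =>
    if q = 0 then 1 else if h : (⟨j, q⟩ : Σ _ : ℕ, ℕ) ∈ versalIndex k lam then s ⟨⟨j, q⟩, h⟩ else 0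

/-- The class of the member at `s` of the tautological family. -/
def versalClass {k : ℕ} {lam : ℕ → ℚ} (s : VersalBase k lam) : IsoClass :=
  classOf (stdModule k lam (versalSeries s))

/-- A locally closed analytic subset of `ℂ^ι`. -/
def IsLocallyClosedAnalytic {ι : Type} [Fintype ι] (A : Set (ι → ℂ)) : Prop :=
  ∀ x ∈ A, ∃ U : Set (ι → ℂ), IsOpen U ∧ x ∈ U ∧ ∃ (n : ℕ) (g : Fin n → (ι → ℂ) → ℂ),
    (∀ m, DifferentiableOn ℂ (g m) U) ∧ A ∩ U = {y | y ∈ U ∧ ∀ m, g m y = 0}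

/-- Holomorphic functions on an analytic set: locally the restriction of a holomorphic function
of the ambient space. -/
def IsHolomorphicOn {ι : Type} [Fintype ι] (A : Set (ι → ℂ)) (f : A → ℂ) : Prop :=
  ∀ x ∈ A, ∃ U : Set (ι → ℂ), IsOpen U ∧ x ∈ U ∧ ∃ g : (ι → ℂ) → ℂ,
    DifferentiableOn ℂ g U ∧ ∀ y : A, (y : ι → ℂ) ∈ U → f y = g y

/-- Holomorphic parameters on a set `F₀ ⊆ ℱ(λ₁, …, λ_k)`. -/
def IsHolomorphicParameter (k : ℕ) (lam : ℕ → ℚ) {F₀ : Set IsoClass} (f : F₀ → ℂ) : Prop :=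
  ∃ G₀ : Set (VersalBase k lam), IsLocallyClosedAnalytic G₀ ∧
    (∀ s : VersalBase k lam, versalClass s ∈ F₀ → s ∈ G₀) ∧
    ∃ Φ : G₀ → ℂ, IsHolomorphicOn G₀ Φ ∧
      ∀ (s : G₀) (h : versalClass s.1 ∈ F₀), f ⟨versalClass s.1, h⟩ = Φ s

/-! ### Changes of variable -/

/-- A change of variable: `θ(0) = 0` and `χ(θ) = θ'(0) ≠ 0`. -/
def IsChangeOfVariable (θ : ℂ⟦X⟧) : Prop :=
  PowerSeries.coeff 0 θ = 0 ∧ PowerSeries.coeff 1 θ ≠ 0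

/-- `y = T(a) x`: the series `∑ t_n aⁿ x` converges to `y` for the `b`-adic topology. -/
def IsSeriesAction (E : PreABModule) (T : ℂ⟦X⟧) (x y : E) : Prop :=
  ∀ N : ℕ, ∃ M : ℕ, ∀ m ≥ M, ∃ z : E,
    y - ∑ n ∈ Finset.range m, cMul (PowerSeries.coeff n T) (E.a^[n] x) =
      (PowerSeries.X ^ N : ℂ⟦X⟧) • z

/-- `E'` is (isomorphic to) `θ_* E`: it is the space `E`, on which `a` acts as `θ(a)` and `b` acts
as `b θ'(a)`. -/
def IsPushforward (θ : ℂ⟦X⟧) (E E' : PreABModule) : Prop :=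
  ∃ φ : E' ≃+ E, (∀ c x, φ (cMul c x) = cMul c (φ x)) ∧
    (∀ x, IsSeriesAction E θ (φ x) (φ (E'.a x))) ∧
    ∀ x, ∃ y, IsSeriesAction E (PowerSeries.derivative ℂ θ) (φ x) y ∧ φ (bMul x) = bMul y

/-- `F₀` is stable by all changes of variable, and `f = χ(θ)^w · (f ∘ θ_*)` for each of them. In terms
of the action `Θ` of the automorphism `a ↦ θ(a)`, `b ↦ b θ'(a)` on presentations, `𝒜/J ↦ 𝒜/Θ(J)`, which is
inverse to `θ_*` on isomorphism classes, this is `f ∘ Θ = χ(θ)^w · f`. The existence of `θ_* E` as an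
(a,b)-module is part of the assertion. -/
def IsQuasiInvariant (w : ℕ) {F₀ : Set IsoClass} (f : F₀ → ℂ) : Prop :=
  ∀ θ : ℂ⟦X⟧, IsChangeOfVariable θ → ∀ (E : PreABModule) (hE : classOf E ∈ F₀),
    (∃ E', IsABModule E' ∧ IsPushforward θ E E') ∧
    ∀ E', IsABModule E' → IsPushforward θ E E' → ∃ hE' : classOf E' ∈ F₀,
      f ⟨classOf E, hE⟩ = PowerSeries.coeff 1 θ ^ w * f ⟨classOf E', hE'⟩

/-! ### The invariants `γ` and `π` -/

/-- `g` is a value of `γ(E) = (p₂ - 1) S₁'(0) - (p₁ - 1) S₂'(0)`, computed from some presentation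
`E ≃ 𝒜 / 𝒜 (a - λ₁b) S₁⁻¹ (a - λ₂b) S₂⁻¹ (a - λ₃b)` with `S₁(0) = S₂(0) = 1`. -/
def IsGammaValue (lam : ℕ → ℚ) (E : PreABModule) (g : ℂ) : Prop :=
  ∃ S : ℕ → ℂ⟦X⟧, PowerSeries.coeff 0 (S 1) = 1 ∧ PowerSeries.coeff 0 (S 2) = 1 ∧
    Iso E (stdModule 3 lam S) ∧
    g = ((pNum lam 2 : ℂ) - 1) * PowerSeries.coeff 1 (S 1)
      - ((pNum lam 1 : ℂ) - 1) * PowerSeries.coeff 1 (S 2)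

/-- `(p_h - 1)(p_{h+1} - 1)(p_h + p_{h+1} - 1)`. -/
def weightFactor (lam : ℕ → ℚ) (h : ℕ) : ℂ :=
  ((pNum lam h : ℂ) - 1) * ((pNum lam (h + 1) : ℂ) - 1) *
    ((pNum lam h : ℂ) + (pNum lam (h + 1) : ℂ) - 1)

/-- `g` is a value of `γ_h(E) = γ(F_{h+2} / F_{h-1})`, whose fundamental invariants are
`λ_h, λ_{h+1}, λ_{h+2}`. -/
def IsGammaAt (lam : ℕ → ℚ) {E : PreABModule} (F : ℕ → ABSub E) (h : ℕ) (g : ℂ) : Prop :=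
  IsGammaValue (fun m => lam (h - 1 + m)) (subquot (F (h + 2)) (F (h - 1))) g

/-- `z` is a value of the expression defining `π_{i,j}`, computed from some representative of the
class `c`, its principal Jordan-Hölder sequence and some presentations of the rank 3 quotients. -/
def IsPiValue (r : AddCircle (1 : ℚ) → AddCircle (1 : ℚ) → Prop) (k : ℕ) (lam : ℕ → ℚ) (i j : ℕ)
    (c : IsoClass) (z : ℂ) : Prop :=
  ∃ (E : PreABModule) (F : ℕ → ABSub E) (gi gj : ℂ), classOf E = c ∧ IsPrincipalJH r k lam E F ∧
    IsGammaAt lam F i gi ∧ IsGammaAt lam F j gj ∧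
    z = weightFactor lam j * gi - weightFactor lam i * gj

end Fresco

end

noncomputable section

namespace Fresco

open PowerSeries

/-! ### Functional calculus for operators of positive degree on a complete filtered space -/

section FunctionalCalculus

variable {V : Type*} [AddCommGroup V] [Module ℂ V]

/-! A fresco with invariants λ_1, …, λ_k has a basis e_1, …, e_k over ℂ⟦b⟧, adapted to its principal
sequence, with (a - λ_j b) e_j = S_{j-1} e_{j-1} and S_j(0) = 1 (`exists_iso_std`). The numbers γ_h
and π_{i,j} involve only the coefficients S_j'(0), so the question is how these vary when the
presentation changes, and when the variable changes.

Change of presentation. The order conditions on the λ_j force every morphism between two such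
modules with the same λ to be triangular (`coord_map_stdBasis_eq_zero`). For an isomorphism, the
diagonal entries are all equal to one constant c ≠ 0, the entries next to the diagonal share one
constant term y, and c times the variation of S_h'(0) is (λ_{h+1} - λ_h) y. The combination γ_h is
the one from which y disappears (`gammaOf_eq_of_iso`).

Change of variable. Let χ and τ be the coefficients of a and a² in θ. The operators a' = θ(a) and b'
= b θ'(a) satisfy a'b' - b'a' = b'², and series in them converge for a complete filtration in which
a and b have degree one and e_j has weight k - j. Starting from e_k, one constructs downwards
vectors e'_j with (a' - λ_j b') e'_j = S'_{j-1}(b') e'_{j-1}, with the same λ_j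
(`exists_isNewPresentation`). Their leading terms are nonzero multiples of the e_j, so they form a
basis over ℂ⟦b'⟧, and θ_* E is again a standard module with the same λ. It is again a fresco,
because the eigenvalues on the saturation are the numbers λ_j + j - k, which depend on λ only.

An expansion to second order then gives χ γ_h(θ_* E) = γ_h(E) - (τ/χ) w_h, with w_h = (p_h -
1)(p_{h+1} - 1)(p_h + p_{h+1} - 1) (`IsNewPresentation.gammaOf_eq`). The factor τ/χ does not depend
on h, so w_j γ_i - w_i γ_j is free of it and has weight one. Holomorphy is immediate, since this
expression is affine in the coordinates of 𝒢. -/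

/-- A decreasing filtration which is exhaustive in degree `0`, separated and complete. -/
structure IsCompleteFiltration (W : ℕ → Submodule ℂ V) : Prop where
  zero : W 0 = ⊤
  anti : Antitone W
  sep : ∀ x, (∀ n, x ∈ W n) → x = 0
  complete : ∀ x : ℕ → V, (∀ n, x (n + 1) - x n ∈ W n) → ∃ y, ∀ n, y - x n ∈ W n

/-- The operator `D` raises the filtration by `d`. -/
def HasDegree (W : ℕ → Submodule ℂ V) (d : ℕ) (D : Module.End ℂ V) : Prop :=
  ∀ n, ∀ x ∈ W n, D x ∈ W (n + d)

theorem HasDegree.pow {W : ℕ → Submodule ℂ V} {d : ℕ} {D : Module.End ℂ V}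
    (h : HasDegree W d D) (i : ℕ) : HasDegree W (i * d) (D ^ i) := by
  induction i with
  | zero => intro n x hx; simpa using hx
  | succ i ih =>
    intro n x hx
    have := h _ _ (ih n x hx)
    rw [pow_succ', Module.End.mul_apply]
    convert this using 2
    ring

theorem HasDegree.pow_one {W : ℕ → Submodule ℂ V} {D : Module.End ℂ V}
    (h : HasDegree W 1 D) (i : ℕ) : HasDegree W i (D ^ i) := by
  simpa using h.pow i

/-- The partial sums of `T(D)`. -/
def partialSum (D : Module.End ℂ V) (T : ℂ⟦X⟧) (n : ℕ) : Module.End ℂ V :=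
  ∑ i ∈ Finset.range n, coeff i T • D ^ i

theorem partialSum_apply (D : Module.End ℂ V) (T : ℂ⟦X⟧) (n : ℕ) (x : V) :
    partialSum D T n x = ∑ i ∈ Finset.range n, coeff i T • (D ^ i) x := by
  simp [partialSum, LinearMap.sum_apply]

theorem exists_evalSeries {W : ℕ → Submodule ℂ V} (hW : IsCompleteFiltration W)
    {D : Module.End ℂ V} (hD : HasDegree W 1 D) (T : ℂ⟦X⟧) (x : V) :
    ∃ y, ∀ n, y - partialSum D T n x ∈ W n := by
  apply hW.complete
  intro n
  rw [partialSum_apply, partialSum_apply, Finset.sum_range_succ, add_sub_cancel_left]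
  have := hD.pow_one n 0 x (by rw [hW.zero]; trivial)
  rw [zero_add] at this
  exact (W n).smul_mem _ this

theorem IsCompleteFiltration.eq_of_sub_mem {W : ℕ → Submodule ℂ V} (hW : IsCompleteFiltration W)
    {u : ℕ → V} {y z : V} (hy : ∀ n, y - u n ∈ W n) (hz : ∀ n, z - u n ∈ W n) : y = z := by
  apply sub_eq_zero.1
  apply hW.sep
  intro n
  have := (W n).sub_mem (hy n) (hz n)
  simpa using this

/-- The operator `T(D)`, as a linear function of `T`. -/
def evalSeries {W : ℕ → Submodule ℂ V} (hW : IsCompleteFiltration W)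
    {D : Module.End ℂ V} (hD : HasDegree W 1 D) : ℂ⟦X⟧ →ₗ[ℂ] Module.End ℂ V :=
  LinearMap.mk₂ ℂ (fun T x => (exists_evalSeries hW hD T x).choose)
    (fun T T' x => hW.eq_of_sub_mem (exists_evalSeries hW hD (T + T') x).choose_spec (fun n => by
      have h1 := (exists_evalSeries hW hD T x).choose_spec n
      have h2 := (exists_evalSeries hW hD T' x).choose_spec n
      convert (W n).add_mem h1 h2 using 1
      simp only [partialSum_apply, map_add, add_smul, Finset.sum_add_distrib]
      abel))
    (fun c T x => hW.eq_of_sub_mem (exists_evalSeries hW hD (c • T) x).choose_spec (fun n => by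
      have h1 := (exists_evalSeries hW hD T x).choose_spec n
      convert (W n).smul_mem c h1 using 1
      simp only [partialSum_apply, smul_sub, Finset.smul_sum, smul_smul, coeff_smul, smul_eq_mul]))
    (fun T x x' => hW.eq_of_sub_mem (exists_evalSeries hW hD T (x + x')).choose_spec (fun n => by
      have h1 := (exists_evalSeries hW hD T x).choose_spec n
      have h2 := (exists_evalSeries hW hD T x').choose_spec n
      convert (W n).add_mem h1 h2 using 1
      rw [map_add]
      abel))
    (fun c T x => hW.eq_of_sub_mem (exists_evalSeries hW hD T (c • x)).choose_spec (fun n => by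
      have h1 := (exists_evalSeries hW hD T x).choose_spec n
      convert (W n).smul_mem c h1 using 1
      rw [map_smul, smul_sub]))

/-! ### The evaluation T ↦ T(D) as a morphism of algebras -/

section

variable {W : ℕ → Submodule ℂ V} (hW : IsCompleteFiltration W)
  {D : Module.End ℂ V} (hD : HasDegree W 1 D)

theorem evalSeries_sub_partialSum (T : ℂ⟦X⟧) (n : ℕ) (x : V) :
    evalSeries hW hD T x - partialSum D T n x ∈ W n :=
  (exists_evalSeries hW hD T x).choose_spec n

theorem evalSeries_X_pow_mul_mem (T : ℂ⟦X⟧) (n : ℕ) (x : V) :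
    evalSeries hW hD (X ^ n * T) x ∈ W n := by
  have h := evalSeries_sub_partialSum hW hD (X ^ n * T) n x
  rw [partialSum_apply, Finset.sum_eq_zero, sub_zero] at h
  · exact h
  · intro i hi
    rw [coeff_X_pow_mul', if_neg (by simpa using hi), zero_smul]

theorem evalSeries_X_pow (n : ℕ) : evalSeries hW hD (X ^ n) = D ^ n := by
  ext x
  refine hW.eq_of_sub_mem (evalSeries_sub_partialSum hW hD (X ^ n) · x) fun m => ?_
  rw [partialSum_apply]
  by_cases hm : n < m
  · rw [Finset.sum_eq_single n (fun i _ hi => by rw [coeff_X_pow, if_neg hi, zero_smul])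
      (fun h => absurd (Finset.mem_range.2 hm) h), coeff_X_pow, if_pos rfl, one_smul, sub_self]
    exact (W m).zero_mem
  · rw [Finset.sum_eq_zero, sub_zero]
    · have := hD.pow_one n 0 x (by rw [hW.zero]; trivial)
      rw [zero_add] at this
      exact hW.anti (not_lt.1 hm) this
    · intro i hi
      rw [coeff_X_pow, if_neg, zero_smul]
      have := Finset.mem_range.1 hi
      omega

theorem evalSeries_one : evalSeries hW hD 1 = 1 := by
  simpa using evalSeries_X_pow hW hD 0

theorem evalSeries_X : evalSeries hW hD X = D := by
  simpa using evalSeries_X_pow hW hD 1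

/-- A linear map on series which vanishes on the monomials and is continuous vanishes. -/
theorem series_linearMap_eq_zero (hW : IsCompleteFiltration W)
    (L : ℂ⟦X⟧ →ₗ[ℂ] V) (c : ℕ) (h : ∀ n, L (X ^ n) = 0)
    (hc : ∀ n T, L (X ^ (n + c) * T) ∈ W n) : L = 0 := by
  ext T
  apply hW.sep
  intro n
  rw [T.eq_X_pow_mul_shift_add_trunc (n + c), map_add]
  refine (W n).add_mem (hc _ _) ?_
  have : ((trunc (n + c) T : Polynomial ℂ) : ℂ⟦X⟧) =
      ∑ i ∈ Finset.range (n + c), coeff i T • (X : ℂ⟦X⟧) ^ i := by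
    ext d
    simp only [Polynomial.coeff_coe, coeff_trunc, map_sum, coeff_smul, coeff_X_pow, smul_eq_mul,
      mul_ite, mul_one, mul_zero, Finset.sum_ite_eq, Finset.mem_range]
  rw [this, map_sum]
  simp only [map_smul, h, smul_zero, Finset.sum_const_zero]
  exact (W n).zero_mem

/-- Polynomials are dense, so identities between operators T(D) need only be checked on monomials.
The shift `c` admits maps that lose a bounded number of orders, such as those containing the
derivative of T. -/
theorem series_linearMap_eq (hW : IsCompleteFiltration W)
    (L L' : ℂ⟦X⟧ →ₗ[ℂ] V) (c : ℕ) (h : ∀ n, L (X ^ n) = L' (X ^ n))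
    (hc : ∀ n T, L (X ^ (n + c) * T) ∈ W n) (hc' : ∀ n T, L' (X ^ (n + c) * T) ∈ W n)
    (T : ℂ⟦X⟧) : L T = L' T := by
  have := series_linearMap_eq_zero hW (L - L') c (fun n => by simp [h])
    (fun n T => (W n).sub_mem (hc n T) (hc' n T))
  exact sub_eq_zero.1 (LinearMap.congr_fun this T)

theorem evalSeries_X_pow_mul (n : ℕ) (T : ℂ⟦X⟧) (x : V) :
    evalSeries hW hD (X ^ n * T) x = (D ^ n) (evalSeries hW hD T x) := by
  refine series_linearMap_eq hW
    (((evalSeries hW hD).flip x).comp (LinearMap.mulLeft ℂ (X ^ n)))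
    ((D ^ n).comp ((evalSeries hW hD).flip x)) 0 (fun m => ?_) (fun m T => ?_) (fun m T => ?_) T
  · simp only [LinearMap.comp_apply, LinearMap.flip_apply, LinearMap.mulLeft_apply, ← pow_add,
      evalSeries_X_pow]
    rw [pow_add, Module.End.mul_apply]
  · simp only [LinearMap.comp_apply, LinearMap.flip_apply, LinearMap.mulLeft_apply, add_zero]
    rw [mul_left_comm]
    exact evalSeries_X_pow_mul_mem hW hD _ _ _
  · simp only [LinearMap.comp_apply, LinearMap.flip_apply, add_zero]
    exact hW.anti (Nat.le_add_right m n)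
      (hD.pow_one n m _ (evalSeries_X_pow_mul_mem hW hD T m x))

theorem evalSeries_mul_apply (T U : ℂ⟦X⟧) (x : V) :
    evalSeries hW hD (T * U) x = evalSeries hW hD T (evalSeries hW hD U x) := by
  refine series_linearMap_eq hW
    (((evalSeries hW hD).flip x).comp (LinearMap.mulRight ℂ U))
    ((evalSeries hW hD).flip (evalSeries hW hD U x)) 0
    (fun m => ?_) (fun m T => ?_) (fun m T => ?_) T
  · simp only [LinearMap.comp_apply, LinearMap.flip_apply, LinearMap.mulRight_apply,
      evalSeries_X_pow, evalSeries_X_pow_mul]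
  · simp only [LinearMap.comp_apply, LinearMap.flip_apply, LinearMap.mulRight_apply, add_zero]
    rw [mul_assoc]
    exact evalSeries_X_pow_mul_mem hW hD _ _ _
  · exact evalSeries_X_pow_mul_mem hW hD _ _ _

theorem evalSeries_X_mul_apply (T : ℂ⟦X⟧) (x : V) :
    evalSeries hW hD (X * T) x = D (evalSeries hW hD T x) := by
  rw [evalSeries_mul_apply, evalSeries_X]

theorem evalSeries_mul (T U : ℂ⟦X⟧) :
    evalSeries hW hD (T * U) = evalSeries hW hD T * evalSeries hW hD U :=
  LinearMap.ext fun x => evalSeries_mul_apply hW hD T U x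

theorem evalSeries_C (c : ℂ) : evalSeries hW hD (C c) = c • 1 := by
  have : (C c : ℂ⟦X⟧) = c • 1 := by rw [smul_eq_C_mul, mul_one]
  rw [this, map_smul, evalSeries_one]

theorem evalSeries_C_mul (c : ℂ) (T : ℂ⟦X⟧) :
    evalSeries hW hD (C c * T) = c • evalSeries hW hD T := by
  rw [← smul_eq_C_mul, map_smul]

theorem evalSeries_commute (T U : ℂ⟦X⟧) (x : V) :
    evalSeries hW hD T (evalSeries hW hD U x) = evalSeries hW hD U (evalSeries hW hD T x) := by
  rw [← evalSeries_mul_apply, mul_comm, evalSeries_mul_apply]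

/-- `P` is closed for the topology defined by `W`. -/
def IsClosedFor (W : ℕ → Submodule ℂ V) (P : Submodule ℂ V) : Prop :=
  ∀ x, (∀ n, ∃ p ∈ P, x - p ∈ W n) → x ∈ P

/-- The partial sums stay in `P`, and `P` is closed. This is how all the subspaces used below are
seen to be stable by series in a or in b θ'(a). -/
theorem evalSeries_mem {P : Submodule ℂ V} (hP : IsClosedFor W P) (hDP : ∀ x ∈ P, D x ∈ P)
    (T : ℂ⟦X⟧) {x : V} (hx : x ∈ P) : evalSeries hW hD T x ∈ P := by
  refine hP _ fun n => ⟨_, ?_, evalSeries_sub_partialSum hW hD T n x⟩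
  rw [partialSum_apply]
  refine P.sum_mem fun i _ => P.smul_mem _ ?_
  clear * - hDP hx
  induction i with
  | zero => simpa using hx
  | succ i ih => rw [pow_succ', Module.End.mul_apply]; exact hDP _ ih

/-- `T = T(0) + X U` gives `T(D) = T(0) + D U(D)`. -/
theorem exists_evalSeries_eq (T : ℂ⟦X⟧) : ∃ U : ℂ⟦X⟧,
    (∀ n, coeff n U = coeff (n + 1) T) ∧
      ∀ x, evalSeries hW hD T x = coeff 0 T • x + D (evalSeries hW hD U x) := by
  refine ⟨PowerSeries.mk fun p => coeff (p + 1) T, fun n => coeff_mk _ _, fun x => ?_⟩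
  conv_lhs => rw [T.eq_X_mul_shift_add_const]
  rw [map_add, evalSeries_mul, evalSeries_C, evalSeries_X, add_comm]
  simp

theorem isClosedFor_self (W : ℕ → Submodule ℂ V) (m : ℕ) :
    IsClosedFor W (W m) := by
  intro x hx
  obtain ⟨p, hp, h⟩ := hx m
  simpa using (W m).add_mem h hp

/-- An operator congruent to the identity is bijective, and strictly compatible with the
filtration. -/
theorem bijective_of_sub_hasDegree (hW : IsCompleteFiltration W)
    {ψ : Module.End ℂ V} (hψ : HasDegree W 1 (ψ - 1)) :
    Function.Bijective ψ ∧ ∀ n x, ψ x ∈ W n → x ∈ W n := by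
  -- Neumann series: ψ is the series 1 + X evaluated at ψ - 1, and its inverse is (1 + X)⁻¹
  -- evaluated at ψ - 1.
  set U : ℂ⟦X⟧ := (1 + X)⁻¹ with hU
  have hUm : (1 + X) * U = 1 := PowerSeries.mul_inv_cancel _ (by simp)
  have h1 : ψ = evalSeries hW hψ (1 + X) := by
    rw [map_add, evalSeries_one, evalSeries_X]; abel
  have hl : ∀ x, evalSeries hW hψ U (ψ x) = x := fun x => by
    rw [congrArg (evalSeries hW hψ U) (LinearMap.congr_fun h1 x), ← evalSeries_mul_apply, mul_comm,
      hUm, evalSeries_one]; rfl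
  have hr : ∀ x, ψ (evalSeries hW hψ U x) = x := fun x => by
    rw [LinearMap.congr_fun h1 (evalSeries hW hψ U x), ← evalSeries_mul_apply, hUm,
      evalSeries_one]; rfl
  refine ⟨⟨fun x y h => by rw [← hl x, h, hl], fun y => ⟨_, hr y⟩⟩, fun n x hx => ?_⟩
  rw [← hl x]
  exact evalSeries_mem hW hψ (isClosedFor_self W n)
    (fun y hy => hW.anti (Nat.le_succ n) (hψ n y hy)) U hx

end

end FunctionalCalculus

/-! ### The `X`-adic filtration of the power series -/

/-- The series divisible by `X ^ n`. -/
def seriesFiltration (n : ℕ) : Submodule ℂ ℂ⟦X⟧ where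
  carrier := {f | ∀ i < n, coeff i f = 0}
  add_mem' := fun hf hg i hi => by rw [map_add, hf i hi, hg i hi, add_zero]
  zero_mem' := fun i _ => by simp
  smul_mem' := fun c f hf i hi => by rw [coeff_smul, hf i hi, smul_zero]

theorem mem_seriesFiltration_iff_dvd {n : ℕ} {f : ℂ⟦X⟧} :
    f ∈ seriesFiltration n ↔ X ^ n ∣ f := X_pow_dvd_iff.symm

theorem seriesFiltration_complete : IsCompleteFiltration seriesFiltration where
  zero := by
    rw [eq_top_iff]
    intro f _ i hi
    omega
  anti := fun n m h f hf i hi => hf i (lt_of_lt_of_le hi h)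
  sep := fun f hf => by
    ext i
    exact hf (i + 1) i (Nat.lt_succ_self i)
  complete := fun x hx => by
    have key : ∀ i n, i < n → ∀ d, coeff i (x (n + d)) = coeff i (x n) := by
      intro i n hi d
      induction d with
      | zero => rfl
      | succ d ih =>
        have := hx (n + d) i (by omega)
        rw [map_sub, sub_eq_zero] at this
        rw [← add_assoc, this, ih]
    refine ⟨PowerSeries.mk fun i => coeff i (x (i + 1)), fun n i hi => ?_⟩
    obtain ⟨d, rfl⟩ := Nat.exists_eq_add_of_le (Nat.succ_le_of_lt hi)
    rw [map_sub, coeff_mk, sub_eq_zero]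
    exact (key i (i + 1) (Nat.lt_succ_self i) d).symm

/-- The linear differential equation `R' = Q R` has a solution with `R(0) = 1`. -/
theorem exists_series_derivative_eq_mul (Q : ℂ⟦X⟧) :
    ∃ R : ℂ⟦X⟧, coeff 0 R = 1 ∧ derivative ℂ R = Q * R := by
  -- `J f` is the primitive of Q f without constant term. The equation with initial value 1 becomes
  -- (1 - J) R = 1, and J raises the order by one.
  let J : Module.End ℂ ℂ⟦X⟧ :=
    { toFun := fun f => PowerSeries.mk fun n => if n = 0 then 0 else coeff (n - 1) (Q * f) / n
      map_add' := fun f g => by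
        ext n
        simp only [coeff_mk, map_add, mul_add]
        split_ifs <;> ring
      map_smul' := fun c f => by
        ext n
        simp only [coeff_mk, RingHom.id_apply, coeff_smul, mul_smul_comm, smul_eq_mul]
        split_ifs <;> ring }
  have hJ : ∀ f n, coeff n (J f) = if n = 0 then 0 else coeff (n - 1) (Q * f) / n :=
    fun f n => coeff_mk n fun n => if n = 0 then 0 else coeff (n - 1) (Q * f) / (n : ℂ)
  have hdeg : HasDegree seriesFiltration 1 ((1 - J) - 1) := by
    intro n f hf i hi
    have h0 : ((1 - J) - 1) f = -J f := by simp
    rw [h0, map_neg, hJ, neg_eq_zero]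
    split_ifs with h
    · rfl
    · have : X ^ n ∣ Q * f := Dvd.dvd.mul_left (mem_seriesFiltration_iff_dvd.1 hf) _
      rw [X_pow_dvd_iff.1 this _ (by omega), zero_div]
  obtain ⟨R, hR⟩ := (bijective_of_sub_hasDegree seriesFiltration_complete hdeg).1.2 1
  have hR' : R = 1 + J R := by
    have : R - J R = 1 := hR
    rw [← this]; abel
  refine ⟨R, ?_, ?_⟩
  · rw [hR', map_add, hJ]; simp
  · ext n
    rw [coeff_derivative, hR', map_add, hJ, if_neg (Nat.succ_ne_zero n), ← hR', coeff_one,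
      if_neg (Nat.succ_ne_zero n)]
    have : ((n : ℂ) + 1) ≠ 0 := by exact_mod_cast Nat.succ_ne_zero n
    push_cast
    rw [zero_add, div_mul_cancel₀ _ this]

/-! ### Complex structure and separation of (a,b)-modules -/

instance complexModule (E : PreABModule) : Module ℂ E := Module.compHom E (C : ℂ →+* ℂ⟦X⟧)

theorem complex_smul_def {E : PreABModule} (c : ℂ) (x : E) : c • x = (C c : ℂ⟦X⟧) • x := rfl

theorem cMul_eq_smul {E : PreABModule} (c : ℂ) (x : E) : cMul c x = c • x := rfl

theorem complex_smul_comm {E : PreABModule} (c : ℂ) (T : ℂ⟦X⟧) (x : E) :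
    c • T • x = T • c • x := by
  rw [complex_smul_def, complex_smul_def, smul_smul, smul_smul, mul_comm]

theorem a_complex_smul {E : PreABModule} (c : ℂ) (x : E) : E.a (c • x) = c • E.a x := by
  rw [complex_smul_def, E.a_smul, derivative_C, mul_zero, zero_smul, add_zero]; rfl

/-- The operator `a`, as a `ℂ`-linear map. -/
def aEnd (E : PreABModule) : Module.End ℂ E where
  toFun := E.a
  map_add' := map_add _
  map_smul' := a_complex_smul

/-- The multiplication by `b`, as a `ℂ`-linear map. -/
def bEnd (E : PreABModule) : Module.End ℂ E where
  toFun x := (X : ℂ⟦X⟧) • x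
  map_add' := smul_add _
  map_smul' c x := (complex_smul_comm c X x).symm

theorem aEnd_apply {E : PreABModule} (x : E) : aEnd E x = E.a x := rfl

theorem bEnd_apply {E : PreABModule} (x : E) : bEnd E x = (X : ℂ⟦X⟧) • x := rfl

theorem aEnd_bEnd {E : PreABModule} (x : E) :
    aEnd E (bEnd E x) = bEnd E (aEnd E x) + bEnd E (bEnd E x) := by
  simp only [aEnd_apply, bEnd_apply, E.a_smul, derivative_X, mul_one, smul_smul, pow_two]

theorem IsABModule.separated {E : PreABModule} (hE : IsABModule E) {x : E}
    (hx : ∀ N : ℕ, ∃ z : E, x = (X ^ N : ℂ⟦X⟧) • z) : x = 0 := by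
  have := hE.free
  have := hE.finite
  let B := Module.Free.chooseBasis ℂ⟦X⟧ E
  apply B.ext_elem
  intro i
  ext n
  obtain ⟨z, hz⟩ := hx (n + 1)
  rw [hz, map_smul, Finsupp.smul_apply, smul_eq_mul, map_zero, Finsupp.zero_apply, map_zero,
    coeff_X_pow_mul', if_neg (by omega)]

theorem IsABModule.smul_eq_zero {E : PreABModule} (hE : IsABModule E) {T : ℂ⟦X⟧} (hT : T ≠ 0)
    {x : E} (hx : T • x = 0) : x = 0 := by
  have := hE.free
  have := hE.finite
  let B := Module.Free.chooseBasis ℂ⟦X⟧ E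
  apply B.ext_elem
  intro i
  have := congrArg (fun y => B.repr y i) hx
  simp only [map_smul, Finsupp.smul_apply, smul_eq_mul, map_zero, Finsupp.zero_apply] at this ⊢
  exact (mul_eq_zero.1 this).resolve_left hT

theorem IsABModule.smul_injective {E : PreABModule} (hE : IsABModule E) {T : ℂ⟦X⟧} (hT : T ≠ 0)
    {x y : E} (h : T • x = T • y) : x = y :=
  sub_eq_zero.1 (hE.smul_eq_zero hT (by rw [smul_sub, h, sub_self]))

theorem IsABModule.of_iso {E E' : PreABModule} (h : Iso E E') (hE : IsABModule E) :
    IsABModule E' := by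
  obtain ⟨φ, -⟩ := h
  have := hE.free
  have := hE.finite
  exact ⟨Module.Free.of_equiv φ, Module.Finite.equiv φ⟩

/-! ### Coordinates on the standard modules -/

section Std

variable {k : ℕ} {lam : ℕ → ℚ} {S : ℕ → ℂ⟦X⟧}

/-- The coordinate on `e_{n+1}`; it is zero for `k ≤ n`. -/
def coord (n : ℕ) : stdModule k lam S →ₗ[ℂ⟦X⟧] ℂ⟦X⟧ where
  toFun x := if h : n < k then (show Fin k → ℂ⟦X⟧ from x) ⟨n, h⟩ else 0
  map_add' x y := by
    split_ifs
    · rfl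
    · simp
  map_smul' T x := by
    split_ifs
    · rfl
    · simp

theorem coord_of_lt {n : ℕ} (h : n < k) (x : stdModule k lam S) :
    coord n x = (show Fin k → ℂ⟦X⟧ from x) ⟨n, h⟩ := dif_pos h

theorem coord_of_le {n : ℕ} (h : k ≤ n) (x : stdModule k lam S) : coord n x = 0 :=
  dif_neg (not_lt.2 h)

theorem coord_ext {x y : stdModule k lam S} (h : ∀ n < k, coord n x = coord n y) : x = y := by
  funext m
  have := h m m.2
  rwa [coord_of_lt m.2, coord_of_lt m.2] at this

/-- Since coordinates of index at least k are zero by convention, no case distinction on n is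
needed. -/
theorem coord_a (n : ℕ) (x : stdModule k lam S) :
    coord n ((stdModule k lam S).a x) = C (lam (n + 1) : ℂ) * X * coord n x
      + X ^ 2 * derivative ℂ (coord n x) + S (n + 1) * coord (n + 1) x := by
  by_cases h : n < k
  · have h2 : S (n + 1) * coord (n + 1) x =
        if h : n + 1 < k then S (n + 1) * (show Fin k → ℂ⟦X⟧ from x) ⟨n + 1, h⟩ else 0 := by
      split_ifs with h'
      · rw [coord_of_lt h']
      · rw [coord_of_le (not_lt.1 h'), mul_zero]
    rw [h2, coord_of_lt h, coord_of_lt h]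
    rfl
  · rw [coord_of_le (not_lt.1 h), coord_of_le (not_lt.1 h), coord_of_le (by omega)]
    simp

/-- The element with given coordinates. -/
def ofCoord (k : ℕ) (lam : ℕ → ℚ) (S : ℕ → ℂ⟦X⟧) (f : ℕ → ℂ⟦X⟧) : stdModule k lam S :=
  fun m : Fin k => f m

theorem coord_ofCoord {n : ℕ} (h : n < k) (f : ℕ → ℂ⟦X⟧) :
    coord n (ofCoord k lam S f) = f n := by
  rw [coord_of_lt h]; rfl

theorem coord_complex_smul (n : ℕ) (c : ℂ) (x : stdModule k lam S) :
    coord n (c • x) = c • coord n x := by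
  rw [complex_smul_def, map_smul, smul_eq_mul, smul_eq_C_mul]

/-- The basis `e_1, …, e_k`, numbered from `0`. -/
def stdBasis (k : ℕ) (lam : ℕ → ℚ) (S : ℕ → ℂ⟦X⟧) (n : ℕ) : stdModule k lam S :=
  ofCoord k lam S (Pi.single n 1)

theorem coord_stdBasis_self {n : ℕ} (h : n < k) : coord n (stdBasis k lam S n) = 1 := by
  rw [stdBasis, coord_ofCoord h, Pi.single_eq_same]

theorem coord_stdBasis_of_ne {n m : ℕ} (h : n ≠ m) : coord n (stdBasis k lam S m) = 0 := by
  by_cases hn : n < k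
  · rw [stdBasis, coord_ofCoord hn, Pi.single_eq_of_ne h]
  · exact coord_of_le (not_lt.1 hn) _

theorem sum_coord_smul (x : stdModule k lam S) :
    ∑ n ∈ Finset.range k, coord n x • stdBasis k lam S n = x := by
  apply coord_ext
  intro m hm
  rw [map_sum, Finset.sum_eq_single m]
  · rw [map_smul, coord_stdBasis_self hm, smul_eq_mul, mul_one]
  · intro n _ hn
    rw [map_smul, coord_stdBasis_of_ne hn.symm, smul_zero]
  · intro h
    exact absurd (Finset.mem_range.2 hm) h

theorem a_stdBasis_zero (n : ℕ) (h : n = 0) :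
    (stdModule k lam S).a (stdBasis k lam S n) =
      (C (lam (n + 1) : ℂ) * X) • stdBasis k lam S n := by
  subst h
  apply coord_ext
  intro m hm
  rw [coord_a, map_smul, coord_stdBasis_of_ne (Nat.succ_ne_zero m)]
  rcases Nat.eq_zero_or_pos m with rfl | h
  · rw [coord_stdBasis_self hm]; simp
  · rw [coord_stdBasis_of_ne h.ne']; simp

theorem a_stdBasis_succ (n : ℕ) (h : n + 1 < k) :
    (stdModule k lam S).a (stdBasis k lam S (n + 1)) =
      (C (lam (n + 2) : ℂ) * X) • stdBasis k lam S (n + 1) + S (n + 1) • stdBasis k lam S n := by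
  apply coord_ext
  intro m hm
  rw [coord_a, map_add, map_smul, map_smul]
  by_cases h1 : m = n + 1
  · subst h1
    rw [coord_stdBasis_self hm, coord_stdBasis_of_ne (Nat.succ_ne_self _),
      coord_stdBasis_of_ne (Nat.succ_ne_self _)]
    simp
  · rw [coord_stdBasis_of_ne h1]
    by_cases h2 : m = n
    · subst h2
      rw [coord_stdBasis_self h, coord_stdBasis_self hm]
      simp
    · rw [coord_stdBasis_of_ne h2, coord_stdBasis_of_ne (by omega)]
      simp

theorem isABModule_std : IsABModule (stdModule k lam S) :=
  ⟨inferInstanceAs (Module.Free ℂ⟦X⟧ (Fin k → ℂ⟦X⟧)),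
    inferInstanceAs (Module.Finite ℂ⟦X⟧ (Fin k → ℂ⟦X⟧))⟩

/-- The submodule generated by `e_1, …, e_j`. -/
def stdFlag (k : ℕ) (lam : ℕ → ℚ) (S : ℕ → ℂ⟦X⟧) (j : ℕ) : ABSub (stdModule k lam S) where
  carrier :=
    { carrier := {x | ∀ m, j ≤ m → coord m x = 0}
      add_mem' := fun hx hy m hm => by rw [map_add, hx m hm, hy m hm, add_zero]
      zero_mem' := fun m _ => map_zero _
      smul_mem' := fun T x hx m hm => by rw [map_smul, hx m hm, smul_zero] }
  stable := fun x hx m hm => by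
    rw [coord_a, hx m hm, hx (m + 1) (Nat.le_succ_of_le hm)]
    simp

theorem mem_stdFlag {j : ℕ} {x : stdModule k lam S} :
    x ∈ (stdFlag k lam S j).carrier ↔ ∀ m, j ≤ m → coord m x = 0 := Iff.rfl

/-! ### Subquotients -/

theorem iso_subquot {E E' : PreABModule} {F G : ABSub E} (f : F.carrier →ₗ[ℂ⟦X⟧] E')
    (hs : Function.Surjective f) (hk : ∀ x, f x = 0 ↔ (x : E) ∈ G.carrier)
    (ha : ∀ x, f (F.subA x) = E'.a (f x)) : Iso (subquot F G) E' := by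
  have h : G.carrier.comap F.carrier.subtype = LinearMap.ker f := by
    ext x
    rw [LinearMap.mem_ker, hk]
    rfl
  refine ⟨(Submodule.quotEquivOfEq _ _ h).trans (f.quotKerEquivOfSurjective hs), fun x => ?_⟩
  obtain ⟨y, rfl⟩ := Submodule.mkQ_surjective _ x
  exact ha y

theorem exists_linearMap_of_iso_subquot {E E' : PreABModule} {F G : ABSub E}
    (h : Iso (subquot F G) E') : ∃ f : F.carrier →ₗ[ℂ⟦X⟧] E', Function.Surjective f ∧
      (∀ x, f x = 0 ↔ (x : E) ∈ G.carrier) ∧ ∀ x, f (F.subA x) = E'.a (f x) := by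
  obtain ⟨φ, hφ⟩ := h
  refine ⟨φ.toLinearMap.comp (Submodule.mkQ (G.carrier.comap F.carrier.subtype)), ?_, ?_, ?_⟩
  · exact φ.surjective.comp (Submodule.mkQ_surjective _)
  · intro x
    have h1 : φ (Submodule.mkQ (G.carrier.comap F.carrier.subtype) x) = 0 ↔
        Submodule.mkQ (G.carrier.comap F.carrier.subtype) x = 0 := φ.map_eq_zero_iff
    exact h1.trans (Submodule.Quotient.mk_eq_zero _)
  · intro x
    exact hφ (Submodule.mkQ (G.carrier.comap F.carrier.subtype) x)

/-- The subquotients of the standard flag are standard modules. -/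
theorem iso_subquot_std {E : PreABModule} (φ : E ≃ₗ[ℂ⟦X⟧] stdModule k lam S)
    (hφ : ∀ x, φ (E.a x) = (stdModule k lam S).a (φ x)) {F G : ABSub E} {h n : ℕ} (hn : h + n ≤ k)
    (hF : ∀ x, x ∈ F.carrier ↔ φ x ∈ (stdFlag k lam S (h + n)).carrier)
    (hG : ∀ x, x ∈ G.carrier ↔ φ x ∈ (stdFlag k lam S h).carrier)
    (lam' : ℕ → ℚ) (S' : ℕ → ℂ⟦X⟧) (hlam : ∀ m < n, lam' (m + 1) = lam (h + m + 1))
    (hS : ∀ m, m + 1 < n → S' (m + 1) = S (h + m + 1)) :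
    Iso (subquot F G) (stdModule n lam' S') := by
  refine iso_subquot
    { toFun := fun x => ofCoord n lam' S' fun m => coord (h + m) (φ x)
      map_add' := fun x y => coord_ext fun m hm => by
        simp only [map_add, coord_ofCoord hm, Submodule.coe_add]
      map_smul' := fun T x => coord_ext fun m hm => by
        simp only [map_smul, coord_ofCoord hm, Submodule.coe_smul, RingHom.id_apply] } ?_ ?_ ?_
  · intro y
    -- The lift of y shifts its coordinates up by h and is zero elsewhere.
    let z : stdModule k lam S :=
      ofCoord k lam S fun m => if h ≤ m ∧ m < h + n then coord (m - h) y else 0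
    refine ⟨⟨φ.symm z, ?_⟩, ?_⟩
    · rw [hF, LinearEquiv.apply_symm_apply]
      intro m hm
      by_cases hk : m < k
      · rw [coord_ofCoord hk, if_neg (by omega)]
      · exact coord_of_le (not_lt.1 hk) _
    · apply coord_ext
      intro m hm
      simp only [LinearMap.coe_mk, AddHom.coe_mk, coord_ofCoord hm, LinearEquiv.apply_symm_apply]
      rw [coord_ofCoord (by omega), if_pos (by omega), Nat.add_sub_cancel_left]
  · rintro ⟨x, hx⟩
    simp only [LinearMap.coe_mk, AddHom.coe_mk]
    rw [hG, mem_stdFlag]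
    constructor
    · intro h0 m hm
      by_cases hmn : m < h + n
      · have := congrArg (coord (m - h)) h0
        rw [coord_ofCoord (by omega), map_zero, Nat.add_sub_cancel' hm] at this
        exact this
      · exact (hF x).1 hx m (not_lt.1 hmn)
    · intro h0
      apply coord_ext
      intro m hm
      rw [coord_ofCoord hm, map_zero]
      exact h0 _ (Nat.le_add_right _ _)
  · rintro ⟨x, hx⟩
    apply coord_ext
    intro m hm
    have h1 : coord m (ofCoord n lam' S' fun m => coord (h + m) (φ (E.a x))) = _ :=
      coord_ofCoord hm _
    refine h1.trans ?_
    rw [hφ, coord_a, coord_a]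
    simp only [LinearMap.coe_mk, AddHom.coe_mk]
    rw [coord_ofCoord hm, hlam m hm]
    congr 1
    by_cases hm' : m + 1 < n
    · rw [coord_ofCoord hm', hS m hm']
      rfl
    -- For the last index both coupling terms vanish: on one side the coordinate of index n is zero
    -- by convention, on the other x lies in F_{h+n}.
    · rw [coord_of_le (not_lt.1 hm'), mul_zero, (hF x).1 hx (h + m + 1) (by omega), mul_zero]

/-! ### The standard flag is the principal Jordan-Hölder sequence -/

/-- The conditions on the fundamental invariants. -/
structure IsPrincipalSeq (r : AddCircle (1 : ℚ) → AddCircle (1 : ℚ) → Prop) (k : ℕ)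
    (lam : ℕ → ℚ) : Prop where
  classes : ∀ j, 1 ≤ j → j < k →
    ¬ r (lam (j + 1) : AddCircle (1 : ℚ)) (lam j : AddCircle (1 : ℚ))
  inside : ∀ j, 1 ≤ j → j < k →
    (lam j : AddCircle (1 : ℚ)) = (lam (j + 1) : AddCircle (1 : ℚ)) →
      lam j + j ≤ lam (j + 1) + (j + 1)

theorem IsPrincipalJH.isPrincipalSeq {r : AddCircle (1 : ℚ) → AddCircle (1 : ℚ) → Prop}
    {E : PreABModule} {F : ℕ → ABSub E} (h : IsPrincipalJH r k lam E F) :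
    IsPrincipalSeq r k lam := ⟨h.classes, h.inside⟩

theorem IsPrincipalSeq.shift {r : AddCircle (1 : ℚ) → AddCircle (1 : ℚ) → Prop}
    (hlam : IsPrincipalSeq r k lam) {h n : ℕ} (hn : h + n ≤ k) :
    IsPrincipalSeq r n fun m => lam (h + m) where
  classes j hj hjn := hlam.classes (h + j) (by omega) (by omega)
  inside j hj hjn he := by
    have := hlam.inside (h + j) (by omega) (by omega) he
    push_cast at this
    change lam (h + j) + (j : ℚ) ≤ lam (h + j + 1) + ((j : ℚ) + 1)
    linarith

theorem isPrincipalJH_std {r : AddCircle (1 : ℚ) → AddCircle (1 : ℚ) → Prop}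
    (hlam : IsPrincipalSeq r k lam) :
    IsPrincipalJH r k lam (stdModule k lam S) (stdFlag k lam S) where
  bot := by
    rw [eq_bot_iff]
    intro x hx
    rw [Submodule.mem_bot]
    apply coord_ext
    intro n _
    rw [hx n (Nat.zero_le n), map_zero]
  top := by
    rw [eq_top_iff]
    intro x _ m hm
    exact coord_of_le hm x
  mono j _ x hx m hm := hx m (by omega)
  normal j hj := by
    -- The coordinates of index at least j identify the quotient by the flag with a free module.
    let f : stdModule k lam S →ₗ[ℂ⟦X⟧] (Fin (k - j) → ℂ⟦X⟧) :=
      LinearMap.pi fun m => coord (j + m)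
    have hs : Function.Surjective f := by
      intro y
      refine ⟨ofCoord k lam S fun n => if h : n - j < k - j then y ⟨n - j, h⟩ else 0, ?_⟩
      funext m
      have : j + (m : ℕ) - j = m := by omega
      simp only [f, LinearMap.pi_apply]
      rw [coord_ofCoord (by omega), dif_pos (by omega)]
      congr 1
      ext
      exact this
    have hk : (stdFlag k lam S j).carrier = LinearMap.ker f := by
      ext x
      rw [LinearMap.mem_ker, mem_stdFlag]
      constructor
      · intro hx
        funext m
        exact hx _ (Nat.le_add_right _ _)
      · intro hx m hm
        by_cases hmk : m < k
        · have := congrFun hx ⟨m - j, by omega⟩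
          simp only [f, LinearMap.pi_apply, Nat.add_sub_cancel' hm] at this
          exact this
        · exact coord_of_le (not_lt.1 hmk) x
    exact Module.Free.of_equiv
      ((Submodule.quotEquivOfEq _ _ hk).trans (f.quotKerEquivOfSurjective hs)).symm
  quotient j hj hjk := by
    refine iso_subquot_std (LinearEquiv.refl _ _) (fun _ => rfl) (h := j - 1) (n := 1) (by omega)
      (fun x => ?_) (fun x => Iff.rfl) _ _ (fun m hm => ?_) (fun m hm => by omega)
    · rw [Nat.sub_add_cancel hj]; rfl
    · congr 1; omega
  classes := hlam.classes
  inside := hlam.inside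

/-! ### Generators -/

theorem smul_mem_iff_of_coeff_zero_ne {E : PreABModule} {N : Submodule ℂ⟦X⟧ E} {T : ℂ⟦X⟧}
    (hT : coeff 0 T ≠ 0) {x : E} : T • x ∈ N ↔ x ∈ N := by
  refine ⟨fun h => ?_, fun h => N.smul_mem _ h⟩
  have := N.smul_mem T⁻¹ h
  rwa [smul_smul, PowerSeries.inv_mul_cancel _ (by simpa using hT), one_smul] at this

theorem eq_top_of_stdBasis_mem {N : Submodule ℂ⟦X⟧ (stdModule k lam S)}
    (h : ∀ n < k, stdBasis k lam S n ∈ N) : N = ⊤ := by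
  rw [eq_top_iff]
  intro x _
  rw [← sum_coord_smul x]
  exact N.sum_mem fun n hn => N.smul_mem _ (h n (Finset.mem_range.1 hn))

/-- The last vector e_k generates: applying a - λ_j b to e_j gives S_{j-1} e_{j-1}, and S_{j-1} is a
unit. -/
theorem isMonogenic_std (hS : ∀ j, 1 ≤ j → j < k → coeff 0 (S j) ≠ 0) :
    IsMonogenic (stdModule k lam S) := by
  refine ⟨stdBasis k lam S (k - 1), fun N hN => eq_top_of_stdBasis_mem ?_⟩
  have : ∀ d, ∀ n, n + d + 1 = k → stdBasis k lam S n ∈ N.carrier := by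
    intro d
    induction d with
    | zero =>
      intro n hn
      obtain rfl : k = n + 1 := by omega
      exact hN
    | succ d ih =>
      intro n hn
      have h1 := ih (n + 1) (by omega)
      have h2 := N.carrier.sub_mem (N.stable _ h1)
        (N.carrier.smul_mem (C (lam (n + 2) : ℂ) * X) h1)
      rw [a_stdBasis_succ n (by omega), add_sub_cancel_left,
        smul_mem_iff_of_coeff_zero_ne (hS _ (by omega) (by omega))] at h2
      exact h2
  exact fun n hn => this (k - 1 - n) n (by omega)

end Std

/-! ### Saturations and geometric standard modules -/

section Geometric

variable {k : ℕ} {lam : ℕ → ℚ} {S : ℕ → ℂ⟦X⟧}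

/-- The invariants of the saturation. -/
def satLam (k : ℕ) (lam : ℕ → ℚ) (j : ℕ) : ℚ := lam j + j - k

/-- The saturation of a standard module with invertible `S_j`. Its basis is `b^{j-k} e_j`. -/
abbrev satModule (k : ℕ) (lam : ℕ → ℚ) (S : ℕ → ℂ⟦X⟧) : PreABModule :=
  stdModule k (satLam k lam) fun j => X * S j

/-- The inclusion in the saturation. -/
def satIncl (k : ℕ) (lam : ℕ → ℚ) (S : ℕ → ℂ⟦X⟧) :
    stdModule k lam S →ₗ[ℂ⟦X⟧] satModule k lam S where
  toFun x := ofCoord k _ _ fun m => X ^ (k - 1 - m) * coord m x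
  map_add' x y := coord_ext fun m hm => by
    rw [map_add, coord_ofCoord hm, coord_ofCoord hm, coord_ofCoord hm, map_add, mul_add]
  map_smul' T x := coord_ext fun m hm => by
    rw [map_smul, coord_ofCoord hm, coord_ofCoord hm, map_smul, RingHom.id_apply, smul_eq_mul,
      smul_eq_mul, mul_left_comm]

theorem coord_satIncl {m : ℕ} (hm : m < k) (x : stdModule k lam S) :
    coord m (satIncl k lam S x) = X ^ (k - 1 - m) * coord m x :=
  coord_ofCoord hm fun m => X ^ (k - 1 - m) * coord m x

theorem satIncl_injective : Function.Injective (satIncl k lam S) := by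
  intro x y h
  apply coord_ext
  intro m hm
  have := congrArg (coord m) h
  rw [coord_satIncl hm, coord_satIncl hm] at this
  exact mul_left_cancel₀ (pow_ne_zero _ X_ne_zero) this

/-- With d = k - 1 - m, the term b² ∂ applied to b^d f produces an extra d b · b^d f. The shift from
`lam` to `satLam` compensates it, and the remaining factor b of the coupling is the one in X * S j.
-/
theorem satIncl_a (x : stdModule k lam S) :
    satIncl k lam S ((stdModule k lam S).a x) = (satModule k lam S).a (satIncl k lam S x) := by
  apply coord_ext
  intro m hm
  rw [coord_satIncl hm, coord_a, coord_a, coord_satIncl hm, Derivation.leibniz, derivative_pow,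
    derivative_X, smul_eq_mul, smul_eq_mul]
  obtain ⟨d, rfl⟩ : ∃ d, k = m + 1 + d := Nat.exists_eq_add_of_le hm
  have h1 : m + 1 + d - 1 - m = d := by omega
  rw [h1]
  have h2 : (satLam (m + 1 + d) lam (m + 1) : ℚ) = lam (m + 1) - d := by
    unfold satLam; push_cast; ring
  rw [h2]
  push_cast
  rw [map_sub]
  have h3 : (C (d : ℂ) : ℂ⟦X⟧) = (d : ℂ⟦X⟧) := map_natCast _ d
  rw [h3]
  cases d with
  | zero =>
    rw [coord_of_le (n := m + 1) (by omega), coord_of_le (n := m + 1) (by omega)]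
    simp
  | succ d =>
    rw [coord_satIncl (by omega)]
    have h4 : m + 1 + (d + 1) - 1 - (m + 1) = d := by omega
    rw [h4, Nat.add_sub_cancel]
    push_cast
    ring

theorem isSimplePole_satModule : IsSimplePole (satModule k lam S) := by
  intro x
  refine ⟨ofCoord k _ _ fun m => C (satLam k lam (m + 1) : ℂ) * coord m x
    + X * derivative ℂ (coord m x) + S (m + 1) * coord (m + 1) x, ?_⟩
  apply coord_ext
  intro m hm
  rw [coord_a, bMul, map_smul, coord_ofCoord hm, smul_eq_mul]
  ring

/-- For the generation: if ε_j = b^{j-k} e_j is reached, then b⁻¹a ε_j is a multiple of ε_j plus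
S_{j-1} ε_{j-1}, and S_{j-1} is a unit. The descent starts at ε_k = e_k. -/
theorem isSaturation_std (hS : ∀ j, 1 ≤ j → j < k → coeff 0 (S j) ≠ 0) :
    IsSaturation (stdModule k lam S) (satModule k lam S) (satIncl k lam S) where
  abModule := isABModule_std
  simplePole := isSimplePole_satModule
  injective := satIncl_injective
  map_a := satIncl_a
  generated := by
    intro N hN hN'
    apply eq_top_of_stdBasis_mem
    have : ∀ d, ∀ n, n + d + 1 = k → stdBasis k (satLam k lam) (fun j => X * S j) n ∈ N := by
      intro d
      induction d with
      | zero =>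
        intro n hn
        convert hN (stdBasis k lam S n)
        apply coord_ext
        intro m hm
        rw [coord_satIncl hm]
        by_cases h : m = n
        · subst h
          rw [coord_stdBasis_self hm, coord_stdBasis_self hm, mul_one,
            show k - 1 - m = 0 by omega, pow_zero]
        · rw [coord_stdBasis_of_ne h, coord_stdBasis_of_ne h, mul_zero]
      | succ d ih =>
        intro n hn
        have h1 := ih (n + 1) (by omega)
        have h2 := hN' _ h1 (C (satLam k lam (n + 2) : ℂ) • stdBasis k _ _ (n + 1)
          + S (n + 1) • stdBasis k _ _ n) (by
            rw [a_stdBasis_succ n (by omega), bMul, smul_add, smul_smul, smul_smul, mul_comm])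
        have h3 := N.sub_mem h2 (N.smul_mem (C (satLam k lam (n + 2) : ℂ)) h1)
        rw [add_sub_cancel_left, smul_mem_iff_of_coeff_zero_ne (hS _ (by omega) (by omega))] at h3
        exact h3
    exact fun n hn => this (k - 1 - n) n (by omega)

/-- Modulo b, the operator b⁻¹a is upper triangular with diagonal entries `satLam`. The last nonzero
entry of an eigenvector reveals its eigenvalue. -/
theorem residueEigenvalue_satModule {μ : ℂ} (h : IsResidueEigenvalue (satModule k lam S) μ) :
    ∃ j, 1 ≤ j ∧ j ≤ k ∧ μ = (satLam k lam j : ℚ) := by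
  obtain ⟨x, hx, z, hz⟩ := h
  have hcoord : ∀ m, coeff 0 (coord m x) * (satLam k lam (m + 1) : ℂ)
      + coeff 0 (S (m + 1)) * coeff 0 (coord (m + 1) x) = μ * coeff 0 (coord m x) := by
    intro m
    have h1 := congrArg (fun y => coeff 1 (coord m y)) hz
    simp only [coord_a, bMul, cMul, map_smul, map_add, smul_eq_mul] at h1
    have h2 : ∀ f : ℂ⟦X⟧, coeff 1 (X * f) = coeff 0 f := fun f => coeff_succ_X_mul 0 f
    have h3 : coeff 1 (X ^ 2 * derivative ℂ (coord m x)) = 0 := by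
      rw [coeff_X_pow_mul', if_neg (by omega)]
    rw [h3, add_zero, mul_assoc, coeff_C_mul, h2, mul_assoc, h2, mul_add, map_add, h2, h2,
      coeff_C_mul] at h1
    have h4 : coeff 0 (X * coord m z) = 0 := by simp
    rw [h4, add_zero] at h1
    rw [← h1]
    simp [mul_comm]
  have hex : ∃ m, m < k ∧ coeff 0 (coord m x) ≠ 0 := by
    by_contra! hcon
    apply hx
    refine ⟨ofCoord k _ _ fun m => PowerSeries.mk fun p => coeff (p + 1) (coord m x), ?_⟩
    apply coord_ext
    intro m hm
    rw [bMul, map_smul, coord_ofCoord hm, smul_eq_mul]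
    conv_lhs => rw [(coord m x).eq_X_mul_shift_add_const]
    have := hcon m hm
    rw [coeff_zero_eq_constantCoeff] at this
    rw [this, map_zero, add_zero]
  classical
  obtain ⟨m₀, hm₀k, hm₀⟩ := hex
  let P : ℕ → Prop := fun m => coeff 0 (coord m x) ≠ 0
  have hP : P (Nat.findGreatest P k) := Nat.findGreatest_spec (P := P) hm₀k.le hm₀
  set m := Nat.findGreatest P k with hm
  have hmk : m < k := by
    by_contra hc
    exact hP (by rw [coord_of_le (not_lt.1 hc), map_zero])
  have hnext : coeff 0 (coord (m + 1) x) = 0 := by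
    by_contra hc
    exact Nat.findGreatest_is_greatest (P := P) (Nat.lt_succ_self m) (by omega) hc
  refine ⟨m + 1, by omega, by omega, ?_⟩
  have h1 := hcoord m
  rw [hnext, mul_zero, add_zero, mul_comm] at h1
  exact (mul_right_cancel₀ hP h1).symm

theorem residueEigenvalue_satLam {j : ℕ} (hj : j < k) :
    IsResidueEigenvalue (satModule k lam S) (satLam k lam (j + 1) : ℚ) := by
  -- The matrix of b⁻¹a modulo b, minus the expected eigenvalue: it is triangular with a zero on the
  -- diagonal, hence has a nonzero kernel vector.
  let A : Matrix (Fin k) (Fin k) ℂ := fun m l =>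
    if l = m then (satLam k lam (m + 1) : ℂ) - (satLam k lam (j + 1) : ℂ)
    else if (l : ℕ) = m + 1 then coeff 0 (S (m + 1)) else 0
  have hA : A.det = 0 := by
    have : A.BlockTriangular id := by
      intro m l h
      simp only [id] at h
      have h' : (l : ℕ) < m := h
      simp only [A]
      rw [if_neg (fun h => by subst h; omega), if_neg (by omega)]
    rw [Matrix.det_of_isUpperTriangular this]
    exact Finset.prod_eq_zero (Finset.mem_univ ⟨j, hj⟩) (by simp [A])
  obtain ⟨v, hv0, hv⟩ := Matrix.exists_mulVec_eq_zero_iff.2 hA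
  let w : ℕ → ℂ := fun n => if h : n < k then v ⟨n, h⟩ else 0
  have hrow : ∀ m (_ : m < k), ((satLam k lam (m + 1) : ℂ) - (satLam k lam (j + 1) : ℂ)) * w m
      + coeff 0 (S (m + 1)) * w (m + 1) = 0 := by
    intro m hm
    have h1 := congrFun hv ⟨m, hm⟩
    simp only [Matrix.mulVec, dotProduct, Pi.zero_apply] at h1
    rw [← h1]
    have h2 : ∀ l : Fin k, A ⟨m, hm⟩ l * v l =
        (if l = ⟨m, hm⟩ then ((satLam k lam (m + 1) : ℂ) - (satLam k lam (j + 1) : ℂ)) * w m else 0)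
        + (if (l : ℕ) = m + 1 then coeff 0 (S (m + 1)) * w (m + 1) else 0) := by
      intro l
      simp only [A]
      by_cases h3 : l = ⟨m, hm⟩
      · subst h3
        rw [if_pos rfl, if_pos rfl, if_neg (by simp), add_zero]
        simp [w, hm]
      · rw [if_neg h3, if_neg h3, zero_add]
        by_cases h4 : (l : ℕ) = m + 1
        · rw [if_pos h4, if_pos h4]
          have h5 : w (m + 1) = v l := by
            simp only [w]
            rw [dif_pos (by omega)]
            congr 1
            ext
            exact h4.symm
          rw [h5]
        · rw [if_neg h4, if_neg h4, zero_mul]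
    rw [Finset.sum_congr rfl fun l _ => h2 l, Finset.sum_add_distrib, Finset.sum_ite_eq',
      if_pos (Finset.mem_univ _)]
    congr 1
    by_cases h6 : m + 1 < k
    · rw [Finset.sum_eq_single ⟨m + 1, h6⟩]
      · simp
      · intro l _ hl
        rw [if_neg]
        intro h7
        exact hl (Fin.ext h7)
      · intro h; exact absurd (Finset.mem_univ _) h
    · have : w (m + 1) = 0 := dif_neg h6
      rw [this, mul_zero]
      simp
  -- The kernel vector is lifted by constant series. The defect z then comes only from the
  -- non-constant parts of the S_j.
  refine ⟨ofCoord k _ _ fun n => C (w n), ?_, ofCoord k _ _ fun m =>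
    (PowerSeries.mk fun p => coeff (p + 1) (S (m + 1))) * C (w (m + 1)), ?_⟩
  · rintro ⟨y, hy⟩
    apply hv0
    funext m
    have := congrArg (fun z => coeff 0 (coord (m : ℕ) z)) hy
    simp only [bMul, map_smul, coord_ofCoord m.2] at this
    simp only [w, m.2, dif_pos] at this
    simpa using this
  · apply coord_ext
    intro m hm
    rw [coord_a, bMul, cMul, bMul, map_smul, map_add, map_smul, map_smul, coord_ofCoord hm,
      coord_ofCoord hm, derivative_C, mul_zero, add_zero]
    have h1 : coord (m + 1) (ofCoord k (satLam k lam) (fun j => X * S j) fun n => C (w n)) =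
        C (w (m + 1)) := by
      by_cases h6 : m + 1 < k
      · rw [coord_ofCoord h6]
      · rw [coord_of_le (not_lt.1 h6)]
        have : w (m + 1) = 0 := dif_neg h6
        rw [this, map_zero]
    rw [h1]
    have h2 : S (m + 1) = X * (PowerSeries.mk fun p => coeff (p + 1) (S (m + 1))) +
        C (coeff 0 (S (m + 1))) := by
      conv_lhs => rw [(S (m + 1)).eq_X_mul_shift_add_const]
      rw [coeff_zero_eq_constantCoeff]
    simp only [smul_eq_mul]
    have h3 : C (satLam k lam (m + 1) : ℂ) * C (w m) + C (coeff 0 (S (m + 1))) * C (w (m + 1))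
        = (C (satLam k lam (j + 1) : ℂ) * C (w m) : ℂ⟦X⟧) := by
      rw [← map_mul, ← map_mul, ← map_mul, ← map_add]
      congr 1
      linear_combination hrow m hm
    have h4 : ((satLam k lam (j + 1) : ℚ) : ℂ) = (satLam k lam (j + 1) : ℂ) := rfl
    linear_combination X * h3 + X * C (w (m + 1)) * h2

theorem IsResidueEigenvalue.of_iso {M M' : PreABModule} (h : Iso M M') {μ : ℂ}
    (hμ : IsResidueEigenvalue M μ) : IsResidueEigenvalue M' μ := by
  obtain ⟨φ, hφ⟩ := h
  obtain ⟨x, hx, z, hz⟩ := hμ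
  refine ⟨φ x, ?_, φ z, ?_⟩
  · rintro ⟨y, hy⟩
    refine hx ⟨φ.symm y, φ.injective ?_⟩
    rw [hy, bMul, bMul, map_smul, LinearEquiv.apply_symm_apply]
  · rw [← hφ, hz]
    simp only [bMul, cMul, map_smul, map_add]

/-- The saturation of a standard module is unique. -/
theorem iso_satModule (hS : ∀ j, 1 ≤ j → j < k → coeff 0 (S j) ≠ 0) {M : PreABModule}
    {ι : stdModule k lam S →ₗ[ℂ⟦X⟧] M} (h : IsSaturation (stdModule k lam S) M ι) :
    Iso (satModule k lam S) M := by
  -- In any saturation the image of e_{k-d} is divisible by b^d: each step divides a ε by b, which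
  -- the simple pole allows, and then by the unit S_{n+1}.
  have key : ∀ d, ∀ n, n + d + 1 = k → ∃ ε : M, (X ^ d : ℂ⟦X⟧) • ε = ι (stdBasis k lam S n) := by
    intro d
    induction d with
    | zero => intro n _; exact ⟨ι (stdBasis k lam S n), by simp⟩
    | succ d ih =>
      intro n hn
      obtain ⟨ε, hε⟩ := ih (n + 1) (by omega)
      obtain ⟨y, hy⟩ := h.simplePole ε
      have h1 := h.map_a (stdBasis k lam S (n + 1))
      rw [a_stdBasis_succ n (by omega), ← hε, M.a_smul, hy, map_add, map_smul, map_smul, ← hε,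
        derivative_pow, derivative_X, bMul] at h1
      have h2 : S (n + 1) • ι (stdBasis k lam S n) =
          (X ^ (d + 1) : ℂ⟦X⟧) • (y + ((d : ℂ⟦X⟧) - C (lam (n + 2) : ℂ)) • ε) := by
        rw [eq_sub_of_add_eq' h1]
        simp only [smul_add, smul_smul]
        have h3 : (X : ℂ⟦X⟧) ^ 2 * ((d : ℂ⟦X⟧) * (X : ℂ⟦X⟧) ^ (d - 1) * 1) =
            (X : ℂ⟦X⟧) ^ (d + 1) * (d : ℂ⟦X⟧) := by
          cases d with
          | zero => simp
          | succ d => rw [Nat.add_sub_cancel]; ring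
        rw [h3, mul_sub, sub_smul, ← pow_succ, add_sub_assoc]
        congr 3
        ring
      refine ⟨(S (n + 1))⁻¹ • (y + ((d : ℂ⟦X⟧) - C (lam (n + 2) : ℂ)) • ε), ?_⟩
      rw [smul_comm, ← h2, smul_smul, PowerSeries.inv_mul_cancel _
        (by simpa using hS (n + 1) (by omega) (by omega)), one_smul]
  choose! ε hε using fun n (hn : n < k) => key (k - 1 - n) n (by omega)
  let κ : satModule k lam S →ₗ[ℂ⟦X⟧] M :=
    ∑ n ∈ Finset.range k, (LinearMap.toSpanSingleton ℂ⟦X⟧ M (ε n)).comp (coord n)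
  have hκ : ∀ x, κ x = ∑ n ∈ Finset.range k, coord n x • ε n := by
    intro x
    simp [κ, LinearMap.sum_apply]
  have hκι : ∀ x, κ (satIncl k lam S x) = ι x := by
    intro x
    conv_rhs => rw [← sum_coord_smul x]
    rw [hκ, map_sum]
    refine Finset.sum_congr rfl fun n hn => ?_
    rw [coord_satIncl (Finset.mem_range.1 hn), map_smul, ← hε n (Finset.mem_range.1 hn), smul_smul,
      mul_comm]
  -- Since b^k carries the saturation into the original module, compatibility with a and injectivity
  -- can be checked there and divided by b^k.
  have hXk : ∀ x : satModule k lam S, ∃ y, (X ^ k : ℂ⟦X⟧) • x = satIncl k lam S y := by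
    intro x
    refine ⟨ofCoord k _ _ fun n => X ^ (n + 1) * coord n x, coord_ext fun m hm => ?_⟩
    rw [map_smul, coord_satIncl hm, coord_ofCoord hm, smul_eq_mul, ← mul_assoc, ← pow_add]
    congr 2
    omega
  have hXk0 : (X ^ k : ℂ⟦X⟧) ≠ 0 := pow_ne_zero _ X_ne_zero
  have hκa : ∀ x, κ ((satModule k lam S).a x) = M.a (κ x) := by
    intro x
    obtain ⟨y, hy⟩ := hXk x
    have h1 : κ ((satModule k lam S).a ((X ^ k : ℂ⟦X⟧) • x)) = M.a (κ ((X ^ k : ℂ⟦X⟧) • x)) := by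
      rw [hy, ← satIncl_a, hκι, hκι, h.map_a]
    rw [(satModule k lam S).a_smul, map_smul, M.a_smul, map_add, map_smul, map_smul] at h1
    exact h.abModule.smul_injective hXk0 (add_right_cancel h1)
  have hinj : Function.Injective κ := by
    rw [injective_iff_map_eq_zero]
    intro x hx
    obtain ⟨y, hy⟩ := hXk x
    have h1 : ι y = ι 0 := by rw [← hκι, ← hy, map_smul, hx, smul_zero, map_zero]
    rw [h.injective h1, map_zero] at hy
    exact isABModule_std.smul_eq_zero hXk0 hy
  -- The range contains the original module and is stable by b⁻¹a, so the generation property of M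
  -- makes it everything.
  have hsurj : Function.Surjective κ := by
    rw [← LinearMap.range_eq_top]
    apply h.generated
    · intro x
      exact ⟨_, hκι x⟩
    · rintro _ ⟨x, rfl⟩ y hy
      obtain ⟨z, hz⟩ := isSimplePole_satModule x
      refine ⟨z, h.abModule.smul_injective (T := (X : ℂ⟦X⟧)) X_ne_zero ?_⟩
      rw [← map_smul]
      change κ (bMul z) = bMul y
      rw [← hz, hκa, hy]
  exact ⟨LinearEquiv.ofBijective κ ⟨hinj, hsurj⟩, hκa⟩

theorem IsGeometric.of_iso {E E' : PreABModule} (h : Iso E E') (hE : IsGeometric E) :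
    IsGeometric E' := by
  refine ⟨hE.1.of_iso h, ?_⟩
  obtain ⟨φ, hφ⟩ := h
  obtain ⟨M, ι, hM, hμ⟩ := hE.2
  refine ⟨M, ι.comp φ.symm.toLinearMap, ⟨hM.abModule, hM.simplePole,
    hM.injective.comp φ.symm.injective, fun x => ?_, fun N hN hN' => ?_⟩, hμ⟩
  · have : φ.symm (E'.a x) = E.a (φ.symm x) := by
      rw [LinearEquiv.symm_apply_eq, hφ, LinearEquiv.apply_symm_apply]
    simp only [LinearMap.comp_apply, LinearEquiv.coe_coe, this, hM.map_a]
  · refine hM.generated N (fun x => ?_) hN'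
    simpa using hN (φ x)

/-- The geometric condition quantifies over some saturation. By uniqueness it may be read on the
explicit one, whose eigenvalues are exactly the numbers `satLam`. -/
theorem isGeometric_std_iff (hS : ∀ j, 1 ≤ j → j < k → coeff 0 (S j) ≠ 0) :
    IsGeometric (stdModule k lam S) ↔ ∀ j, 1 ≤ j → j ≤ k → 0 < satLam k lam j := by
  constructor
  · rintro ⟨-, M, ι, hM, hμ⟩ j hj hjk
    obtain ⟨q, hq, h⟩ := hμ _ ((residueEigenvalue_satLam (lam := lam) (S := S)
      (j := j - 1) (by omega)).of_iso (iso_satModule hS hM))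
    rw [Nat.sub_add_cancel hj] at h
    have h' : satLam k lam j = q := by exact_mod_cast h
    rwa [h']
  · intro h
    refine ⟨isABModule_std, _, _, isSaturation_std hS, fun μ hμ => ?_⟩
    obtain ⟨j, hj, hjk, rfl⟩ := residueEigenvalue_satModule hμ
    exact ⟨_, h j hj hjk, rfl⟩

end Geometric

/-! ### Presentations of frescos -/

section Presentation

variable {k : ℕ} {lam : ℕ → ℚ} {E : PreABModule} {F : ℕ → ABSub E}

/-- `ψ` identifies `F / G` with `E_μ`. -/
structure IsRankOneQuotient (F G : ABSub E) (μ : ℚ) (ψ : F.carrier →ₗ[ℂ⟦X⟧] ℂ⟦X⟧) : Prop where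
  surj : Function.Surjective ψ
  ker : ∀ x, ψ x = 0 ↔ (x : E) ∈ G.carrier
  map_a : ∀ x, ψ (F.subA x) = C (μ : ℂ) * X * ψ x + X ^ 2 * derivative ℂ (ψ x)

theorem exists_isRankOneQuotient {F G : ABSub E} {μ : ℚ} (h : Iso (subquot F G) (rankOne μ)) :
    ∃ ψ, IsRankOneQuotient F G μ ψ := by
  obtain ⟨f, hs, hk, ha⟩ := exists_linearMap_of_iso_subquot
    (E' := stdModule 1 (fun _ => μ) fun _ => 1) h
  have h0 : ∀ y : stdModule 1 (fun _ => μ) (fun _ => 1), coord 0 y = 0 ↔ y = 0 := by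
    intro y
    constructor
    · intro hy
      apply coord_ext
      intro n hn
      obtain rfl : n = 0 := by omega
      rw [hy, map_zero]
    · rintro rfl
      exact map_zero _
  refine ⟨(coord (k := 1) (lam := fun _ => μ) (S := fun _ => 1) 0).comp f, ?_, fun x => ?_,
    fun x => ?_⟩
  · intro T
    obtain ⟨x, hx⟩ := hs (ofCoord 1 _ _ fun _ => T)
    refine ⟨x, ?_⟩
    rw [LinearMap.comp_apply, hx]
    exact coord_ofCoord Nat.one_pos _
  · rw [LinearMap.comp_apply, h0, hk]
  · rw [LinearMap.comp_apply, LinearMap.comp_apply, ha]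
    refine (coord_a 0 (f x)).trans ?_
    rw [coord_of_le (n := 0 + 1) le_rfl, mul_zero, add_zero]

/-- The linear form of a rank one quotient is invertible on a generator, and can be normalized. -/
theorem IsRankOneQuotient.exists_normalized {F G : ABSub E} {μ : ℚ}
    {ψ : F.carrier →ₗ[ℂ⟦X⟧] ℂ⟦X⟧} (hψ : IsRankOneQuotient F G μ ψ) {f : E} (hf : f ∈ F.carrier)
    (hgen : ∀ N : ABSub E, f ∈ N.carrier → F.carrier ≤ N.carrier) :
    ∃ ψ', IsRankOneQuotient F G μ ψ' ∧ coeff 0 (ψ' ⟨f, hf⟩) = 1 := by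
  have hc : coeff 0 (ψ ⟨f, hf⟩) ≠ 0 := by
    intro hc
    -- If ψ(f) were divisible by b, the inverse image of (b) under ψ would be a sub-module
    -- containing f but not all of F: the operator λb + b²∂ maps every series into (b).
    let N : ABSub E :=
      { carrier := (Submodule.comap ψ (Ideal.span {X})).map F.carrier.subtype
        stable := by
          rintro _ ⟨x, hx, rfl⟩
          refine ⟨F.subA x, ?_, rfl⟩
          change ψ (F.subA x) ∈ (Ideal.span {X} : Ideal ℂ⟦X⟧)
          rw [hψ.map_a, Ideal.mem_span_singleton]
          exact Dvd.dvd.add (Dvd.intro (C (μ : ℂ) * ψ x) (by ring))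
            (Dvd.intro (X * derivative ℂ (ψ x)) (by ring)) }
    have hfN : f ∈ N.carrier := by
      refine ⟨⟨f, hf⟩, ?_, rfl⟩
      change ψ _ ∈ (Ideal.span {X} : Ideal ℂ⟦X⟧)
      rw [Ideal.mem_span_singleton, X_dvd_iff]
      simpa using hc
    obtain ⟨x, hx⟩ := hψ.surj 1
    obtain ⟨y, hy, hyx⟩ := hgen N hfN x.2
    obtain rfl : y = x := Subtype.ext hyx
    change ψ y ∈ (Ideal.span {X} : Ideal ℂ⟦X⟧) at hy
    rw [hx, Ideal.mem_span_singleton, X_dvd_iff] at hy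
    simp at hy
  set c := coeff 0 (ψ ⟨f, hf⟩)
  have hc' : (C c⁻¹ : ℂ⟦X⟧) * C c = 1 := by rw [← map_mul, inv_mul_cancel₀ hc, map_one]
  have hc0 : (C c⁻¹ : ℂ⟦X⟧) ≠ 0 := left_ne_zero_of_mul_eq_one hc'
  refine ⟨(C c⁻¹ : ℂ⟦X⟧) • ψ, ⟨fun T => ?_, fun x => ?_, fun x => ?_⟩, ?_⟩
  · obtain ⟨x, hx⟩ := hψ.surj (C c * T)
    refine ⟨x, ?_⟩
    rw [LinearMap.smul_apply, hx, smul_eq_mul, ← mul_assoc, hc', one_mul]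
  · rw [LinearMap.smul_apply, smul_eq_mul, mul_eq_zero, ← hψ.ker]
    simp [hc0]
  · simp only [LinearMap.smul_apply, smul_eq_mul, hψ.map_a, Derivation.leibniz, derivative_C]
    ring
  · rw [LinearMap.smul_apply, smul_eq_mul, coeff_C_mul]
    exact inv_mul_cancel₀ hc

/-- Vectors adapted to a flag and forming a standard presentation, up to the last series `S j`. -/
structure IsPresentation (F : ℕ → ABSub E) (lam : ℕ → ℚ) (j : ℕ) (e : ℕ → E) (S : ℕ → ℂ⟦X⟧) :
    Prop where
  mem : ∀ n < j, e n ∈ (F (n + 1)).carrier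
  gen : ∀ n < j, ∀ x ∈ (F (n + 1)).carrier, ∃ c : ℂ⟦X⟧, x - c • e n ∈ (F n).carrier
  indep : ∀ n < j, ∀ c : ℂ⟦X⟧, c • e n ∈ (F n).carrier → c = 0
  coeff_zero : ∀ n, 1 ≤ n → n ≤ j → coeff 0 (S n) = 1
  a_zero : 0 < j → E.a (e 0) = (C (lam 1 : ℂ) * X) • e 0
  a_succ : ∀ n, n + 1 < j →
    E.a (e (n + 1)) = (C (lam (n + 2) : ℂ) * X) • e (n + 1) + S (n + 1) • e n

/-- The generator f of F_j is kept arbitrary so that the induction can pass from F_{j+1} to F_j.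
Modulo F_j it is a series u with u(0) = 1 in the basis of E_{λ_{j+1}}. Then e_{j+1} = u⁻¹ f
satisfies a e_{j+1} ≡ λ_{j+1} b e_{j+1}, and the defect f' generates F_j in its turn; u is recorded
as the last series S_{j+1}. -/
theorem exists_isPresentation (hbot : (F 0).carrier = ⊥)
    (hmono : ∀ j < k, (F j).carrier ≤ (F (j + 1)).carrier)
    (hquot : ∀ j, 1 ≤ j → j ≤ k → Iso (subquot (F j) (F (j - 1))) (rankOne (lam j))) :
    ∀ j ≤ k, ∀ f ∈ (F j).carrier, (∀ N : ABSub E, f ∈ N.carrier → (F j).carrier ≤ N.carrier) →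
      ∃ e S, IsPresentation F lam j e S ∧ (1 ≤ j → f = S j • e (j - 1)) := by
  intro j
  induction j with
  | zero =>
    intro _ f _ _
    exact ⟨fun _ => 0, fun _ => 1, ⟨fun n hn => absurd hn (Nat.not_lt_zero _),
      fun n hn => absurd hn (Nat.not_lt_zero _), fun n hn => absurd hn (Nat.not_lt_zero _),
      fun n h h' => by omega, fun h => absurd h (Nat.not_lt_zero _), fun n hn => by omega⟩,
      fun h => by omega⟩
  | succ j ih =>
    intro hj f hf hgen
    obtain ⟨ψ₀, hψ₀⟩ := exists_isRankOneQuotient (hquot (j + 1) (by omega) hj)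
    rw [Nat.add_sub_cancel] at hψ₀
    obtain ⟨ψ, hψ, hψf⟩ := hψ₀.exists_normalized hf hgen
    set u := ψ ⟨f, hf⟩ with hu
    have hu1 : u⁻¹ * u = 1 := PowerSeries.inv_mul_cancel _ (by simpa using hψf.trans_ne one_ne_zero)
    obtain ⟨e₀, he₀⟩ : ∃ e₀ : E, e₀ = u⁻¹ • f := ⟨_, rfl⟩
    have he₀F : e₀ ∈ (F (j + 1)).carrier := he₀ ▸ Submodule.smul_mem _ _ hf
    have hψe : ψ ⟨e₀, he₀F⟩ = 1 := by
      have : (⟨e₀, he₀F⟩ : (F (j + 1)).carrier) = u⁻¹ • ⟨f, hf⟩ := Subtype.ext he₀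
      rw [this, map_smul, smul_eq_mul, ← hu, hu1]
    have hfe : f = u • e₀ := by rw [he₀, smul_smul, mul_comm, hu1, one_smul]
    set f' : E := E.a e₀ - (C (lam (j + 1) : ℂ) * X) • e₀ with hf'
    have hf'F : f' ∈ (F j).carrier := by
      rw [show f' = (((F (j + 1)).subA ⟨e₀, he₀F⟩ -
        (C (lam (j + 1) : ℂ) * X) • ⟨e₀, he₀F⟩ : (F (j + 1)).carrier) : E) from rfl, ← hψ.ker,
        map_sub, map_smul, hψ.map_a, hψe, smul_eq_mul]
      simp
    have hgen' : ∀ N : ABSub E, f' ∈ N.carrier → (F j).carrier ≤ N.carrier := by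
      intro N hN
      -- The projection x ↦ x - ψ(x) e₀ satisfies q(a x) = a q(x) + ψ(x) f'. Hence q⁻¹(N) is a
      -- sub-module if N contains f'. It contains f because q(f) = 0, so it is all of F_{j+1}, and q
      -- is the identity on F_j.
      let q : (F (j + 1)).carrier →ₗ[ℂ⟦X⟧] E :=
        (F (j + 1)).carrier.subtype - (LinearMap.toSpanSingleton ℂ⟦X⟧ E e₀).comp ψ
      have hq : ∀ x, q x = x - ψ x • e₀ := fun x => by simp [q]
      let N' : ABSub E :=
        { carrier := (Submodule.comap q N.carrier).map (F (j + 1)).carrier.subtype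
          stable := by
            rintro _ ⟨x, hx, rfl⟩
            refine ⟨(F (j + 1)).subA x, ?_, rfl⟩
            change q _ ∈ N.carrier at hx ⊢
            have h1 := N.carrier.add_mem (N.stable _ hx) (N.carrier.smul_mem (ψ x) hN)
            convert h1 using 1
            rw [hq, hq, hψ.map_a, map_sub, E.a_smul, hf']
            change E.a x - _ = _
            rw [smul_sub, smul_smul, add_smul]
            have h2 : C (lam (j + 1) : ℂ) * X * ψ x = ψ x * (C (lam (j + 1) : ℂ) * X) := by ring
            rw [h2]
            abel }
      intro x hx
      have hx' := hmono j (by omega) hx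
      have h1 : f ∈ N'.carrier := by
        refine ⟨⟨f, hf⟩, ?_, rfl⟩
        change q _ ∈ N.carrier
        rw [hq, ← hu, ← hfe, sub_self]
        exact N.carrier.zero_mem
      obtain ⟨y, hy, hyx⟩ := hgen N' h1 hx'
      obtain rfl : y = ⟨x, hx'⟩ := Subtype.ext hyx
      change q _ ∈ N.carrier at hy
      rwa [hq, (hψ.ker ⟨x, hx'⟩).2 hx, zero_smul, sub_zero] at hy
    obtain ⟨e, S, hp, hl⟩ := ih (by omega) f' hf'F hgen'
    have hen : ∀ n < j, Function.update e j e₀ n = e n := fun n hn =>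
      Function.update_of_ne (by omega) _ _
    have hSn : ∀ n ≤ j, Function.update S (j + 1) u n = S n := fun n hn =>
      Function.update_of_ne (by omega) _ _
    have hee : Function.update e j e₀ j = e₀ := Function.update_self _ _ _
    have hEa : E.a e₀ = (C (lam (j + 1) : ℂ) * X) • e₀ + f' := by rw [hf']; abel
    refine ⟨Function.update e j e₀, Function.update S (j + 1) u,
      ⟨fun n hn => ?_, fun n hn => ?_, fun n hn => ?_, fun n h1 hn => ?_, fun _ => ?_,
      fun n hn => ?_⟩, fun _ => ?_⟩
    · rcases Nat.lt_succ_iff_lt_or_eq.1 hn with h | rfl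
      · rw [hen n h]; exact hp.mem n h
      · rw [hee]; exact he₀F
    · rcases Nat.lt_succ_iff_lt_or_eq.1 hn with h | rfl
      · rw [hen n h]; exact hp.gen n h
      · intro x hx
        refine ⟨ψ ⟨x, hx⟩, ?_⟩
        rw [hee, show x - ψ ⟨x, hx⟩ • e₀ = ((⟨x, hx⟩ - ψ ⟨x, hx⟩ • ⟨e₀, he₀F⟩ :
          (F (n + 1)).carrier) : E) from rfl, ← hψ.ker, map_sub, map_smul, hψe, smul_eq_mul,
          mul_one, sub_self]
    · rcases Nat.lt_succ_iff_lt_or_eq.1 hn with h | rfl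
      · rw [hen n h]; exact hp.indep n h
      · intro c hc
        rw [hee, show c • e₀ = ((c • ⟨e₀, he₀F⟩ : (F (n + 1)).carrier) : E) from rfl, ← hψ.ker,
          map_smul, hψe, smul_eq_mul, mul_one] at hc
        exact hc
    · rcases Nat.le_or_eq_of_le_succ hn with h | rfl
      · rw [hSn n h]; exact hp.coeff_zero n h1 h
      · rw [Function.update_self]; exact hψf
    · rcases Nat.eq_zero_or_pos j with rfl | h
      · rw [hee, hEa]
        rw [hbot, Submodule.mem_bot] at hf'F
        rw [hf'F, add_zero]
      · rw [hen 0 h]; exact hp.a_zero h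
    · rcases Nat.lt_succ_iff_lt_or_eq.1 hn with h | rfl
      · rw [hen _ h, hen n (by omega), hSn _ h.le]; exact hp.a_succ n h
      · rw [hee, hen n (by omega), hSn _ le_rfl, hEa]
        congr 1
        simpa using hl (by omega)
    · rw [Function.update_self, Nat.add_sub_cancel, hee]
      exact hfe

theorem exists_iso_of_isPresentation (hbot : (F 0).carrier = ⊥) (htop : (F k).carrier = ⊤)
    (hmono : ∀ j < k, (F j).carrier ≤ (F (j + 1)).carrier) {e : ℕ → E} {S : ℕ → ℂ⟦X⟧}
    (hp : IsPresentation F lam k e S) :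
    ∃ φ : E ≃ₗ[ℂ⟦X⟧] stdModule k lam S, (∀ x, φ (E.a x) = (stdModule k lam S).a (φ x)) ∧
      ∀ j ≤ k, ∀ x, x ∈ (F j).carrier ↔ φ x ∈ (stdFlag k lam S j).carrier := by
  let Φ : stdModule k lam S →ₗ[ℂ⟦X⟧] E :=
    ∑ n ∈ Finset.range k, (LinearMap.toSpanSingleton ℂ⟦X⟧ E (e n)).comp (coord n)
  have hΦ : ∀ x, Φ x = ∑ n ∈ Finset.range k, coord n x • e n := by
    intro x
    simp [Φ, LinearMap.sum_apply]
  have hΦe : ∀ n < k, Φ (stdBasis k lam S n) = e n := by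
    intro n hn
    rw [hΦ, Finset.sum_eq_single n]
    · rw [coord_stdBasis_self hn, one_smul]
    · intro m _ hm
      rw [coord_stdBasis_of_ne hm, zero_smul]
    · intro h; exact absurd (Finset.mem_range.2 hn) h
  have hΦae : ∀ n < k, Φ ((stdModule k lam S).a (stdBasis k lam S n)) = E.a (e n) := by
    intro n hn
    cases n with
    | zero => rw [a_stdBasis_zero 0 rfl, map_smul, hΦe 0 hn, hp.a_zero hn]
    | succ n =>
      rw [a_stdBasis_succ n hn, map_add, map_smul, map_smul, hΦe _ hn, hΦe n (by omega),
        hp.a_succ n hn]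
  have hΦa : ∀ x, Φ ((stdModule k lam S).a x) = E.a (Φ x) := by
    intro x
    conv_lhs => rw [← sum_coord_smul x]
    rw [hΦ x, map_sum, map_sum, map_sum]
    refine Finset.sum_congr rfl fun n hn => ?_
    rw [PreABModule.a_smul, PreABModule.a_smul, map_add, map_smul, map_smul,
      hΦae n (Finset.mem_range.1 hn), hΦe n (Finset.mem_range.1 hn)]
  have hle : ∀ i j, i ≤ j → j ≤ k → (F i).carrier ≤ (F j).carrier := by
    intro i j hij
    induction j, hij using Nat.le_induction with
    | base => exact fun _ => le_rfl
    | succ j _ ih => exact fun hj => (ih (by omega)).trans (hmono j (by omega))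
  have hflag : ∀ j ≤ k, ∀ y ∈ (stdFlag k lam S j).carrier, Φ y ∈ (F j).carrier := by
    intro j hj y hy
    rw [hΦ]
    refine Submodule.sum_mem _ fun n hn => ?_
    by_cases h : n < j
    · exact Submodule.smul_mem _ _ (hle _ _ h hj (hp.mem n (Finset.mem_range.1 hn)))
    · rw [hy n (not_lt.1 h), zero_smul]
      exact Submodule.zero_mem _
  have hsurj : ∀ j ≤ k, ∀ x ∈ (F j).carrier, ∃ y, Φ y = x := by
    intro j
    induction j with
    | zero =>
      intro _ x hx
      rw [hbot, Submodule.mem_bot] at hx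
      exact ⟨0, by rw [map_zero, hx]⟩
    | succ j ih =>
      intro hj x hx
      obtain ⟨c, hc⟩ := hp.gen j (by omega) x hx
      obtain ⟨y, hy⟩ := ih (by omega) _ hc
      refine ⟨y + c • stdBasis k lam S j, ?_⟩
      rw [map_add, map_smul, hΦe j (by omega), hy, sub_add_cancel]
  -- Strictness with respect to the flags: `indep` kills the highest coordinate of y, one index at a
  -- time. The case j = 0 is injectivity.
  have hstrict : ∀ j d, ∀ y ∈ (stdFlag k lam S (j + d)).carrier, Φ y ∈ (F j).carrier →
      y ∈ (stdFlag k lam S j).carrier := by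
    intro j d
    induction d with
    | zero => exact fun y hy _ => hy
    | succ d ih =>
      intro y hy hΦy
      apply ih y _ hΦy
      intro m hm
      rcases hm.eq_or_lt with rfl | hm
      · by_cases hk : j + d < k
        · let y' := y - coord (j + d) y • stdBasis k lam S (j + d)
          have hy' : y' ∈ (stdFlag k lam S (j + d)).carrier := by
            intro m hm
            rw [map_sub, map_smul]
            rcases hm.eq_or_lt with rfl | hm
            · rw [coord_stdBasis_self hk, smul_eq_mul, mul_one, sub_self]
            · rw [hy m hm, coord_stdBasis_of_ne hm.ne', smul_zero, sub_zero]
          have h1 := hflag _ hk.le y' hy'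
          have h2 := Submodule.sub_mem _ (hle j (j + d) (by omega) hk.le hΦy) h1
          rw [← map_sub, sub_sub_cancel, map_smul, hΦe _ hk] at h2
          exact hp.indep _ hk _ h2
        · exact coord_of_le (not_lt.1 hk) y
      · exact hy m hm
  have hmemk : ∀ y, y ∈ (stdFlag k lam S k).carrier := fun y m hm => coord_of_le hm y
  have hinj : Function.Injective Φ := by
    rw [injective_iff_map_eq_zero]
    intro y hy
    have := hstrict 0 k y (by rw [zero_add]; exact hmemk y) (by rw [hy]; exact Submodule.zero_mem _)
    exact coord_ext fun n _ => by rw [this n (Nat.zero_le n), map_zero]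
  have hbij : Function.Bijective Φ :=
    ⟨hinj, fun x => hsurj k le_rfl x (by rw [htop]; trivial)⟩
  let ψ := LinearEquiv.ofBijective Φ hbij
  have hψ : ∀ x, Φ (ψ.symm x) = x := fun x => ψ.apply_symm_apply x
  refine ⟨ψ.symm, fun x => hinj ?_, fun j hj x => ⟨fun hx => ?_, fun hx => ?_⟩⟩
  · rw [hΦa, hψ, hψ]
  · refine hstrict j (k - j) _ ?_ (by rwa [hψ])
    rw [Nat.add_sub_cancel' hj]
    exact hmemk _
  · rw [← hψ x]
    exact hflag j hj _ hx

/-- A monogenic module with a principal Jordan-Hölder sequence has a standard presentation adapted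
to this sequence. -/
theorem exists_iso_std {r : AddCircle (1 : ℚ) → AddCircle (1 : ℚ) → Prop} (hE : IsMonogenic E)
    (hF : IsPrincipalJH r k lam E F) :
    ∃ S : ℕ → ℂ⟦X⟧, (∀ n, 1 ≤ n → n < k → coeff 0 (S n) = 1) ∧
      ∃ φ : E ≃ₗ[ℂ⟦X⟧] stdModule k lam S, (∀ x, φ (E.a x) = (stdModule k lam S).a (φ x)) ∧
        ∀ j ≤ k, ∀ x, x ∈ (F j).carrier ↔ φ x ∈ (stdFlag k lam S j).carrier := by
  obtain ⟨f, hf⟩ := hE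
  obtain ⟨e, S, hp, -⟩ := exists_isPresentation hF.bot hF.mono hF.quotient k le_rfl f
    (by rw [hF.top]; trivial) (fun N hN => by rw [hf N hN]; exact le_top)
  exact ⟨S, fun n h1 h2 => hp.coeff_zero n h1 h2.le,
    exists_iso_of_isPresentation hF.bot hF.top hF.mono hp⟩

end Presentation

/-! ### Isomorphisms of standard modules and the invariants `γ` -/

theorem coeff_zero_euler (c : ℂ) (f : ℂ⟦X⟧) :
    coeff 0 (C c * X * f + X ^ 2 * derivative ℂ f) = 0 := by simp

/-- The operator λb + b²∂ sends b^q to (λ + q) b^{q+1}. All coefficient computations below rest on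
this. -/
theorem coeff_succ_euler (c : ℂ) (f : ℂ⟦X⟧) (q : ℕ) :
    coeff (q + 1) (C c * X * f + X ^ 2 * derivative ℂ f) = (c + q) * coeff q f := by
  rw [map_add, mul_assoc, coeff_C_mul, coeff_succ_X_mul, pow_two, mul_assoc, coeff_succ_X_mul]
  cases q with
  | zero => simp
  | succ q =>
    rw [coeff_succ_X_mul, coeff_derivative]
    push_cast
    ring

theorem coeff_one_mul' (f g : ℂ⟦X⟧) :
    coeff 1 (f * g) = coeff 0 f * coeff 1 g + coeff 1 f * coeff 0 g := by
  rw [coeff_mul, Finset.Nat.sum_antidiagonal_eq_sum_range_succ_mk]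
  simp [Finset.sum_range_succ]

theorem coeff_zero_mul' (f g : ℂ⟦X⟧) : coeff 0 (f * g) = coeff 0 f * coeff 0 g := by
  simp

section Invariants

variable {k : ℕ} {lam : ℕ → ℚ} {S S' : ℕ → ℂ⟦X⟧}

/-- `γ_h`, computed from a presentation. -/
def gammaOf (lam : ℕ → ℚ) (S : ℕ → ℂ⟦X⟧) (h : ℕ) : ℂ :=
  ((pNum lam (h + 1) : ℂ) - 1) * coeff 1 (S h) - ((pNum lam h : ℂ) - 1) * coeff 1 (S (h + 1))

/-- `π_{i,j}`, computed from a presentation. -/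
def piOf (lam : ℕ → ℚ) (S : ℕ → ℂ⟦X⟧) (i j : ℕ) : ℂ :=
  weightFactor lam j * gammaOf lam S i - weightFactor lam i * gammaOf lam S j

section

variable {r : AddCircle (1 : ℚ) → AddCircle (1 : ℚ) → Prop}
  [IsStrictTotalOrder (AddCircle (1 : ℚ)) r]

theorem IsPrincipalSeq.not_rel (h : IsPrincipalSeq r k lam) {i j : ℕ} (hi : 1 ≤ i) (hij : i ≤ j)
    (hj : j ≤ k) : ¬ r (lam j : AddCircle (1 : ℚ)) (lam i : AddCircle (1 : ℚ)) := by
  induction j, hij using Nat.le_induction with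
  | base => exact irrefl _
  | succ j hij ih =>
    intro hr
    have h1 := ih (by omega)
    have h2 := h.classes j (by omega) (by omega)
    rcases trichotomous_of r (lam j : AddCircle (1 : ℚ)) (lam (j + 1) : AddCircle (1 : ℚ)) with
      h3 | h3 | h3
    · exact h1 (_root_.trans h3 hr)
    · rw [← h3] at hr; exact h1 hr
    · exact h2 h3

/-- As the classes are weakly increasing, equality at i and j forces the same class at every index
between them, so the inequalities of consecutive terms can be chained. -/
theorem IsPrincipalSeq.le_of_class_eq (h : IsPrincipalSeq r k lam) {i j : ℕ} (hi : 1 ≤ i)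
    (hij : i ≤ j) (hj : j ≤ k)
    (he : (lam i : AddCircle (1 : ℚ)) = (lam j : AddCircle (1 : ℚ))) :
    lam i + i ≤ lam j + j := by
  have hall : ∀ m, i ≤ m → m ≤ j →
      (lam m : AddCircle (1 : ℚ)) = (lam i : AddCircle (1 : ℚ)) := by
    intro m him hmj
    have h1 := h.not_rel hi him (by omega)
    have h2 := h.not_rel (by omega) hmj hj
    rw [← he] at h2
    rcases trichotomous_of r (lam m : AddCircle (1 : ℚ)) (lam i : AddCircle (1 : ℚ)) with
      h3 | h3 | h3
    · exact absurd h3 h1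
    · exact h3
    · exact absurd h3 h2
  clear he
  induction j, hij using Nat.le_induction with
  | base => exact le_rfl
  | succ j hij ih =>
    refine (ih (by omega) fun m h1 h2 => hall m h1 (by omega)).trans ?_
    have := h.inside j (by omega) (by omega)
      ((hall j hij (by omega)).trans (hall (j + 1) (by omega) le_rfl).symm)
    push_cast
    exact this

/-- An eigenvector of `b⁻¹a` modulo `F_j` for the eigenvalue `λ_{j+1}` is in `F_{j+1}`. -/
theorem coord_eq_zero_of_eigen (hlam : IsPrincipalSeq r k lam)
    (hS : ∀ n, 1 ≤ n → n < k → coeff 0 (S n) = 1) {j : ℕ} (x : stdModule k lam S)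
    (hx : ∀ n, j ≤ n → n < k →
      coord n ((stdModule k lam S).a x) = C (lam (j + 1) : ℂ) * X * coord n x) :
    ∀ n, j < n → coord n x = 0 := by
  by_contra! hcon
  classical
  obtain ⟨n₀, hn₀, hxn₀⟩ := hcon
  have hn₀k : n₀ < k := by
    by_contra hc
    exact hxn₀ (coord_of_le (not_lt.1 hc) x)
  let P : ℕ → Prop := fun m => coord m x ≠ 0
  have hP : P (Nat.findGreatest P k) := Nat.findGreatest_spec (P := P) hn₀k.le hxn₀
  have hge : n₀ ≤ Nat.findGreatest P k := Nat.le_findGreatest (P := P) hn₀k.le hxn₀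
  set m := Nat.findGreatest P k with hm
  have hmk : m < k := by
    by_contra hc
    exact hP (coord_of_le (not_lt.1 hc) x)
  have hnext : coord (m + 1) x = 0 := by
    by_contra hc
    exact Nat.findGreatest_is_greatest (P := P) (Nat.lt_succ_self m) (by omega) hc
  have heq : ∀ n, j ≤ n → n < k → ∀ q,
      ((lam (n + 1) : ℂ) - lam (j + 1) + q) * coeff q (coord n x)
        + coeff (q + 1) (S (n + 1) * coord (n + 1) x) = 0 := by
    intro n h1 h2 q
    have h3 := congrArg (coeff (q + 1)) (hx n h1 h2)
    rw [coord_a, map_add, coeff_succ_euler, mul_assoc, coeff_C_mul, coeff_succ_X_mul] at h3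
    linear_combination h3
  have heq0 : ∀ n, j ≤ n → n < k → coeff 0 (S (n + 1) * coord (n + 1) x) = 0 := by
    intro n h1 h2
    have h3 := congrArg (coeff 0) (hx n h1 h2)
    rw [coord_a, map_add, coeff_zero_euler, zero_add] at h3
    rw [h3]
    simp
  have hjm : j < m := lt_of_lt_of_le hn₀ hge
  -- On the highest nonzero coordinate the equation is homogeneous: degree q can occur only if q =
  -- λ_{j+1} - λ_{m+1}. The two classes then agree, and the monotonicity of λ_n + n bounds q by m -
  -- j.
  have htopm : ∃ q ≤ m - j, coeff q (coord m x) ≠ 0 := by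
    obtain ⟨q, hq⟩ : ∃ q, coeff q (coord m x) ≠ 0 := by
      by_contra! hcon
      exact hP (PowerSeries.ext fun q => by rw [hcon q, map_zero])
    refine ⟨q, ?_, hq⟩
    have h1 := heq m hjm.le hmk q
    rw [hnext, mul_zero, map_zero, add_zero] at h1
    have h2 := (mul_eq_zero.1 h1).resolve_right hq
    have h3 : lam (m + 1) - lam (j + 1) + q = 0 := by exact_mod_cast h2
    have h4 : (lam (j + 1) : AddCircle (1 : ℚ)) = (lam (m + 1) : AddCircle (1 : ℚ)) := by
      have : lam (j + 1) = lam (m + 1) + q • (1 : ℚ) := by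
        rw [nsmul_eq_mul, mul_one]; linarith
      rw [this, AddCircle.coe_add, AddCircle.coe_nsmul, AddCircle.coe_period, smul_zero, add_zero]
    have h5 := hlam.le_of_class_eq (by omega) (by omega) (by omega) h4
    push_cast at h5
    have h6 : (q : ℚ) + j ≤ m := by linarith
    have h7 : q + j ≤ m := by exact_mod_cast h6
    omega
  -- Going down one index lowers the order by at least one. The lowest term of the coordinate n + 1
  -- survives multiplication by S_{n+1} and must be cancelled by the coordinate n, one degree lower.
  have hstep : ∀ n, j ≤ n → n + 1 < k → (∃ q ≤ n + 1 - j, coeff q (coord (n + 1) x) ≠ 0) →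
      ∃ q, q + 1 ≤ n + 1 - j ∧ ((lam (n + 1) : ℂ) - lam (j + 1) + q) * coeff q (coord n x) ≠ 0 := by
    rintro n hjn hnk ⟨q, hq, hqx⟩
    have hex : ∃ q, coeff q (coord (n + 1) x) ≠ 0 := ⟨q, hqx⟩
    have hmin : ∀ p < Nat.find hex, coeff p (coord (n + 1) x) = 0 := fun p hp => by
      simpa using Nat.find_min hex hp
    have hfind := Nat.find_spec hex
    have hle : Nat.find hex ≤ q := Nat.find_min' hex hqx
    generalize Nat.find hex = p at hmin hfind hle
    have hcoef : coeff p (S (n + 1) * coord (n + 1) x) = coeff p (coord (n + 1) x) := by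
      rw [coeff_mul, Finset.sum_eq_single (0, p)]
      · simp only
        rw [hS (n + 1) (by omega) hnk, one_mul]
      · rintro ⟨u, v⟩ huv hne
        rw [Finset.HasAntidiagonal.mem_antidiagonal] at huv
        simp only at huv ⊢
        rw [hmin v, mul_zero]
        by_contra hc
        apply hne
        ext <;> simp only <;> omega
      · intro h
        exact absurd (Finset.HasAntidiagonal.mem_antidiagonal.2 (zero_add p)) h
    cases p with
    | zero => exact absurd (hcoef.symm.trans (heq0 n hjn (by omega))) hfind
    | succ p =>
      refine ⟨p, by omega, fun h0 => hfind ?_⟩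
      have := heq n hjn (by omega) p
      rw [h0, zero_add] at this
      rw [← hcoef, this]
  have hdesc : ∀ d, ∀ n, n + d = m → j < n → ∃ q ≤ n - j, coeff q (coord n x) ≠ 0 := by
    intro d
    induction d with
    | zero =>
      rintro n hn _
      obtain rfl : n = m := by omega
      exact htopm
    | succ d ih =>
      intro n hn hjn
      obtain ⟨q, hq, h⟩ := hstep n hjn.le (by omega) (ih (n + 1) (by omega) (by omega))
      exact ⟨q, by omega, right_ne_zero_of_mul h⟩
  -- At index j the bound forces q = 0, but there the factor λ_{j+1} - λ_{j+1} + q vanishes.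
  obtain ⟨q, hq, h⟩ := hstep j le_rfl (by omega) (hdesc (m - (j + 1)) (j + 1) (by omega) (by omega))
  obtain rfl : q = 0 := by omega
  simp at h

/-- The image of `e_{j+1}` under a morphism of standard modules is in the flag. -/
theorem coord_map_stdBasis_eq_zero (hlam : IsPrincipalSeq r k lam)
    (hS' : ∀ n, 1 ≤ n → n < k → coeff 0 (S' n) = 1)
    (φ : stdModule k lam S →ₗ[ℂ⟦X⟧] stdModule k lam S')
    (hφ : ∀ x, φ ((stdModule k lam S).a x) = (stdModule k lam S').a (φ x)) (j : ℕ) :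
    ∀ n, j < n → coord n (φ (stdBasis k lam S j)) = 0 := by
  induction j with
  | zero =>
    apply coord_eq_zero_of_eigen hlam hS'
    intro n _ _
    rw [← hφ, a_stdBasis_zero 0 rfl, map_smul, map_smul, smul_eq_mul]
  | succ j ih =>
    by_cases hj : j + 1 < k
    · apply coord_eq_zero_of_eigen hlam hS'
      intro n hn _
      rw [← hφ, a_stdBasis_succ j hj, map_add, map_add, map_smul, map_smul, map_smul, map_smul,
        ih n (by omega), smul_zero, add_zero, smul_eq_mul]
    · exact fun n hn => coord_of_le (by omega) _

/-- `γ_h` is an invariant of the isomorphism class. -/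
theorem gammaOf_eq_of_iso (hlam : IsPrincipalSeq r k lam)
    (hS : ∀ n, 1 ≤ n → n < k → coeff 0 (S n) = 1) (hS' : ∀ n, 1 ≤ n → n < k → coeff 0 (S' n) = 1)
    (hiso : Iso (stdModule k lam S) (stdModule k lam S')) {h : ℕ} (hh : 1 ≤ h) (hk : h + 2 ≤ k) :
    gammaOf lam S h = gammaOf lam S' h := by
  obtain ⟨φ, hφ⟩ := hiso
  have htri := coord_map_stdBasis_eq_zero hlam hS' φ.toLinearMap hφ
  simp only [LinearEquiv.coe_coe] at htri
  let g : ℕ → ℕ → ℂ⟦X⟧ := fun n j => coord n (φ (stdBasis k lam S j))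
  have htri' : ∀ j n, j < n → g n j = 0 := htri
  have heq : ∀ j n, j + 1 < k →
      C (lam (n + 1) : ℂ) * X * g n (j + 1) + X ^ 2 * derivative ℂ (g n (j + 1))
        + S' (n + 1) * g (n + 1) (j + 1)
      = C (lam (j + 2) : ℂ) * X * g n (j + 1) + S (j + 1) * g n j := by
    intro j n hj
    have h1 := congrArg (coord n) (hφ (stdBasis k lam S (j + 1)))
    rw [coord_a, a_stdBasis_succ j hj, map_add, map_add, map_smul, map_smul, map_smul, map_smul,
      smul_eq_mul, smul_eq_mul] at h1
    exact h1.symm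
  have heqc : ∀ j n q, j + 1 < k →
      ((lam (n + 1) : ℂ) - lam (j + 2) + q) * coeff q (g n (j + 1))
        + coeff (q + 1) (S' (n + 1) * g (n + 1) (j + 1)) = coeff (q + 1) (S (j + 1) * g n j) := by
    intro j n q hj
    have h1 := congrArg (coeff (q + 1)) (heq j n hj)
    rw [map_add, coeff_succ_euler, map_add, mul_assoc, coeff_C_mul, coeff_succ_X_mul] at h1
    linear_combination h1
  have heqz : ∀ j n, j + 1 < k → n + 1 < k →
      coeff 0 (g (n + 1) (j + 1)) = coeff 0 (g n j) := by
    intro j n hj hn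
    have h1 := congrArg (coeff 0) (heq j n hj)
    rw [map_add, coeff_zero_euler, map_add, coeff_zero_mul', coeff_zero_mul', coeff_zero_mul',
      coeff_zero_mul', hS _ (by omega) hj, hS' _ (by omega) hn] at h1
    simpa using h1
  -- On the diagonal the terms λ_{j+1} b cancel and triangularity removes the couplings. There
  -- remains b² g' = 0, so the entry is constant.
  have hd : ∀ j, j < k → coeff 1 (g j j) = 0 := by
    intro j hj
    have h0 : derivative ℂ (g j j) = 0 := by
      have h2 : X ^ 2 * derivative ℂ (g j j) = 0 := by
        cases j with
        | zero =>
          have h1 := congrArg (coord 0) (hφ (stdBasis k lam S 0))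
          rw [coord_a, a_stdBasis_zero 0 rfl, map_smul, map_smul, smul_eq_mul] at h1
          have h3 : coord (0 + 1) (φ (stdBasis k lam S 0)) = 0 := htri 0 1 Nat.one_pos
          rw [h3] at h1
          linear_combination -h1
        | succ j =>
          have h1 := heq j (j + 1) hj
          rw [htri' _ _ (Nat.lt_succ_self _), htri' _ _ (Nat.lt_succ_self _)] at h1
          linear_combination h1
      exact (mul_eq_zero.1 h2).resolve_left (pow_ne_zero _ X_ne_zero)
    have := coeff_derivative (g j j) 0
    rw [h0, map_zero] at this
    simpa using this.symm
  have hc : ∀ j, j < k → coeff 0 (g j j) = coeff 0 (g 0 0) := by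
    intro j
    induction j with
    | zero => exact fun _ => rfl
    | succ j ih => exact fun hj => (heqz j j hj hj).trans (ih (by omega))
  -- By triangularity the last coordinate of φ x is that of x times the last diagonal entry, and
  -- some x maps to e_k.
  have hc0 : coeff 0 (g 0 0) ≠ 0 := by
    intro h0
    obtain ⟨x, hx⟩ := φ.surjective (stdBasis k lam S' (k - 1))
    have h1 : coord (k - 1) (φ x) = coord (k - 1) x * g (k - 1) (k - 1) := by
      conv_lhs => rw [← sum_coord_smul x]
      rw [map_sum, map_sum, Finset.sum_eq_single (k - 1)]
      · rw [map_smul, map_smul, smul_eq_mul]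
      · intro n hn hne
        rw [map_smul, map_smul, htri n (k - 1) (by have := Finset.mem_range.1 hn; omega),
          smul_zero]
      · intro hn
        exact absurd (Finset.mem_range.2 (by omega)) hn
    rw [hx, coord_stdBasis_self (by omega)] at h1
    have h2 := congrArg (coeff 0) h1
    rw [coeff_zero_mul', hc _ (by omega), h0, mul_zero] at h2
    simp at h2
  obtain ⟨h, rfl⟩ : ∃ h', h = h' + 1 := ⟨h - 1, by omega⟩
  -- `e1` and `e2` express the variations of S'(0) through the constant terms next to the diagonal.
  -- By `e3` these constant terms are equal, and the combination γ eliminates them.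
  have e1 := heqc h h 0 (by omega)
  have e2 := heqc (h + 1) (h + 1) 0 (by omega)
  have e3 := heqz (h + 1) h (by omega) (by omega)
  rw [zero_add, coeff_one_mul', coeff_one_mul', hd _ (by omega), hd _ (by omega)] at e1 e2
  rw [hc (h + 1) (by omega), hc h (by omega)] at e1
  rw [hc (h + 1 + 1) (by omega), hc (h + 1) (by omega)] at e2
  simp only [gammaOf, pNum]
  push_cast
  push_cast at e1 e2
  apply mul_left_cancel₀ hc0
  linear_combination ((lam (h + 1 + 1) : ℂ) - lam (h + 1)) * e2
    - ((lam (h + 1 + 1 + 1) : ℂ) - lam (h + 1 + 1)) * e1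
    + ((lam (h + 1 + 1 + 1) : ℂ) - lam (h + 1 + 1)) * ((lam (h + 1 + 1) : ℂ) - lam (h + 1)) * e3

end

end Invariants

/-! ### Changes of variable for a pair of operators with `ab - ba = b²` -/

section ChangeOfVariable

variable {V : Type*} [AddCommGroup V] [Module ℂ V] {W : ℕ → Submodule ℂ V}

theorem evalSeries_mem_self (hW : IsCompleteFiltration W) {D : Module.End ℂ V}
    (hD : HasDegree W 1 D) (T : ℂ⟦X⟧) {n : ℕ} {x : V} (hx : x ∈ W n) :
    evalSeries hW hD T x ∈ W n :=
  evalSeries_mem hW hD (isClosedFor_self W n) (fun y hy => hW.anti (Nat.le_succ n) (hD n y hy)) T hx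

variable (hW : IsCompleteFiltration W) {A b : Module.End ℂ V} (hA : HasDegree W 1 A)
  (hb : HasDegree W 1 b) (hAb : ∀ x, A (b x) = b (A x) + b (b x)) (θ : ℂ⟦X⟧)

/-- The operator `θ(a)`. -/
def newA : Module.End ℂ V := evalSeries hW hA θ

/-- The operator `b θ'(a)`. -/
def newB (b : Module.End ℂ V) : Module.End ℂ V := b * evalSeries hW hA (derivative ℂ θ)

theorem newB_apply (x : V) :
    newB hW hA θ b x = b (evalSeries hW hA (derivative ℂ θ) x) := rfl

theorem newB_hasDegree (hW : IsCompleteFiltration W) (hA : HasDegree W 1 A)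
    (hb : HasDegree W 1 b) (θ : ℂ⟦X⟧) : HasDegree W 1 (newB hW hA θ b) :=
  fun n _ hx => hb n _ (evalSeries_mem_self hW hA _ hx)

/-- On monomials this is Aⁿ b = b Aⁿ + n b Aⁿ⁻¹ b, by induction from ab - ba = b². The continuity
argument loses one order because of the derivative. -/
theorem evalSeries_b (hW : IsCompleteFiltration W) (hA : HasDegree W 1 A)
    (hb : HasDegree W 1 b) (hAb : ∀ x, A (b x) = b (A x) + b (b x))
    (f : ℂ⟦X⟧) (x : V) : evalSeries hW hA f (b x) =
    b (evalSeries hW hA f x) + b (evalSeries hW hA (derivative ℂ f) (b x)) := by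
  have hWb : ∀ n y, y ∈ W n → b y ∈ W n := fun n y hy => hW.anti (Nat.le_succ n) (hb n y hy)
  refine series_linearMap_eq hW ((evalSeries hW hA).flip (b x))
    (b.comp ((evalSeries hW hA).flip x) +
      b.comp (((evalSeries hW hA).flip (b x)).comp (derivative ℂ).toLinearMap)) 1
    (fun n => ?_) (fun n T => ?_) (fun n T => ?_) f
  · simp only [LinearMap.flip_apply, LinearMap.add_apply, LinearMap.comp_apply, evalSeries_X_pow]
    change _ = _ + b (evalSeries hW hA (derivative ℂ (X ^ n)) (b x))
    rw [derivative_pow, derivative_X, mul_one]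
    induction n with
    | zero => simp
    | succ n ih =>
      rw [pow_succ' A, Module.End.mul_apply, ih, map_add, hAb, hAb, Module.End.mul_apply]
      have h1 : A (evalSeries hW hA ((n : ℂ⟦X⟧) * (X : ℂ⟦X⟧) ^ (n - 1)) (b x)) =
          evalSeries hW hA ((n : ℂ⟦X⟧) * X ^ n) (b x) := by
        rw [← evalSeries_X_mul_apply hW hA]
        congr 2
        cases n with
        | zero => simp
        | succ n => rw [Nat.add_sub_cancel]; ring
      have h2 : evalSeries hW hA (((n + 1 : ℕ) : ℂ⟦X⟧) * X ^ (n + 1 - 1)) (b x) =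
          evalSeries hW hA ((n : ℂ⟦X⟧) * X ^ n) (b x) + (A ^ n) (b x) := by
        rw [Nat.add_sub_cancel, Nat.cast_succ, add_mul, one_mul, map_add, evalSeries_X_pow]
        rfl
      rw [h1, h2, ih]
      simp only [map_add]
      abel
  · exact hW.anti (Nat.le_succ n) (evalSeries_X_pow_mul_mem hW hA T (n + 1) (b x))
  · refine (W n).add_mem (hWb _ _ (hW.anti (Nat.le_succ n)
      (evalSeries_X_pow_mul_mem hW hA T (n + 1) x))) (hWb _ _ ?_)
    change evalSeries hW hA (derivative ℂ (X ^ (n + 1) * T)) (b x) ∈ W n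
    rw [Derivation.leibniz, derivative_pow, derivative_X, mul_one, smul_eq_mul, smul_eq_mul,
      Nat.add_sub_cancel]
    have : X ^ (n + 1) * derivative ℂ T + T * (((n + 1 : ℕ) : ℂ⟦X⟧) * X ^ n) =
        X ^ n * (X * derivative ℂ T + T * ((n + 1 : ℕ) : ℂ⟦X⟧)) := by ring
    rw [this]
    exact evalSeries_X_pow_mul_mem hW hA _ _ _

/-- Apply f(A) b = b f(A) + b f'(A) b with f = θ to θ'(A) x, and use that series in A commute. -/
theorem newA_newB (hW : IsCompleteFiltration W) (hA : HasDegree W 1 A)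
    (hb : HasDegree W 1 b) (hAb : ∀ x, A (b x) = b (A x) + b (b x))
    (θ : ℂ⟦X⟧) (x : V) : newA hW hA θ (newB hW hA θ b x) =
    newB hW hA θ b (newA hW hA θ x) + newB hW hA θ b (newB hW hA θ b x) := by
  simp only [newA, newB_apply]
  rw [evalSeries_b hW hA hb hAb, evalSeries_commute hW hA θ]

/-- This makes the space a module over ℂ⟦b'⟧ with the commutation rule required of an (a,b)-module.
On monomials it follows by induction from `newA_newB`. -/
theorem newA_evalSeries_newB (hW : IsCompleteFiltration W) (hA : HasDegree W 1 A)
    (hb : HasDegree W 1 b) (hAb : ∀ x, A (b x) = b (A x) + b (b x))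
    (θ : ℂ⟦X⟧) (T : ℂ⟦X⟧) (x : V) :
    newA hW hA θ (evalSeries hW (newB_hasDegree hW hA hb θ) T x) =
      evalSeries hW (newB_hasDegree hW hA hb θ) T (newA hW hA θ x) +
      evalSeries hW (newB_hasDegree hW hA hb θ) (X ^ 2 * derivative ℂ T) x := by
  have hB := newB_hasDegree hW hA hb θ
  have hWA : ∀ n y, y ∈ W n → newA hW hA θ y ∈ W n := fun n y hy => evalSeries_mem_self hW hA θ hy
  refine series_linearMap_eq hW ((newA hW hA θ).comp ((evalSeries hW hB).flip x))
    ((evalSeries hW hB).flip (newA hW hA θ x) +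
      (((evalSeries hW hB).flip x).comp ((LinearMap.mulLeft ℂ (X ^ 2)).comp
        (derivative ℂ).toLinearMap))) 0
    (fun n => ?_) (fun n T => ?_) (fun n T => ?_) T
  · simp only [LinearMap.flip_apply, LinearMap.add_apply, LinearMap.comp_apply, evalSeries_X_pow,
      LinearMap.mulLeft_apply]
    change _ = _ + evalSeries hW hB (X ^ 2 * derivative ℂ (X ^ n)) x
    rw [derivative_pow, derivative_X, mul_one]
    induction n with
    | zero => simp
    | succ n ih =>
      rw [pow_succ' (newB hW hA θ b), Module.End.mul_apply, Module.End.mul_apply,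
        newA_newB hW hA hb hAb, ih, map_add]
      have h1 : newB hW hA θ b (evalSeries hW hB ((X : ℂ⟦X⟧) ^ 2 * ((n : ℂ⟦X⟧) * (X : ℂ⟦X⟧) ^ (n - 1))) x) =
          evalSeries hW hB ((n : ℂ⟦X⟧) * X ^ (n + 2)) x := by
        rw [← evalSeries_X_mul_apply hW hB]
        congr 2
        cases n with
        | zero => simp
        | succ n => rw [Nat.add_sub_cancel]; ring
      have h2 : evalSeries hW hB (X ^ 2 * (((n + 1 : ℕ) : ℂ⟦X⟧) * X ^ (n + 1 - 1))) x =
          evalSeries hW hB ((n : ℂ⟦X⟧) * X ^ (n + 2)) x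
            + newB hW hA θ b (newB hW hA θ b ((newB hW hA θ b ^ n) x)) := by
        have h3 : (X : ℂ⟦X⟧) ^ 2 * (((n + 1 : ℕ) : ℂ⟦X⟧) * X ^ (n + 1 - 1)) =
            (n : ℂ⟦X⟧) * X ^ (n + 2) + X ^ (n + 2) := by
          rw [Nat.add_sub_cancel, Nat.cast_succ]; ring
        rw [h3, map_add, evalSeries_X_pow, pow_succ' (newB hW hA θ b) (n + 1),
          pow_succ' (newB hW hA θ b) n]
        rfl
      rw [h1, h2]
      abel
  · exact hWA _ _ (evalSeries_X_pow_mul_mem hW hB T n x)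
  · refine (W n).add_mem (evalSeries_X_pow_mul_mem hW hB T n _) ?_
    have key : X ^ 2 * derivative ℂ (X ^ n * T) =
        X ^ n * (X ^ 2 * derivative ℂ T + T * (n : ℂ⟦X⟧) * X) := by
      rw [Derivation.leibniz, derivative_pow, derivative_X, mul_one, smul_eq_mul, smul_eq_mul]
      cases n with
      | zero => simp
      | succ n => rw [Nat.add_sub_cancel]; ring
    have hmem := evalSeries_X_pow_mul_mem hW hB (X ^ 2 * derivative ℂ T + T * (n : ℂ⟦X⟧) * X) n x
    rw [← key] at hmem
    exact hmem

/-! ### Leading terms and second-order expansions of the new operators -/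

/-- A filtration by closed subspaces for which `a` and `b` have degree one. -/
structure IsAdmissible (W : ℕ → Submodule ℂ V) (A b : Module.End ℂ V) (P : ℕ → Submodule ℂ V) :
    Prop where
  closed : ∀ n, IsClosedFor W (P n)
  anti : Antitone P
  degA : HasDegree P 1 A
  degB : HasDegree P 1 b

section

variable {P : ℕ → Submodule ℂ V}

theorem IsAdmissible.evalSeries_mem (hP : IsAdmissible W A b P)
    (f : ℂ⟦X⟧) {n : ℕ} {x : V} (hx : x ∈ P n) :
    evalSeries hW hA f x ∈ P n :=
  Fresco.evalSeries_mem hW hA (hP.closed n)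
    (fun y hy => hP.anti (Nat.le_succ n) (hP.degA n y hy)) f hx

theorem IsAdmissible.newB_mem (hP : IsAdmissible W A b P)
    {n : ℕ} {x : V} (hx : x ∈ P n) : newB hW hA θ b x ∈ P (n + 1) :=
  hP.degB n _ (hP.evalSeries_mem hW hA _ hx)

theorem IsAdmissible.evalSeries_sub_mem (hP : IsAdmissible W A b P)
    (f : ℂ⟦X⟧) {n : ℕ} {x : V} (hx : x ∈ P n) :
    evalSeries hW hA f x - coeff 0 f • x ∈ P (n + 1) := by
  obtain ⟨U, -, hU⟩ := exists_evalSeries_eq hW hA f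
  rw [hU, add_sub_cancel_left]
  exact hP.degA n _ (hP.evalSeries_mem hW hA U hx)

theorem IsAdmissible.newB_sub_mem (hP : IsAdmissible W A b P) {n : ℕ} {x : V} (hx : x ∈ P n) :
    newB hW hA θ b x - coeff 1 θ • b x ∈ P (n + 2) := by
  have h1 := hP.degB _ _ (hP.evalSeries_sub_mem hW hA (derivative ℂ θ) hx)
  rw [map_sub, map_smul, coeff_derivative] at h1
  simpa [newB_apply] using h1

theorem IsAdmissible.newB_pow_sub_mem (hP : IsAdmissible W A b P)
    (i : ℕ) {n : ℕ} {x : V} (hx : x ∈ P n) :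
    (newB hW hA θ b ^ i) x - coeff 1 θ ^ i • (b ^ i) x ∈ P (n + i + 1) := by
  induction i with
  | zero => simp
  | succ i ih =>
    have h1 := hP.newB_mem hW hA θ ih
    have h2 := hP.newB_sub_mem hW hA θ (hP.degB.pow_one i n x hx)
    have h3 := (P (n + i + 1 + 1)).add_mem h1 ((P _).smul_mem (coeff 1 θ ^ i) h2)
    rw [map_sub, map_smul, smul_sub, smul_smul, ← pow_succ, sub_add_sub_cancel] at h3
    rw [pow_succ' (newB hW hA θ b), pow_succ' b, Module.End.mul_apply, Module.End.mul_apply]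
    exact h3

theorem IsAdmissible.evalSeries_newB_mem (hP : IsAdmissible W A b P)
    (T : ℂ⟦X⟧) {n : ℕ} {x : V} (hx : x ∈ P n) :
    evalSeries hW (newB_hasDegree hW hA hb θ) T x ∈ P n :=
  Fresco.evalSeries_mem hW _ (hP.closed n)
    (fun _ hy => hP.anti (Nat.le_succ n) (hP.newB_mem hW hA θ hy)) T hx

theorem IsAdmissible.evalSeries_newB_sub_mem (hP : IsAdmissible W A b P)
    (T : ℂ⟦X⟧) {n : ℕ} {x : V} (hx : x ∈ P n) :
    evalSeries hW (newB_hasDegree hW hA hb θ) T x - coeff 0 T • x ∈ P (n + 1) := by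
  obtain ⟨U, -, hU⟩ := exists_evalSeries_eq hW (newB_hasDegree hW hA hb θ) T
  rw [hU, add_sub_cancel_left]
  exact hP.newB_mem hW hA θ (hP.evalSeries_newB_mem hW hA hb θ U hx)

/-- The leading term of `T(b θ'(a))`, for `T` divisible by `X ^ i`. -/
theorem IsAdmissible.evalSeries_newB_leading (hP : IsAdmissible W A b P)
    (T : ℂ⟦X⟧) {i n : ℕ} (hT : T ∈ seriesFiltration i)
    {x : V} (hx : x ∈ P n) :
    evalSeries hW (newB_hasDegree hW hA hb θ) T x - (coeff i T * coeff 1 θ ^ i) • (b ^ i) x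
      ∈ P (n + i + 1) := by
  obtain ⟨g, rfl⟩ := mem_seriesFiltration_iff_dvd.1 hT
  have hg : coeff i (X ^ i * g) = coeff 0 g := by simpa using coeff_X_pow_mul g i 0
  rw [hg, evalSeries_X_pow_mul]
  have h1 : ∀ {m : ℕ} {y : V}, y ∈ P m → (newB hW hA θ b ^ i) y ∈ P (m + i) := by
    have : HasDegree P 1 (newB hW hA θ b) := fun m y hy => hP.newB_mem hW hA θ hy
    exact fun {m y} hy => this.pow_one i m y hy
  have h2 := h1 (hP.evalSeries_newB_sub_mem hW hA hb θ g hx)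
  have h3 := (P _).smul_mem (coeff 0 g) (hP.newB_pow_sub_mem hW hA θ i hx)
  rw [show n + 1 + i = n + i + 1 by ring] at h2
  have h4 := (P _).add_mem h2 h3
  rw [map_sub, map_smul, smul_sub, smul_smul, sub_add_sub_cancel] at h4
  exact h4

/-- The second order expansion of `θ(a)`. -/
theorem IsAdmissible.newA_sub_mem (hP : IsAdmissible W A b P)
    (hθ : coeff 0 θ = 0) {n : ℕ} {x : V} (hx : x ∈ P n) :
    newA hW hA θ x - (coeff 1 θ • A x + coeff 2 θ • A (A x)) ∈ P (n + 3) := by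
  obtain ⟨U, hU, h1⟩ := exists_evalSeries_eq hW hA θ
  obtain ⟨U', hU', h2⟩ := exists_evalSeries_eq hW hA U
  obtain ⟨U'', -, h3⟩ := exists_evalSeries_eq hW hA U'
  rw [newA, h1, h2, h3, hθ, hU', hU, hU, zero_smul, zero_add, map_add, map_add, map_smul, map_add,
    map_smul, map_smul, ← add_assoc, add_sub_cancel_left]
  exact hP.degA _ _ (hP.degA _ _ (hP.degA _ _ (hP.evalSeries_mem hW hA U'' hx)))

/-- The second order expansion of `b θ'(a)`. -/
theorem IsAdmissible.newB_sub_mem_two (hP : IsAdmissible W A b P) {n : ℕ} {x : V} (hx : x ∈ P n) :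
    newB hW hA θ b x - (coeff 1 θ • b x + (2 * coeff 2 θ) • b (A x)) ∈ P (n + 3) := by
  obtain ⟨U, hU, h1⟩ := exists_evalSeries_eq hW hA (derivative ℂ θ)
  obtain ⟨U', -, h2⟩ := exists_evalSeries_eq hW hA U
  have e1 : coeff 0 (derivative ℂ θ) = coeff 1 θ := by simp [coeff_derivative]
  have e2 : coeff 1 (derivative ℂ θ) = 2 * coeff 2 θ := by
    rw [coeff_derivative]; push_cast; ring
  rw [newB_apply, h1, h2, hU, e1, e2, map_add, map_add, map_add, map_smul, map_smul, map_smul,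
    ← add_assoc, add_sub_cancel_left]
  exact hP.degB _ _ (hP.degA _ _ (hP.degA _ _ (hP.evalSeries_mem hW hA U' hx)))

/-- The first order expansion of `T(b θ'(a))`. -/
theorem IsAdmissible.evalSeries_newB_sub_mem_two (hP : IsAdmissible W A b P)
    (T : ℂ⟦X⟧) {n : ℕ} {x : V} (hx : x ∈ P n) :
    evalSeries hW (newB_hasDegree hW hA hb θ) T x
      - (coeff 0 T • x + (coeff 1 T * coeff 1 θ) • b x) ∈ P (n + 2) := by
  obtain ⟨U, hU, h1⟩ := exists_evalSeries_eq hW (newB_hasDegree hW hA hb θ) T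
  have h2 := hP.newB_mem hW hA θ (hP.evalSeries_newB_sub_mem hW hA hb θ U hx)
  have h3 := (P _).smul_mem (coeff 1 T) (hP.newB_sub_mem hW hA θ hx)
  have h4 := (P _).add_mem h2 h3
  rw [hU, map_sub, map_smul, smul_sub, smul_smul, sub_add_sub_cancel] at h4
  rw [h1, add_sub_add_left_eq_sub]
  exact h4

end

end ChangeOfVariable

/-! ### The weight filtration of a standard module -/

section Weight

variable {k : ℕ} {lam : ℕ → ℚ} {S : ℕ → ℂ⟦X⟧}

/-- The filtration for which `a` and `b` have weight one and `e_{m+1}` has weight `k - 1 - m`. -/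
def weightFiltration (k : ℕ) (lam : ℕ → ℚ) (S : ℕ → ℂ⟦X⟧) (n : ℕ) :
    Submodule ℂ (stdModule k lam S) where
  carrier := {x | ∀ m i, i + k < n + m + 1 → coeff i (coord m x) = 0}
  add_mem' := fun hx hy m i h => by rw [map_add, map_add, hx m i h, hy m i h, add_zero]
  zero_mem' := fun m i _ => by rw [map_zero, map_zero]
  smul_mem' := fun c x hx m i h => by rw [coord_complex_smul, coeff_smul, hx m i h, smul_zero]

theorem weightFiltration_complete : IsCompleteFiltration (weightFiltration k lam S) where
  zero := by
    rw [eq_top_iff]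
    intro x _ m i h
    rw [coord_of_le (by omega), map_zero]
  anti := fun n n' h x hx m i hi => hx m i (by omega)
  sep := fun x hx => by
    apply coord_ext
    intro m _
    ext i
    rw [hx (i + k) m i (by omega), map_zero, map_zero]
  complete := fun x hx => by
    have key : ∀ m i n, i + k < n + m + 1 → ∀ d,
        coeff i (coord m (x (n + d))) = coeff i (coord m (x n)) := by
      intro m i n hi d
      induction d with
      | zero => rfl
      | succ d ih =>
        have := hx (n + d) m i (by omega)
        rw [map_sub, map_sub, sub_eq_zero] at this
        rw [← add_assoc, this, ih]
    -- From stage i + k on, the coefficient of degree i no longer changes, whatever the coordinate.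
    refine ⟨ofCoord k lam S fun m => PowerSeries.mk fun i => coeff i (coord m (x (i + k))),
      fun n m i hi => ?_⟩
    rw [map_sub, map_sub, sub_eq_zero]
    by_cases hm : m < k
    · rw [coord_ofCoord hm, coeff_mk]
      rcases le_total n (i + k) with h | h
      · obtain ⟨d, hd⟩ := Nat.exists_eq_add_of_le h
        rw [hd]
        exact key m i n hi d
      · obtain ⟨d, hd⟩ := Nat.exists_eq_add_of_le h
        rw [hd]
        exact (key m i (i + k) (by omega) d).symm
    · rw [coord_of_le (not_lt.1 hm), coord_of_le (not_lt.1 hm)]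

theorem coeff_zero_coord_a (n : ℕ) (z : stdModule k lam S) :
    coeff 0 (coord n (aEnd _ z)) = coeff 0 (S (n + 1)) * coeff 0 (coord (n + 1) z) := by
  rw [aEnd_apply, coord_a, map_add, coeff_zero_euler, zero_add, coeff_zero_mul']

theorem coeff_succ_coord_a (n q : ℕ) (z : stdModule k lam S) :
    coeff (q + 1) (coord n (aEnd _ z)) = ((lam (n + 1) : ℂ) + q) * coeff q (coord n z)
      + coeff (q + 1) (S (n + 1) * coord (n + 1) z) := by
  rw [aEnd_apply, coord_a, map_add, coeff_succ_euler]

theorem coeff_zero_coord_b (n : ℕ) (z : stdModule k lam S) :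
    coeff 0 (coord n (bEnd _ z)) = 0 := by
  rw [bEnd_apply, map_smul, smul_eq_mul, coeff_zero_X_mul]

theorem coeff_succ_coord_b (n q : ℕ) (z : stdModule k lam S) :
    coeff (q + 1) (coord n (bEnd _ z)) = coeff q (coord n z) := by
  rw [bEnd_apply, map_smul, smul_eq_mul, coeff_succ_X_mul]

theorem coeff_mul_eq_zero_of_forall {f g : ℂ⟦X⟧} {i : ℕ} (hg : ∀ q ≤ i, coeff q g = 0) :
    coeff i (f * g) = 0 := by
  rw [coeff_mul]
  refine Finset.sum_eq_zero fun p hp => ?_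
  rw [hg p.2 (by have := Finset.HasAntidiagonal.mem_antidiagonal.1 hp; omega), mul_zero]

/-- The weights are chosen so that a is homogeneous to leading order: a e_j is a combination of b
e_j and e_{j-1}, both of weight one more than e_j. -/
theorem weightFiltration_admissible : IsAdmissible (weightFiltration k lam S)
    (aEnd (stdModule k lam S)) (bEnd (stdModule k lam S)) (weightFiltration k lam S) where
  closed := isClosedFor_self _
  anti := weightFiltration_complete.anti
  degA := by
    intro n x hx m i hi
    have h2 : coeff i (S (m + 1) * coord (m + 1) x) = 0 :=
      coeff_mul_eq_zero_of_forall fun q hq => hx (m + 1) q (by omega)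
    cases i with
    | zero => rw [coeff_zero_coord_a, ← coeff_zero_mul', h2]
    | succ i => rw [coeff_succ_coord_a, h2, hx m i (by omega), mul_zero, add_zero]
  degB := by
    intro n x hx m i hi
    cases i with
    | zero => exact coeff_zero_coord_b _ _
    | succ i => rw [coeff_succ_coord_b, hx m i (by omega)]

/-- The elements of `F_{j+1}` whose coordinate on `e_{j+1}` is divisible by `X ^ n`. -/
def rankOneFiltration (k : ℕ) (lam : ℕ → ℚ) (S : ℕ → ℂ⟦X⟧) (j n : ℕ) :
    Submodule ℂ (stdModule k lam S) where
  carrier := {x | (∀ m, j < m → coord m x = 0) ∧ ∀ i < n, coeff i (coord j x) = 0}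
  add_mem' := fun hx hy => ⟨fun m h => by rw [map_add, hx.1 m h, hy.1 m h, add_zero],
    fun i h => by rw [map_add, map_add, hx.2 i h, hy.2 i h, add_zero]⟩
  zero_mem' := ⟨fun m _ => map_zero _, fun i _ => by rw [map_zero, map_zero]⟩
  smul_mem' := fun c x hx => ⟨fun m h => by rw [coord_complex_smul, hx.1 m h, smul_zero],
    fun i h => by rw [coord_complex_smul, coeff_smul, hx.2 i h, smul_zero]⟩

/-- On F_{j+1} the last coordinate sees a as λ_{j+1} b + b²∂, which raises the order by one. The
space is closed because each coefficient is determined at a finite level of the weight filtration.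
-/
theorem rankOneFiltration_admissible (j : ℕ) : IsAdmissible (weightFiltration k lam S)
    (aEnd (stdModule k lam S)) (bEnd (stdModule k lam S)) (rankOneFiltration k lam S j) where
  closed := by
    have key : ∀ x p : stdModule k lam S, ∀ m i, x - p ∈ weightFiltration k lam S (i + k) →
        coeff i (coord m x) = coeff i (coord m p) := by
      intro x p m i h
      have := h m i (by omega)
      rwa [map_sub, map_sub, sub_eq_zero] at this
    intro n x hx
    refine ⟨fun m hm => PowerSeries.ext fun i => ?_, fun i hi => ?_⟩
    · obtain ⟨p, hp, h⟩ := hx (i + k)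
      rw [key x p m i h, hp.1 m hm]
    · obtain ⟨p, hp, h⟩ := hx (i + k)
      rw [key x p j i h, hp.2 i hi]
  anti := fun n n' h x hx => ⟨hx.1, fun i hi => hx.2 i (by omega)⟩
  degA := by
    intro n x hx
    refine ⟨fun m hm => ?_, fun i hi => ?_⟩
    · rw [aEnd_apply, coord_a, hx.1 m hm, hx.1 (m + 1) (by omega)]
      simp
    · cases i with
      | zero => rw [coeff_zero_coord_a, hx.1 _ (Nat.lt_succ_self j), map_zero, mul_zero]
      | succ i =>
        rw [coeff_succ_coord_a, hx.1 _ (Nat.lt_succ_self j), mul_zero, map_zero, add_zero,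
          hx.2 i (by omega), mul_zero]
  degB := by
    intro n x hx
    refine ⟨fun m hm => ?_, fun i hi => ?_⟩
    · rw [bEnd_apply, map_smul, hx.1 m hm, smul_zero]
    · cases i with
      | zero => exact coeff_zero_coord_b _ _
      | succ i => rw [coeff_succ_coord_b, hx.2 i (by omega)]

theorem bEnd_pow_apply {E : PreABModule} (i : ℕ) (x : E) :
    (bEnd E ^ i) x = (X ^ i : ℂ⟦X⟧) • x := by
  induction i with
  | zero => simp
  | succ i ih => rw [pow_succ', Module.End.mul_apply, ih, bEnd_apply, smul_smul, ← pow_succ']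

theorem smul_mem_weightFiltration {T : ℂ⟦X⟧} {q n : ℕ} (hT : T ∈ seriesFiltration q)
    {x : stdModule k lam S} (hx : x ∈ weightFiltration k lam S n) :
    T • x ∈ weightFiltration k lam S (n + q) := by
  intro m i hi
  rw [map_smul, smul_eq_mul, coeff_mul]
  refine Finset.sum_eq_zero fun p hp => ?_
  have hp' := Finset.HasAntidiagonal.mem_antidiagonal.1 hp
  by_cases h : p.1 < q
  · rw [hT _ h, zero_mul]
  · rw [hx m p.2 (by omega), mul_zero]

/-! ### Changes of variable on a standard module -/

/-- The operator `θ(a)` on a standard module. -/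
abbrev stdNewA (k : ℕ) (lam : ℕ → ℚ) (S : ℕ → ℂ⟦X⟧) (θ : ℂ⟦X⟧) :
    Module.End ℂ (stdModule k lam S) :=
  newA weightFiltration_complete weightFiltration_admissible.degA θ

/-- The operator `b θ'(a)` on a standard module. -/
abbrev stdNewB (k : ℕ) (lam : ℕ → ℚ) (S : ℕ → ℂ⟦X⟧) (θ : ℂ⟦X⟧) :
    Module.End ℂ (stdModule k lam S) :=
  newB weightFiltration_complete weightFiltration_admissible.degA θ (bEnd _)

/-- The operators `T(b θ'(a))` on a standard module. -/
abbrev newSeries (k : ℕ) (lam : ℕ → ℚ) (S : ℕ → ℂ⟦X⟧) (θ : ℂ⟦X⟧) :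
    ℂ⟦X⟧ →ₗ[ℂ] Module.End ℂ (stdModule k lam S) :=
  evalSeries weightFiltration_complete
    (newB_hasDegree weightFiltration_complete weightFiltration_admissible.degA
      weightFiltration_admissible.degB θ)

variable {θ : ℂ⟦X⟧}

theorem newSeries_mul_apply (T U : ℂ⟦X⟧) (x : stdModule k lam S) :
    newSeries k lam S θ (T * U) x = newSeries k lam S θ T (newSeries k lam S θ U x) :=
  evalSeries_mul_apply _ _ T U x

theorem stdNewA_newSeries (T : ℂ⟦X⟧) (x : stdModule k lam S) :
    stdNewA k lam S θ (newSeries k lam S θ T x) =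
      newSeries k lam S θ T (stdNewA k lam S θ x) +
        newSeries k lam S θ (X ^ 2 * derivative ℂ T) x :=
  newA_evalSeries_newB _ _ weightFiltration_admissible.degB aEnd_bEnd θ T x

theorem newSeries_leading {P : ℕ → Submodule ℂ (stdModule k lam S)}
    (hP : IsAdmissible (weightFiltration k lam S) (aEnd _) (bEnd _) P) {T : ℂ⟦X⟧} {i n : ℕ}
    (hT : T ∈ seriesFiltration i) {x : stdModule k lam S} (hx : x ∈ P n) :
    newSeries k lam S θ T x - (coeff i T * coeff 1 θ ^ i) • (X ^ i : ℂ⟦X⟧) • x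
      ∈ P (n + i + 1) := by
  rw [← bEnd_pow_apply]
  exact hP.evalSeries_newB_leading weightFiltration_complete _
    weightFiltration_admissible.degB θ T hT hx

theorem newSeries_mem {P : ℕ → Submodule ℂ (stdModule k lam S)}
    (hP : IsAdmissible (weightFiltration k lam S) (aEnd _) (bEnd _) P) (T : ℂ⟦X⟧) {n : ℕ}
    {x : stdModule k lam S} (hx : x ∈ P n) : newSeries k lam S θ T x ∈ P n :=
  hP.evalSeries_newB_mem weightFiltration_complete _ weightFiltration_admissible.degB θ T hx

theorem newSeries_mem_flag (T : ℂ⟦X⟧) {j : ℕ} {x : stdModule k lam S}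
    (hx : x ∈ (stdFlag k lam S j).carrier) :
    newSeries k lam S θ T x ∈ (stdFlag k lam S j).carrier := by
  cases j with
  | zero =>
    have : x = 0 := coord_ext fun n _ => by rw [hx n (Nat.zero_le n), map_zero]
    rw [this, map_zero]
    exact Submodule.zero_mem _
  | succ j =>
    have h : x ∈ rankOneFiltration k lam S j 0 := ⟨fun m hm => hx m hm, fun i hi => by omega⟩
    exact fun m hm => (newSeries_mem (rankOneFiltration_admissible j) T h).1 m hm

/-- The series `T(c X)`, as a linear function of `T`. -/
def rescaleLin (c : ℂ) : Module.End ℂ ℂ⟦X⟧ where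
  toFun := rescale c
  map_add' := map_add _
  map_smul' d T := by
    ext n
    simp only [coeff_rescale, coeff_smul, smul_eq_mul, RingHom.id_apply]
    ring

theorem coeff_rescaleLin (c : ℂ) (T : ℂ⟦X⟧) (n : ℕ) :
    coeff n (rescaleLin c T) = c ^ n * coeff n T := coeff_rescale _ _ _

theorem rescaleLin_mem {c : ℂ} {T : ℂ⟦X⟧} {n : ℕ} (hT : T ∈ seriesFiltration n) :
    rescaleLin c T ∈ seriesFiltration n := fun i hi => by
  rw [coeff_rescaleLin, hT i hi, mul_zero]

theorem rescaleLin_rescaleLin {c d : ℂ} (h : c * d = 1) (T : ℂ⟦X⟧) :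
    rescaleLin c (rescaleLin d T) = T := by
  ext n
  rw [coeff_rescaleLin, coeff_rescaleLin, ← mul_assoc, ← mul_pow, h, one_pow, one_mul]

/-- Division modulo `F_j` by an element of `F_{j+1}` which generates it modulo `F_j`. -/
theorem exists_newSeries_division (hχ : coeff 1 θ ≠ 0) {j : ℕ} {y : stdModule k lam S}
    (hy : y ∈ (stdFlag k lam S (j + 1)).carrier) (hc : coeff 0 (coord j y) ≠ 0) (n : ℕ)
    (f : ℂ⟦X⟧) (hf : f ∈ seriesFiltration n) :
    ∃ Q ∈ seriesFiltration n, coord j (newSeries k lam S θ Q y) = f := by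
  set χ := coeff 1 θ with hχd
  set c := coeff 0 (coord j y) with hcd
  have hy' : y ∈ rankOneFiltration k lam S j 0 := ⟨fun m hm => hy m hm, fun i hi => by omega⟩
  let coordC : stdModule k lam S →ₗ[ℂ] ℂ⟦X⟧ :=
    { toFun := coord j
      map_add' := map_add _
      map_smul' := coord_complex_smul j }
  -- T(b') y has leading coordinate χ^i c times the leading term of T. Rescaling the variable by χ⁻¹
  -- and dividing by c makes the map congruent to the identity, hence bijective and strict.
  let ψ : Module.End ℂ ℂ⟦X⟧ :=
    coordC.comp (((newSeries k lam S θ).flip y).comp (c⁻¹ • rescaleLin χ⁻¹))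
  have hψ : ∀ Q, ψ Q = coord j (newSeries k lam S θ (c⁻¹ • rescaleLin χ⁻¹ Q) y) := fun _ => rfl
  have hdeg : HasDegree seriesFiltration 1 (ψ - 1) := by
    intro q Q hQ i hi
    have h1 : c⁻¹ • rescaleLin χ⁻¹ Q ∈ seriesFiltration q :=
      Submodule.smul_mem _ _ (rescaleLin_mem hQ)
    have h2 := (newSeries_leading (θ := θ) (rankOneFiltration_admissible j) h1 hy').2 i
      (by omega)
    rw [LinearMap.sub_apply, hψ, Module.End.one_apply]
    rw [map_sub, map_sub, sub_eq_zero] at h2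
    rw [map_sub, h2, coord_complex_smul, coeff_smul, map_smul (coord j)]
    simp only [smul_eq_mul]
    rw [coeff_smul, coeff_rescaleLin, coeff_X_pow_mul', ← hχd]
    rcases Nat.lt_succ_iff_lt_or_eq.1 hi with h | rfl
    · rw [if_neg (by omega), hQ i h, mul_zero, sub_zero]
    · rw [if_pos le_rfl, Nat.sub_self, ← hcd]
      have h3 : (χ ^ i)⁻¹ * χ ^ i = 1 := inv_mul_cancel₀ (pow_ne_zero _ hχ)
      have h4 : c⁻¹ * c = 1 := inv_mul_cancel₀ hc
      rw [inv_pow, smul_eq_mul]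
      linear_combination coeff i Q * ((χ ^ i)⁻¹ * χ ^ i) * h4 + coeff i Q * h3
  obtain ⟨⟨-, hsurj⟩, hstrict⟩ := bijective_of_sub_hasDegree seriesFiltration_complete hdeg
  obtain ⟨Q, hQ⟩ := hsurj f
  refine ⟨c⁻¹ • rescaleLin χ⁻¹ Q, Submodule.smul_mem _ _ (rescaleLin_mem (hstrict n Q ?_)), ?_⟩
  · rw [hQ]; exact hf
  · rw [← hψ, hQ]

theorem stdNewA_mem_flag {j : ℕ} {x : stdModule k lam S}
    (hx : x ∈ (stdFlag k lam S (j + 1)).carrier) :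
    stdNewA k lam S θ x ∈ (stdFlag k lam S (j + 1)).carrier := by
  have h : x ∈ rankOneFiltration k lam S j 0 := ⟨fun m hm => hx m hm, fun i hi => by omega⟩
  exact fun m hm => ((rankOneFiltration_admissible j).evalSeries_mem weightFiltration_complete
    _ θ h).1 m hm

theorem stdNewB_mem_flag {j : ℕ} {x : stdModule k lam S}
    (hx : x ∈ (stdFlag k lam S (j + 1)).carrier) :
    stdNewB k lam S θ x ∈ (stdFlag k lam S (j + 1)).carrier := by
  have h : x ∈ rankOneFiltration k lam S j 0 := ⟨fun m hm => hx m hm, fun i hi => by omega⟩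
  exact fun m hm => ((rankOneFiltration_admissible j).newB_mem weightFiltration_complete
    _ θ h).1 m hm

/-- `θ(a) - λ b θ'(a)` up to order three. -/
theorem stdNew_expansion {P : ℕ → Submodule ℂ (stdModule k lam S)}
    (hP : IsAdmissible (weightFiltration k lam S) (aEnd _) (bEnd _) P) (hθ : coeff 0 θ = 0)
    (μ : ℂ) {n : ℕ} {x : stdModule k lam S} (hx : x ∈ P n) :
    (stdNewA k lam S θ x - μ • stdNewB k lam S θ x) -
      (coeff 1 θ • aEnd _ x + coeff 2 θ • aEnd _ (aEnd _ x) -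
        μ • (coeff 1 θ • bEnd _ x + (2 * coeff 2 θ) • bEnd _ (aEnd _ x))) ∈ P (n + 3) := by
  have h1 := hP.newA_sub_mem weightFiltration_complete weightFiltration_admissible.degA θ hθ hx
  have h2 := hP.newB_sub_mem_two weightFiltration_complete weightFiltration_admissible.degA θ hx
  have h3 := (P _).sub_mem h1 ((P _).smul_mem μ h2)
  rw [smul_sub] at h3
  convert h3 using 1
  abel

/-- One step of the construction of the presentation of `θ_* E`. -/
theorem exists_newSeries_eigen (hθ : IsChangeOfVariable θ) {j : ℕ} {y : stdModule k lam S}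
    (hy : y ∈ (stdFlag k lam S (j + 1)).carrier) (hc : coeff 0 (coord j y) ≠ 0) {w : ℕ}
    (hw : y ∈ weightFiltration k lam S w) :
    ∃ (R : ℂ⟦X⟧) (e : stdModule k lam S), coeff 0 R = 1 ∧ y = newSeries k lam S θ R e ∧
      e ∈ (stdFlag k lam S (j + 1)).carrier ∧ e ∈ weightFiltration k lam S w ∧
      coeff 0 (coord j e) ≠ 0 ∧
      stdNewA k lam S θ e - (lam (j + 1) : ℂ) • stdNewB k lam S θ e ∈
        (stdFlag k lam S j).carrier := by
  obtain ⟨hθ0, hχ⟩ := hθ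
  have hy' : y ∈ rankOneFiltration k lam S j 0 := ⟨fun m hm => hy m hm, fun i hi => by omega⟩
  set μ : ℂ := (lam (j + 1) : ℂ) with hμ
  set u := stdNewA k lam S θ y - μ • stdNewB k lam S θ y with hu
  have hsmul : ∀ {i} (c : ℂ) {x : stdModule k lam S}, x ∈ (stdFlag k lam S i).carrier →
      c • x ∈ (stdFlag k lam S i).carrier := fun {_} c {_} hx => Submodule.smul_mem _ (C c) hx
  have huF : u ∈ (stdFlag k lam S (j + 1)).carrier :=
    Submodule.sub_mem _ (stdNewA_mem_flag hy) (hsmul _ (stdNewB_mem_flag hy))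
  -- To first order u is χ (a - λb) y, and a - λb kills the constant term of the coordinate. Only
  -- degrees at least two remain.
  have hu2 : coord j u ∈ seriesFiltration 2 := by
    have hR := rankOneFiltration_admissible (k := k) (lam := lam) (S := S) j
    have h1 := (stdNew_expansion hR hθ0 μ hy').2
    intro i hi
    have h2 := h1 i (by omega)
    rw [map_sub, map_sub, sub_eq_zero] at h2
    rw [hu, h2]
    have hA2 := (hR.degA _ _ (hR.degA _ _ hy')).2 i (by omega)
    have hbA := (hR.degB _ _ (hR.degA _ _ hy')).2 i (by omega)
    simp only [map_sub, map_add, coord_complex_smul, coeff_smul, hA2, hbA, smul_eq_mul, mul_zero,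
      add_zero]
    have h0 : coord (j + 1) y = 0 := hy _ le_rfl
    interval_cases i
    · rw [coeff_zero_coord_a, coeff_zero_coord_b, h0]; simp
    · rw [coeff_succ_coord_a j 0, coeff_succ_coord_b j 0, h0]
      simp only [mul_zero, map_zero, add_zero, Nat.cast_zero, ← hμ]
      ring
  obtain ⟨Q, hQ2, hQ⟩ := exists_newSeries_division hχ hy hc 2 _ hu2
  obtain ⟨Q', rfl⟩ := mem_seriesFiltration_iff_dvd.1 hQ2
  -- Integrating factor: modulo F_j one has (a' - λb') y = b'² Q'(b') y, while a' R(b') = R(b') a' +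
  -- b'² R'(b'). The choice R' = -Q' R makes R(b') y an exact solution modulo F_j.
  obtain ⟨R, hR0, hR⟩ := exists_series_derivative_eq_mul (-Q')
  have hRinv : R⁻¹ * R = 1 :=
    PowerSeries.inv_mul_cancel _ (by
      rw [← coeff_zero_eq_constantCoeff_apply, hR0]; exact one_ne_zero)
  have hRinv0 : coeff 0 R⁻¹ = 1 := by
    have := congrArg (coeff 0) hRinv
    rw [coeff_zero_mul', hR0, mul_one] at this
    simpa using this
  refine ⟨R⁻¹, newSeries k lam S θ R y, hRinv0, ?_, newSeries_mem_flag R hy,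
    newSeries_mem weightFiltration_admissible R hw, ?_, ?_⟩
  · rw [← newSeries_mul_apply, hRinv, evalSeries_one]; rfl
  · have h1 := (newSeries_leading (θ := θ) (rankOneFiltration_admissible j) (T := R) (i := 0)
      (fun i hi => by omega) hy').2 0 (by omega)
    rw [map_sub, map_sub, sub_eq_zero] at h1
    rw [h1, hR0]
    simpa using hc
  · have h1 : stdNewA k lam S θ (newSeries k lam S θ R y) -
        μ • stdNewB k lam S θ (newSeries k lam S θ R y) =
        newSeries k lam S θ R (u - newSeries k lam S θ (X ^ 2 * Q') y) := by
      have h2 : stdNewB k lam S θ (newSeries k lam S θ R y) =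
          newSeries k lam S θ R (stdNewB k lam S θ y) := by
        rw [← evalSeries_X_mul_apply, mul_comm, newSeries_mul_apply, evalSeries_X]
      have h3 : X ^ 2 * derivative ℂ R = -(R * (X ^ 2 * Q')) := by rw [hR]; ring
      rw [stdNewA_newSeries, h2, h3, map_neg, LinearMap.neg_apply, newSeries_mul_apply, hu,
        map_sub, map_sub, map_smul]
      abel
    rw [h1]
    apply newSeries_mem_flag
    intro m hm
    rcases hm.eq_or_lt with rfl | hm
    · rw [map_sub, hQ, sub_self]
    · rw [map_sub, huF m hm, newSeries_mem_flag _ hy m hm, sub_zero]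

/-- Vectors of a standard module giving a presentation of `θ_* E`. -/
structure IsNewPresentation (k : ℕ) (lam : ℕ → ℚ) (S : ℕ → ℂ⟦X⟧) (θ : ℂ⟦X⟧) (j : ℕ)
    (e : ℕ → stdModule k lam S) (S' : ℕ → ℂ⟦X⟧) : Prop where
  flag : ∀ n < j, e n ∈ (stdFlag k lam S (n + 1)).carrier
  weight : ∀ n < j, ∀ w, w + n + 1 = k → e n ∈ weightFiltration k lam S w
  lead : ∀ n < j, coeff 0 (coord n (e n)) ≠ 0
  coeff_zero : ∀ n, 1 ≤ n → n ≤ j → coeff 0 (S' n) = 1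
  a_zero : 0 < j → stdNewA k lam S θ (e 0) = (lam 1 : ℂ) • stdNewB k lam S θ (e 0)
  a_succ : ∀ n, n + 1 < j → stdNewA k lam S θ (e (n + 1)) =
    (lam (n + 2) : ℂ) • stdNewB k lam S θ (e (n + 1)) + newSeries k lam S θ (S' (n + 1)) (e n)

/-- The descent of `exists_isPresentation` for the operators a' and b'. Generation is replaced by
two explicit conditions: y has weight k - j, and its coordinate on e_j has a nonzero constant term.
The next vector (a' - λ b') e₀ inherits them, its leading coefficient being multiplied by χ because
S_j(0) = 1. -/
theorem exists_isNewPresentation_aux (hθ : IsChangeOfVariable θ)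
    (hS : ∀ n, 1 ≤ n → n < k → coeff 0 (S n) = 1) :
    ∀ j w, w + j = k → ∀ y ∈ (stdFlag k lam S j).carrier, y ∈ weightFiltration k lam S w →
      (1 ≤ j → coeff 0 (coord (j - 1) y) ≠ 0) →
      ∃ e S', IsNewPresentation k lam S θ j e S' ∧
        (1 ≤ j → y = newSeries k lam S θ (S' j) (e (j - 1))) := by
  intro j
  induction j with
  | zero =>
    intro w _ y _ _ _
    exact ⟨fun _ => 0, fun _ => 1, ⟨fun n hn => absurd hn (Nat.not_lt_zero _),
      fun n hn => absurd hn (Nat.not_lt_zero _), fun n hn => absurd hn (Nat.not_lt_zero _),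
      fun n h h' => by omega, fun h => absurd h (Nat.not_lt_zero _), fun n hn => by omega⟩,
      fun h => by omega⟩
  | succ j ih =>
    intro w hwj y hy hyw hyc
    obtain ⟨R, e₀, hR0, hye, heF, heW, hec, hf⟩ :=
      exists_newSeries_eigen hθ hy (hyc (by omega)) hyw
    set f := stdNewA k lam S θ e₀ - (lam (j + 1) : ℂ) • stdNewB k lam S θ e₀ with hfd
    have hWad := weightFiltration_admissible (k := k) (lam := lam) (S := S)
    have hexp := stdNew_expansion hWad hθ.1 (lam (j + 1) : ℂ) heW
    rw [← hfd] at hexp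
    have hA2 := hWad.degA _ _ (hWad.degA _ _ heW)
    have hbA := hWad.degB _ _ (hWad.degA _ _ heW)
    have hfW : f ∈ weightFiltration k lam S (w + 1) := by
      have hle := weightFiltration_complete (k := k) (lam := lam) (S := S) |>.anti
      have h1 := hle (show w + 1 ≤ w + 3 by omega) hexp
      refine (Submodule.sub_mem_iff_left _ ?_).1 h1
      have h2 := hWad.degA _ _ heW
      have h3 := hWad.degB _ _ heW
      have h4 := hle (show w + 1 ≤ w + 1 + 1 by omega) hA2
      have h5 := hle (show w + 1 ≤ w + 1 + 1 by omega) hbA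
      exact Submodule.sub_mem _ (Submodule.add_mem _ (Submodule.smul_mem _ _ h2)
        (Submodule.smul_mem _ _ h4)) (Submodule.smul_mem _ _ (Submodule.add_mem _
        (Submodule.smul_mem _ _ h3) (Submodule.smul_mem _ _ h5)))
    have hfc : 1 ≤ j → coeff 0 (coord (j - 1) f) ≠ 0 := by
      intro hj
      obtain ⟨j, rfl⟩ : ∃ j', j = j' + 1 := ⟨j - 1, by omega⟩
      rw [Nat.add_sub_cancel]
      have h1 := hexp j 0 (by omega)
      rw [map_sub, map_sub, sub_eq_zero] at h1
      have h4 := hA2 j 0 (by omega)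
      rw [h1]
      simp only [map_sub, map_add, coord_complex_smul, coeff_smul, h4, coeff_zero_coord_b,
        coeff_zero_coord_a, smul_eq_mul, mul_zero, add_zero, sub_zero]
      rw [hS _ (by omega) (by omega), one_mul]
      exact mul_ne_zero hθ.2 hec
    obtain ⟨e, S', hp, hl⟩ := ih (w + 1) (by omega) f hf hfW hfc
    have hen : ∀ n < j, Function.update e j e₀ n = e n := fun n hn =>
      Function.update_of_ne (by omega) _ _
    have hSn : ∀ n ≤ j, Function.update S' (j + 1) R n = S' n := fun n hn =>
      Function.update_of_ne (by omega) _ _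
    have hee : Function.update e j e₀ j = e₀ := Function.update_self _ _ _
    have hEa : stdNewA k lam S θ e₀ = (lam (j + 1) : ℂ) • stdNewB k lam S θ e₀ + f := by
      rw [hfd]; abel
    refine ⟨Function.update e j e₀, Function.update S' (j + 1) R,
      ⟨fun n hn => ?_, fun n hn w' hw' => ?_, fun n hn => ?_, fun n h1 hn => ?_, fun _ => ?_,
      fun n hn => ?_⟩, fun _ => ?_⟩
    · rcases Nat.lt_succ_iff_lt_or_eq.1 hn with h | rfl
      · rw [hen n h]; exact hp.flag n h
      · rw [hee]; exact heF
    · rcases Nat.lt_succ_iff_lt_or_eq.1 hn with h | rfl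
      · rw [hen n h]; exact hp.weight n h w' hw'
      · rw [hee]
        obtain rfl : w' = w := by omega
        exact heW
    · rcases Nat.lt_succ_iff_lt_or_eq.1 hn with h | rfl
      · rw [hen n h]; exact hp.lead n h
      · rw [hee]; exact hec
    · rcases Nat.le_or_eq_of_le_succ hn with h | rfl
      · rw [hSn n h]; exact hp.coeff_zero n h1 h
      · rw [Function.update_self]; exact hR0
    · rcases Nat.eq_zero_or_pos j with rfl | h
      · rw [hee, hEa]
        have : f = 0 := coord_ext fun n _ => by rw [hf n (Nat.zero_le n), map_zero]
        rw [this, add_zero]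
      · rw [hen 0 h]; exact hp.a_zero h
    · rcases Nat.lt_succ_iff_lt_or_eq.1 hn with h | rfl
      · rw [hen _ h, hen n (by omega), hSn _ h.le]; exact hp.a_succ n h
      · rw [hee, hen n (by omega), hSn _ le_rfl, hEa]
        congr 1
        simpa using hl (by omega)
    · rw [Function.update_self, Nat.add_sub_cancel, hee]
      exact hye

theorem exists_isNewPresentation (hθ : IsChangeOfVariable θ)
    (hS : ∀ n, 1 ≤ n → n < k → coeff 0 (S n) = 1) :
    ∃ e S', IsNewPresentation k lam S θ k e S' := by
  obtain ⟨e, S', h, -⟩ := exists_isNewPresentation_aux hθ hS k 0 (by omega)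
    (stdBasis k lam S (k - 1)) (fun m hm => coord_of_le hm _)
    (by rw [weightFiltration_complete.zero]; trivial)
    (fun hk => by rw [coord_stdBasis_self (by omega)]; simp)
  exact ⟨e, S', h⟩

end Weight

/-! ### The direct image of a standard module -/

section Pushforward

variable {k : ℕ} {lam : ℕ → ℚ} {S S' : ℕ → ℂ⟦X⟧} {θ : ℂ⟦X⟧} {e : ℕ → stdModule k lam S}

theorem stdBasis_mem_weightFiltration {m w : ℕ} (hw : w + m + 1 = k) :
    stdBasis k lam S m ∈ weightFiltration k lam S w := by
  intro n i hi
  rw [coord_stdBasis_of_ne (by omega), map_zero]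

theorem X_pow_mem_seriesFiltration (q : ℕ) : (X ^ q : ℂ⟦X⟧) ∈ seriesFiltration q :=
  mem_seriesFiltration_iff_dvd.2 dvd_rfl

/-- The operator comparing the new basis with the standard basis. -/
theorem IsNewPresentation.comparison_hasDegree (hχ : coeff 1 θ ≠ 0)
    (h : IsNewPresentation k lam S θ k e S') {m n : ℕ} (hm : m < k) {x : stdModule k lam S}
    (hx : x ∈ weightFiltration k lam S n) :
    newSeries k lam S θ ((coeff 0 (coord m (e m)))⁻¹ • rescaleLin (coeff 1 θ)⁻¹ (coord m x)) (e m)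
      - coord m x • stdBasis k lam S m ∈ weightFiltration k lam S (n + 1) := by
  obtain ⟨w, hw⟩ : ∃ w, w + m + 1 = k := ⟨k - 1 - m, by omega⟩
  set χ := coeff 1 θ with hχd
  set c := coeff 0 (coord m (e m)) with hc
  set T := coord m x with hT
  -- The subtraction is truncated: for n < w no vanishing of the coordinate is known, and the weight
  -- w of e_m alone suffices.
  set q := n - w with hq
  have hTq : T ∈ seriesFiltration q := fun i hi => hx m i (by omega)
  have hanti := weightFiltration_complete (k := k) (lam := lam) (S := S) |>.anti
  have h1 : c⁻¹ • rescaleLin χ⁻¹ T ∈ seriesFiltration q :=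
    Submodule.smul_mem _ _ (rescaleLin_mem hTq)
  have h2 := newSeries_leading (θ := θ) weightFiltration_admissible h1 (h.weight m hm w hw)
  have h3 : e m - c • stdBasis k lam S m ∈ weightFiltration k lam S (w + 1) := by
    intro n i hi
    rw [map_sub, coord_complex_smul]
    rcases lt_trichotomy n m with h' | rfl | h'
    · omega
    · obtain rfl : i = 0 := by omega
      rw [coord_stdBasis_self hm, map_sub, coeff_smul, ← hc]
      simp
    · rw [coord_stdBasis_of_ne h'.ne', h.flag m hm n h', smul_zero, sub_zero, map_zero]
  have h4 := smul_mem_weightFiltration (X_pow_mem_seriesFiltration q) h3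
  have h5 : T - coeff q T • X ^ q ∈ seriesFiltration (q + 1) := by
    intro i hi
    rw [map_sub, coeff_smul, coeff_X_pow]
    rcases Nat.lt_succ_iff_lt_or_eq.1 hi with h' | rfl
    · rw [if_neg (by omega), hTq i h', smul_zero, sub_zero]
    · rw [if_pos rfl, smul_eq_mul, mul_one, sub_self]
  have h6 := smul_mem_weightFiltration h5 (stdBasis_mem_weightFiltration (lam := lam) (S := S) hw)
  rw [show w + 1 + q = w + q + 1 by ring] at h4
  set α := coeff q (c⁻¹ • rescaleLin χ⁻¹ T) * χ ^ q with hα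
  have hαc : α * c = coeff q T := by
    rw [hα, coeff_smul, coeff_rescaleLin, smul_eq_mul]
    have e1 : (χ ^ q)⁻¹ * χ ^ q = 1 := inv_mul_cancel₀ (pow_ne_zero _ hχ)
    have e2 : c⁻¹ * c = 1 := inv_mul_cancel₀ (h.lead m hm)
    rw [inv_pow]
    linear_combination coeff q T * ((χ ^ q)⁻¹ * χ ^ q) * e2 + coeff q T * e1
  have h7 := Submodule.sub_mem _ (Submodule.add_mem _ h2 (Submodule.smul_mem _ α h4)) h6
  refine hanti (show n + 1 ≤ w + q + 1 by omega) ?_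
  convert h7 using 1
  have h8 : (coeff q T • X ^ q : ℂ⟦X⟧) • stdBasis k lam S m
      = α • (X ^ q : ℂ⟦X⟧) • c • stdBasis k lam S m := by
    rw [← complex_smul_comm, smul_smul, hαc, complex_smul_def, smul_smul, smul_eq_C_mul]
  rw [sub_smul, h8, smul_sub, smul_sub]
  abel

/-- The map `(T_m) ↦ ∑ T_m(b θ'(a)) e_m`. -/
def newMap (k : ℕ) (lam : ℕ → ℚ) (S S' : ℕ → ℂ⟦X⟧) (θ : ℂ⟦X⟧) (e : ℕ → stdModule k lam S) :
    stdModule k lam S' →+ stdModule k lam S where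
  toFun T := ∑ m ∈ Finset.range k, newSeries k lam S θ (coord m T) (e m)
  map_zero' := by simp
  map_add' T T' := by simp [Finset.sum_add_distrib]

theorem newMap_apply (T : stdModule k lam S') : newMap k lam S S' θ e T =
    ∑ m ∈ Finset.range k, newSeries k lam S θ (coord m T) (e m) := rfl

/-- After the bijective rescaling T ↦ c⁻¹ T(χ⁻¹ X) of each coordinate, the map is the identity plus
an operator that raises the weight. -/
theorem IsNewPresentation.bijective (hχ : coeff 1 θ ≠ 0)
    (h : IsNewPresentation k lam S θ k e S') : Function.Bijective (newMap k lam S S' θ e) := by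
  let c : ℕ → ℂ := fun m => coeff 0 (coord m (e m))
  have hc : ∀ m < k, c m ≠ 0 := h.lead
  let ψ : Module.End ℂ (stdModule k lam S) :=
    { toFun := fun x => ∑ m ∈ Finset.range k,
        newSeries k lam S θ ((c m)⁻¹ • rescaleLin (coeff 1 θ)⁻¹ (coord m x)) (e m)
      map_add' := fun x y => by
        simp only [map_add, smul_add, LinearMap.add_apply, Finset.sum_add_distrib]
      map_smul' := fun d x => by
        simp only [coord_complex_smul, map_smul, LinearMap.smul_apply, RingHom.id_apply,
          Finset.smul_sum]
        refine Finset.sum_congr rfl fun m _ => ?_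
        rw [smul_comm] }
  have hψ : ∀ x, ψ x = ∑ m ∈ Finset.range k,
      newSeries k lam S θ ((c m)⁻¹ • rescaleLin (coeff 1 θ)⁻¹ (coord m x)) (e m) := fun _ => rfl
  have hdeg : HasDegree (weightFiltration k lam S) 1 (ψ - 1) := by
    intro n x hx
    have h1 : (ψ - 1) x = ∑ m ∈ Finset.range k, (newSeries k lam S θ ((c m)⁻¹ •
        rescaleLin (coeff 1 θ)⁻¹ (coord m x)) (e m) - coord m x • stdBasis k lam S m) := by
      rw [Finset.sum_sub_distrib, sum_coord_smul, LinearMap.sub_apply, hψ, Module.End.one_apply]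
    rw [h1]
    exact Submodule.sum_mem _ fun m hm => h.comparison_hasDegree hχ (Finset.mem_range.1 hm) hx
  obtain ⟨⟨hinj, hsurj⟩, -⟩ := bijective_of_sub_hasDegree weightFiltration_complete hdeg
  constructor
  · rw [injective_iff_map_eq_zero]
    intro T hT
    have h1 : ψ (ofCoord k lam S fun m => c m • rescaleLin (coeff 1 θ) (coord m T)) = ψ 0 := by
      rw [map_zero, hψ, ← hT, newMap_apply]
      refine Finset.sum_congr rfl fun m hm => ?_
      rw [coord_ofCoord (Finset.mem_range.1 hm), map_smul (rescaleLin _), smul_smul,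
        inv_mul_cancel₀ (hc m (Finset.mem_range.1 hm)), one_smul,
        rescaleLin_rescaleLin (inv_mul_cancel₀ hχ)]
    have h2 := hinj h1
    apply coord_ext
    intro m hm
    have h3 := congrArg (coord m) h2
    rw [coord_ofCoord hm, map_zero] at h3
    have h4 := (smul_eq_zero.1 h3).resolve_left (hc m hm)
    rw [map_zero, ← rescaleLin_rescaleLin (inv_mul_cancel₀ hχ) (coord m T), h4, map_zero]
  · intro y
    obtain ⟨x, rfl⟩ := hsurj y
    refine ⟨ofCoord k lam S' fun m => (c m)⁻¹ • rescaleLin (coeff 1 θ)⁻¹ (coord m x), ?_⟩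
    rw [newMap_apply, hψ]
    refine Finset.sum_congr rfl fun m hm => ?_
    rw [coord_ofCoord (Finset.mem_range.1 hm)]

theorem newMap_X_smul (T : stdModule k lam S') : newMap k lam S S' θ e ((X : ℂ⟦X⟧) • T) =
    stdNewB k lam S θ (newMap k lam S S' θ e T) := by
  rw [newMap_apply, newMap_apply, map_sum]
  refine Finset.sum_congr rfl fun m _ => ?_
  rw [map_smul, smul_eq_mul, evalSeries_X_mul_apply]

theorem newMap_a (h : IsNewPresentation k lam S θ k e S') (T : stdModule k lam S') :
    newMap k lam S S' θ e ((stdModule k lam S').a T) =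
      stdNewA k lam S θ (newMap k lam S S' θ e T) := by
  rw [newMap_apply, newMap_apply, map_sum]
  have h1 : ∀ m, newSeries k lam S θ (coord m ((stdModule k lam S').a T)) (e m) =
      newSeries k lam S θ (C (lam (m + 1) : ℂ) * X * coord m T) (e m) +
        newSeries k lam S θ (X ^ 2 * derivative ℂ (coord m T)) (e m) +
        newSeries k lam S θ (S' (m + 1) * coord (m + 1) T) (e m) := by
    intro m
    rw [coord_a, map_add, map_add]
    rfl
  have h2 : ∀ m, newSeries k lam S θ (C (lam (m + 1) : ℂ) * X * coord m T) (e m) =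
      newSeries k lam S θ (coord m T) ((lam (m + 1) : ℂ) • stdNewB k lam S θ (e m)) := by
    intro m
    rw [mul_assoc, evalSeries_C_mul, LinearMap.smul_apply, map_smul, mul_comm X,
      newSeries_mul_apply, evalSeries_X]
  simp only [h1, h2, stdNewA_newSeries, Finset.sum_add_distrib]
  -- Each a' e_{m+1} contributes a term on e_m. Collecting these by target index leaves one summand
  -- fewer, whence the truncated `N - 1`.
  have h3 : ∀ N ≤ k, ∑ m ∈ Finset.range N, newSeries k lam S θ (coord m T)
      (stdNewA k lam S θ (e m)) = ∑ m ∈ Finset.range N, newSeries k lam S θ (coord m T)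
        ((lam (m + 1) : ℂ) • stdNewB k lam S θ (e m)) +
      ∑ m ∈ Finset.range (N - 1), newSeries k lam S θ (S' (m + 1) * coord (m + 1) T) (e m) := by
    intro N
    induction N with
    | zero => simp
    | succ N ih =>
      intro hN
      rw [Finset.sum_range_succ, ih (by omega), Finset.sum_range_succ]
      cases N with
      | zero => simp [h.a_zero (by omega)]
      | succ N =>
        rw [h.a_succ N (by omega), Nat.add_sub_cancel, Nat.add_sub_cancel,
          Finset.sum_range_succ (fun m =>
            newSeries k lam S θ (S' (m + 1) * coord (m + 1) T) (e m)) N, map_add,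
          mul_comm (S' (N + 1)), newSeries_mul_apply]
        abel
  rw [h3 k le_rfl]
  have h4 : ∑ m ∈ Finset.range k, newSeries k lam S θ (S' (m + 1) * coord (m + 1) T) (e m) =
      ∑ m ∈ Finset.range (k - 1), newSeries k lam S θ (S' (m + 1) * coord (m + 1) T) (e m) := by
    cases k with
    | zero => rfl
    | succ k =>
      rw [Finset.sum_range_succ, Nat.add_sub_cancel, coord_of_le le_rfl, mul_zero, map_zero,
        LinearMap.zero_apply, add_zero]
  rw [h4]
  abel

/-- Elements of weight N + k are divisible by b^N, so convergence for the weight filtration implies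
b-adic convergence. -/
theorem isSeriesAction_evalSeries (T : ℂ⟦X⟧) (x : stdModule k lam S) :
    IsSeriesAction (stdModule k lam S) T x
      (evalSeries weightFiltration_complete weightFiltration_admissible.degA T x) := by
  intro N
  refine ⟨N + k, fun m hm => ?_⟩
  have h1 := weightFiltration_complete.anti hm (evalSeries_sub_partialSum weightFiltration_complete
    (weightFiltration_admissible (k := k) (lam := lam) (S := S)).degA T m x)
  rw [partialSum_apply] at h1
  have h2 : ∀ i, (aEnd (stdModule k lam S) ^ i) x = (stdModule k lam S).a^[i] x := fun i =>
    Module.End.pow_apply _ _ _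
  simp only [h2] at h1
  have h3 : ∀ y ∈ weightFiltration k lam S (N + k), ∃ z, y = (X ^ N : ℂ⟦X⟧) • z := by
    intro y hy
    have : ∀ n, ∃ g, coord n y = X ^ N * g := fun n =>
      X_pow_dvd_iff.2 fun i hi => hy n i (by omega)
    choose g hg using this
    refine ⟨ofCoord k lam S g, coord_ext fun n hn => ?_⟩
    rw [map_smul, coord_ofCoord hn, smul_eq_mul, hg]
  exact h3 _ h1

theorem IsNewPresentation.isPushforward (hχ : coeff 1 θ ≠ 0)
    (h : IsNewPresentation k lam S θ k e S') :
    IsPushforward θ (stdModule k lam S) (stdModule k lam S') := by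
  let φ : stdModule k lam S' ≃+ stdModule k lam S :=
    AddEquiv.ofBijective (newMap k lam S S' θ e) (h.bijective hχ)
  have hφ : ∀ x, φ x = newMap k lam S S' θ e x := fun _ => rfl
  refine ⟨φ, fun c x => ?_, fun x => ?_, fun x => ?_⟩
  · rw [hφ, hφ, cMul_eq_smul, cMul_eq_smul, newMap_apply, newMap_apply, Finset.smul_sum]
    refine Finset.sum_congr rfl fun m _ => ?_
    rw [coord_complex_smul, map_smul, LinearMap.smul_apply]
  · rw [hφ, hφ, newMap_a h]
    exact isSeriesAction_evalSeries θ _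
  · refine ⟨_, isSeriesAction_evalSeries (derivative ℂ θ) _, ?_⟩
    rw [hφ, hφ, bMul, newMap_X_smul]
    rfl

/-! ### The action of a change of variable on `γ` -/

/-- Take the coefficient of b² on the vector's own coordinate, where a maps b^q to (λ + q) b^{q+1}.
The terms in τ add up to τ ((λ + 1)λ - 2λ²) = -τ λ(λ - 1). -/
theorem newPresentation_diag (hθ : coeff 0 θ = 0) {n w : ℕ} (hw : w + n + 1 = k)
    {z : stdModule k lam S} (hz : z ∈ (stdFlag k lam S (n + 1)).carrier)
    (hzW : z ∈ weightFiltration k lam S w)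
    (h : coord n (stdNewA k lam S θ z - (lam (n + 1) : ℂ) • stdNewB k lam S θ z) = 0) :
    coeff 1 θ * coeff 1 (coord n z) =
      coeff 2 θ * (lam (n + 1) : ℂ) * ((lam (n + 1) : ℂ) - 1) * coeff 0 (coord n z) := by
  have h1 := stdNew_expansion weightFiltration_admissible hθ (lam (n + 1) : ℂ) hzW n 2 (by omega)
  have hz1 : coord (n + 1) z = 0 := hz _ le_rfl
  have hz2 : coord (n + 1) (aEnd _ z) = 0 := (stdFlag k lam S (n + 1)).stable _ hz _ le_rfl
  rw [map_sub, h, zero_sub, map_neg, neg_eq_zero] at h1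
  simp only [map_sub, map_add, coord_complex_smul, coeff_smul, smul_eq_mul] at h1
  rw [coeff_succ_coord_a n 1 z, coeff_succ_coord_a n 1 (aEnd _ z), coeff_succ_coord_b n 1 z,
    coeff_succ_coord_b n 1 (aEnd _ z), coeff_succ_coord_a n 0 z, hz1, hz2] at h1
  simp only [mul_zero, map_zero, add_zero, Nat.cast_zero, Nat.cast_one] at h1
  linear_combination h1

/-- The coefficients of degree 0 and 1 one index below the diagonal vector. Weights make the error
terms of the expansions vanish in these degrees. -/
theorem newPresentation_offdiag (hθ : coeff 0 θ = 0) {m w : ℕ} (hw : w + m + 2 = k)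
    (hS : coeff 0 (S (m + 1)) = 1)
    {z z' : stdModule k lam S} (hz : z ∈ (stdFlag k lam S (m + 2)).carrier)
    (hzW : z ∈ weightFiltration k lam S w) (hzW' : z' ∈ weightFiltration k lam S (w + 1))
    {T : ℂ⟦X⟧} (hT : coeff 0 T = 1)
    (h : stdNewA k lam S θ z = (lam (m + 2) : ℂ) • stdNewB k lam S θ z + newSeries k lam S θ T z') :
    coeff 0 (coord m z') = coeff 1 θ * coeff 0 (coord (m + 1) z) ∧
    coeff 1 (coord m z') + coeff 1 T * coeff 1 θ * coeff 0 (coord m z') =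
      coeff 1 θ * (coeff 1 (coord (m + 1) z) + coeff 1 (S (m + 1)) * coeff 0 (coord (m + 1) z)
        - ((lam (m + 2) : ℂ) - lam (m + 1)) * coeff 0 (coord m z))
        - coeff 2 θ * ((lam (m + 2) : ℂ) - lam (m + 1)) * coeff 0 (coord (m + 1) z) := by
  have h1 := stdNew_expansion weightFiltration_admissible hθ (lam (m + 2) : ℂ) hzW
  have h2 := (weightFiltration_admissible (k := k) (lam := lam) (S := S)).evalSeries_newB_sub_mem_two
    weightFiltration_complete weightFiltration_admissible.degA weightFiltration_admissible.degB θ T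
    hzW'
  rw [h, add_sub_cancel_left] at h1
  have hD := Submodule.sub_mem _ h1 h2
  rw [sub_sub_sub_cancel_left, hT, one_smul] at hD
  have hz1 : coord (m + 1 + 1) z = 0 := hz _ le_rfl
  have e0 := hD m 0 (by omega)
  have e1 := hD m 1 (by omega)
  simp only [map_sub, map_add, coord_complex_smul, coeff_smul, smul_eq_mul] at e0 e1
  rw [coeff_zero_coord_a, coeff_zero_coord_a, coeff_zero_coord_a, coeff_zero_coord_b,
    coeff_zero_coord_b, coeff_zero_coord_b, hz1, hS] at e0
  simp only [map_zero, mul_zero, add_zero, sub_zero, one_mul] at e0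
  rw [coeff_succ_coord_a m 0 z, coeff_succ_coord_a m 0 (aEnd _ z), coeff_succ_coord_b m 0 z,
    coeff_succ_coord_b m 0 (aEnd _ z), coeff_succ_coord_b m 0 z', zero_add, coeff_one_mul',
    coeff_one_mul', coeff_zero_coord_a, coeff_zero_coord_a, coeff_succ_coord_a (m + 1) 0 z, hz1,
    hS] at e1
  simp only [map_zero, mul_zero, add_zero, one_mul, Nat.cast_zero] at e1
  refine ⟨by linear_combination e0, ?_⟩
  linear_combination e1

/-- Two indices down, the constant term of a² e_{m+3} is 1. This is where τ enters the relation
between neighbouring constant terms, which are no longer merely proportional. -/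
theorem newPresentation_lower (hθ : coeff 0 θ = 0) {m w : ℕ} (hw : w + m + 3 = k)
    (hS : coeff 0 (S (m + 1)) = 1) (hS' : coeff 0 (S (m + 2)) = 1)
    {z z' : stdModule k lam S}
    (hzW : z ∈ weightFiltration k lam S w) (hzW' : z' ∈ weightFiltration k lam S (w + 1))
    {T : ℂ⟦X⟧} (hT : coeff 0 T = 1)
    (h : stdNewA k lam S θ z = (lam (m + 3) : ℂ) • stdNewB k lam S θ z + newSeries k lam S θ T z') :
    coeff 0 (coord m z') = coeff 1 θ * coeff 0 (coord (m + 1) z)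
      + coeff 2 θ * coeff 0 (coord (m + 2) z) := by
  have h1 := stdNew_expansion weightFiltration_admissible hθ (lam (m + 3) : ℂ) hzW
  have h2 := (weightFiltration_admissible (k := k) (lam := lam) (S := S)).evalSeries_newB_sub_mem_two
    weightFiltration_complete weightFiltration_admissible.degA weightFiltration_admissible.degB θ T
    hzW'
  rw [h, add_sub_cancel_left] at h1
  have hD := Submodule.sub_mem _ h1 h2
  rw [sub_sub_sub_cancel_left, hT, one_smul] at hD
  have e0 := hD m 0 (by omega)
  simp only [map_sub, map_add, coord_complex_smul, coeff_smul, smul_eq_mul] at e0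
  rw [coeff_zero_coord_a, coeff_zero_coord_a, coeff_zero_coord_a, coeff_zero_coord_b,
    coeff_zero_coord_b, coeff_zero_coord_b, hS, hS'] at e0
  linear_combination e0

/-- The argument of `gammaOf_eq_of_iso` carried to second order in θ. The undetermined constant `y2`
still cancels in γ, and what remains is τ/χ times a cubic polynomial in three consecutive λ, which
factors as the weight factor. -/
theorem IsNewPresentation.gammaOf_eq (hθ : IsChangeOfVariable θ)
    (hS : ∀ n, 1 ≤ n → n < k → coeff 0 (S n) = 1)
    (h : IsNewPresentation k lam S θ k e S') {l : ℕ} (hl : 1 ≤ l) (hlk : l + 2 ≤ k) :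
    coeff 1 θ * gammaOf lam S' l =
      gammaOf lam S l - coeff 2 θ / coeff 1 θ * weightFactor lam l := by
  obtain ⟨hθ0, hχ⟩ := hθ
  obtain ⟨l, rfl⟩ : ∃ l', l = l' + 1 := ⟨l - 1, by omega⟩
  obtain ⟨w, hw⟩ : ∃ w, w + l + 3 = k := ⟨k - (l + 3), by omega⟩
  have hflag : ∀ n, ∀ x ∈ (stdFlag k lam S (n + 1)).carrier, ∀ T,
      coord (n + 1) (newSeries k lam S θ T x) = 0 := fun n x hx T =>
    newSeries_mem_flag T hx _ le_rfl
  have d0 := newPresentation_diag hθ0 (n := l) (w := w + 2) (by omega) (h.flag l (by omega))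
    (h.weight l (by omega) _ (by omega)) (by
      cases l with
      | zero => rw [h.a_zero (by omega), zero_add, sub_self, map_zero]
      | succ l =>
        rw [h.a_succ l (by omega), add_sub_cancel_left]
        exact hflag _ _ (h.flag l (by omega)) _)
  have d1 := newPresentation_diag hθ0 (n := l + 1) (w := w + 1) (by omega)
    (h.flag (l + 1) (by omega)) (h.weight (l + 1) (by omega) _ (by omega)) (by
        rw [h.a_succ l (by omega), add_sub_cancel_left]
        exact hflag _ _ (h.flag l (by omega)) _)
  have d2 := newPresentation_diag hθ0 (n := l + 2) (w := w) (by omega)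
    (h.flag (l + 2) (by omega)) (h.weight (l + 2) (by omega) _ (by omega)) (by
        rw [h.a_succ (l + 1) (by omega), add_sub_cancel_left]
        exact hflag _ _ (h.flag (l + 1) (by omega)) _)
  obtain ⟨c0, o0⟩ := newPresentation_offdiag hθ0 (m := l) (w := w + 1) (by omega)
    (hS _ (by omega) (by omega)) (h.flag (l + 1) (by omega))
    (h.weight (l + 1) (by omega) _ (by omega)) (h.weight l (by omega) _ (by omega))
    (h.coeff_zero _ (by omega) (by omega)) (h.a_succ l (by omega))
  obtain ⟨c1, o1⟩ := newPresentation_offdiag hθ0 (m := l + 1) (w := w) (by omega)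
    (hS _ (by omega) (by omega)) (h.flag (l + 2) (by omega))
    (h.weight (l + 2) (by omega) _ (by omega)) (h.weight (l + 1) (by omega) _ (by omega))
    (h.coeff_zero _ (by omega) (by omega)) (h.a_succ (l + 1) (by omega))
  have y1 := newPresentation_lower hθ0 (m := l) (w := w) (by omega)
    (hS _ (by omega) (by omega)) (hS _ (by omega) (by omega))
    (h.weight (l + 2) (by omega) _ (by omega)) (h.weight (l + 1) (by omega) _ (by omega))
    (h.coeff_zero _ (by omega) (by omega)) (h.a_succ (l + 1) (by omega))
  have hc := h.lead (l + 2) (by omega)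
  simp only [gammaOf, weightFactor, pNum]
  push_cast
  simp only [show l + 1 + 1 = l + 2 from rfl, show l + 1 + 2 = l + 3 from rfl] at *
  generalize coeff 0 (coord (l + 2) (e (l + 2))) = c at *
  generalize coeff 1 (coord (l + 2) (e (l + 2))) = x2 at *
  generalize coeff 0 (coord (l + 1) (e (l + 2))) = y2 at *
  generalize coeff 0 (coord (l + 1) (e (l + 1))) = c1 at *
  generalize coeff 1 (coord (l + 1) (e (l + 1))) = x1 at *
  generalize coeff 0 (coord l (e (l + 1))) = y1 at *
  generalize coeff 0 (coord l (e l)) = c0 at *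
  generalize coeff 1 (coord l (e l)) = x0 at *
  generalize coeff 1 (S (l + 1)) = s1 at *
  generalize coeff 1 (S (l + 2)) = s2 at *
  generalize coeff 1 (S' (l + 1)) = s1' at *
  generalize coeff 1 (S' (l + 2)) = s2' at *
  generalize ((lam (l + 1) : ℚ) : ℂ) = a1 at *
  generalize ((lam (l + 2) : ℚ) : ℂ) = a2 at *
  generalize ((lam (l + 3) : ℚ) : ℂ) = a3 at *
  generalize coeff 1 θ = χ at *
  generalize coeff 2 θ = τ at *
  obtain ⟨t, rfl⟩ : ∃ t, τ = t * χ := ⟨τ / χ, by field_simp⟩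
  rw [mul_div_assoc, div_self hχ, mul_one]
  subst c1
  subst c0
  subst y1
  have d0' : x0 = t * a1 * (a1 - 1) * (χ * (χ * c)) := by
    apply mul_left_cancel₀ hχ; linear_combination d0
  have d1' : x1 = t * a2 * (a2 - 1) * (χ * c) := by
    apply mul_left_cancel₀ hχ; linear_combination d1
  have d2' : x2 = t * a3 * (a3 - 1) * c := by
    apply mul_left_cancel₀ hχ; linear_combination d2
  subst d0' d1' d2'
  -- With τ = tχ, the leading coefficients are c, χc, χ²c from the top down. `top` and `bot` are the
  -- degree-one relations divided by powers of χ. Eliminating `y2` leaves -t c (a2 - a1)(a3 - a2)(a3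
  -- - a1 + 1) as the correction.
  have top : t * a2 * (a2 - 1) * c + χ * s2' * c = t * a3 * (a3 - 1) * c + s2 * c
      - (a3 - a2) * y2 - t * (a3 - a2) * c := by
    apply mul_left_cancel₀ hχ; linear_combination o1
  have bot : t * a1 * (a1 - 1) * c + χ * s1' * c = t * a2 * (a2 - 1) * c + s1 * c
      - (a2 - a1) * (y2 + t * c) - t * (a2 - a1) * c := by
    apply mul_left_cancel₀ (pow_ne_zero 2 hχ); linear_combination o0
  apply mul_left_cancel₀ hc
  linear_combination (a3 - a2) * bot - (a2 - a1) * top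

end Pushforward

/-! ### Uniqueness of the direct image -/

theorem IsSeriesAction.unique {E : PreABModule} (hE : IsABModule E) {T : ℂ⟦X⟧} {x y y' : E}
    (h : IsSeriesAction E T x y) (h' : IsSeriesAction E T x y') : y = y' := by
  refine sub_eq_zero.1 (hE.separated fun N => ?_)
  obtain ⟨M, hM⟩ := h N
  obtain ⟨M', hM'⟩ := h' N
  obtain ⟨z, hz⟩ := hM (max M M') (le_max_left _ _)
  obtain ⟨z', hz'⟩ := hM' (max M M') (le_max_right _ _)
  exact ⟨z - z', by rw [smul_sub, ← hz, ← hz', sub_sub_sub_cancel_right]⟩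

theorem IsSeriesAction.map {E E' : PreABModule} (f : E →ₗ[ℂ⟦X⟧] E')
    (hf : ∀ x, f (E.a x) = E'.a (f x)) {T : ℂ⟦X⟧} {x y : E} (h : IsSeriesAction E T x y) :
    IsSeriesAction E' T (f x) (f y) := by
  have hit : ∀ n x, f (E.a^[n] x) = E'.a^[n] (f x) := fun n =>
    (Function.Semiconj.iterate_right (f := f) hf n)
  intro N
  obtain ⟨M, hM⟩ := h N
  refine ⟨M, fun m hm => ?_⟩
  obtain ⟨z, hz⟩ := hM m hm
  refine ⟨f z, ?_⟩
  rw [← map_smul, ← hz, map_sub, map_sum]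
  simp only [cMul, map_smul, hit]

theorem IsPushforward.of_iso {θ : ℂ⟦X⟧} {E E₀ E' : PreABModule} (h : Iso E E₀)
    (hp : IsPushforward θ E₀ E') : IsPushforward θ E E' := by
  obtain ⟨α, hα⟩ := h.symm
  obtain ⟨φ, hc, ha, hb⟩ := hp
  refine ⟨φ.trans α.toAddEquiv, fun c x => ?_, fun x => ?_, fun x => ?_⟩
  · exact (congrArg α (hc c x)).trans (map_smul α _ _)
  · exact (ha x).map α.toLinearMap hα
  · obtain ⟨y, hy, hby⟩ := hb x
    exact ⟨α y, hy.map α.toLinearMap hα, (congrArg α hby).trans (map_smul α _ _)⟩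

/-- No continuity of ψ is needed: it commutes with polynomials in b, and the remainder X^N T₁ is
sent into b^N E'. The target is b-adically separated. -/
theorem smul_map_of_bMul {E E' : PreABModule} (hE' : IsABModule E') (ψ : E →+ E')
    (hc : ∀ c x, ψ (cMul c x) = cMul c (ψ x)) (hb : ∀ x, ψ (bMul x) = bMul (ψ x))
    (T : ℂ⟦X⟧) (x : E) : ψ (T • x) = T • ψ x := by
  have hpoly : ∀ (P : Polynomial ℂ) (x : E), ψ ((P : ℂ⟦X⟧) • x) = (P : ℂ⟦X⟧) • ψ x := by
    intro P
    induction P using Polynomial.induction_on with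
    | C c => intro x; rw [Polynomial.coe_C]; exact hc c x
    | add P Q hP hQ => intro x; rw [Polynomial.coe_add, add_smul, add_smul, map_add, hP, hQ]
    | monomial n c h =>
      intro x
      have h1 := h (bMul x)
      rw [hb] at h1
      rw [pow_succ, ← mul_assoc, Polynomial.coe_mul, Polynomial.coe_X, mul_smul, mul_smul]
      exact h1
  refine sub_eq_zero.1 (hE'.separated fun N => ?_)
  have hX : ∀ y, ψ ((X ^ N : ℂ⟦X⟧) • y) = (X ^ N : ℂ⟦X⟧) • ψ y := by
    intro y
    have := hpoly (Polynomial.X ^ N) y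
    rwa [Polynomial.coe_pow, Polynomial.coe_X] at this
  refine ⟨ψ ((mk fun i => coeff (i + N) T) • x) - (mk fun i => coeff (i + N) T) • ψ x, ?_⟩
  conv_lhs => rw [eq_X_pow_mul_shift_add_trunc N T]
  rw [add_smul, add_smul, map_add, hpoly, add_sub_add_right_eq_sub, mul_smul, mul_smul, hX,
    smul_sub]

theorem IsPushforward.unique {θ : ℂ⟦X⟧} {E E₁ E₂ : PreABModule} (hE : IsABModule E)
    (hE₂ : IsABModule E₂) (h₁ : IsPushforward θ E E₁) (h₂ : IsPushforward θ E E₂) :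
    Iso E₁ E₂ := by
  obtain ⟨φ₁, hc₁, ha₁, hb₁⟩ := h₁
  obtain ⟨φ₂, hc₂, ha₂, hb₂⟩ := h₂
  let ψ : E₁ ≃+ E₂ := φ₁.trans φ₂.symm
  have hψ : ∀ x, φ₂ (ψ x) = φ₁ x := fun x => φ₂.apply_symm_apply _
  have hc : ∀ c x, ψ (cMul c x) = cMul c (ψ x) := fun c x =>
    φ₂.injective (by rw [hψ, hc₁, hc₂, hψ])
  have ha : ∀ x, ψ (E₁.a x) = E₂.a (ψ x) := fun x => by
    apply φ₂.injective
    rw [hψ]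
    refine (ha₁ x).unique hE ?_
    rw [← hψ x]
    exact ha₂ _
  have hb : ∀ x, ψ (bMul x) = bMul (ψ x) := fun x => by
    apply φ₂.injective
    obtain ⟨y, hy, hby⟩ := hb₁ x
    obtain ⟨y', hy', hby'⟩ := hb₂ (ψ x)
    rw [hψ] at hy'
    rw [hψ, hby, hby', hy.unique hE hy']
  exact ⟨{ ψ with map_smul' := smul_map_of_bMul hE₂ ψ.toAddMonoidHom hc hb }, ha⟩

/-! ### The fresco classes in terms of presentations -/

theorem IsMonogenic.of_iso {E E' : PreABModule} (h : Iso E E') (hE : IsMonogenic E) :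
    IsMonogenic E' := by
  obtain ⟨φ, hφ⟩ := h
  obtain ⟨e, he⟩ := hE
  refine ⟨φ e, fun N hN => ?_⟩
  have h1 := he ⟨N.carrier.comap φ.toLinearMap, fun x hx => by
    have := N.stable _ hx
    rwa [Submodule.mem_comap, LinearEquiv.coe_coe, hφ]⟩ hN
  rw [eq_top_iff]
  intro y _
  obtain ⟨x, rfl⟩ := φ.surjective y
  have h2 : x ∈ N.carrier.comap φ.toLinearMap := by
    rw [show N.carrier.comap φ.toLinearMap = ⊤ from h1]
    trivial
  exact h2

/-- The presentations normalized by `S_j(0) = 1`. -/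
def IsNormalized (k : ℕ) (S : ℕ → ℂ⟦X⟧) : Prop := ∀ n, 1 ≤ n → n < k → coeff 0 (S n) = 1

theorem classOf_eq_iff {E E' : PreABModule} : classOf E = classOf E' ↔ Iso E E' :=
  ⟨Quotient.exact, fun h => Quotient.sound h⟩

section

variable {r : AddCircle (1 : ℚ) → AddCircle (1 : ℚ) → Prop} {k : ℕ} {lam : ℕ → ℚ}
  {S S' : ℕ → ℂ⟦X⟧}

theorem IsNormalized.coeff_ne_zero (hS : IsNormalized k S) :
    ∀ j, 1 ≤ j → j < k → coeff 0 (S j) ≠ 0 := fun j h1 h2 => by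
  rw [hS j h1 h2]
  exact one_ne_zero

theorem classOf_std_mem_frescoClasses (hlam : IsPrincipalSeq r k lam)
    (hsat : ∀ j, 1 ≤ j → j ≤ k → 0 < satLam k lam j) (hS : IsNormalized k S) :
    classOf (stdModule k lam S) ∈ frescoClasses r k lam :=
  ⟨_, rfl, ⟨(isGeometric_std_iff hS.coeff_ne_zero).2 hsat, isMonogenic_std hS.coeff_ne_zero⟩, _,
    isPrincipalJH_std hlam⟩

/-- Together with `classOf_std_mem_frescoClasses` this describes the set of fresco classes by
normalized presentations, under conditions on λ alone. This gives its stability under change of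
variable. -/
theorem exists_std_of_mem_frescoClasses {c : IsoClass} (hc : c ∈ frescoClasses r k lam) :
    IsPrincipalSeq r k lam ∧ (∀ j, 1 ≤ j → j ≤ k → 0 < satLam k lam j) ∧
      ∃ S, IsNormalized k S ∧ classOf (stdModule k lam S) = c := by
  obtain ⟨E, rfl, ⟨hg, hm⟩, F, hF⟩ := hc
  obtain ⟨S, hS, φ, hφ, -⟩ := exists_iso_std hm hF
  have hiso : Iso E (stdModule k lam S) := ⟨φ, hφ⟩
  exact ⟨hF.isPrincipalSeq,
    (isGeometric_std_iff (IsNormalized.coeff_ne_zero hS)).1 (hg.of_iso hiso), S, hS,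
    classOf_eq_iff.2 hiso.symm⟩

theorem isMonogenic_of_mem_frescoClasses {E : PreABModule}
    (hE : classOf E ∈ frescoClasses r k lam) : IsMonogenic E := by
  obtain ⟨E', h, ⟨-, hm⟩, -⟩ := hE
  exact hm.of_iso (classOf_eq_iff.1 h)

variable [IsStrictTotalOrder (AddCircle (1 : ℚ)) r]

theorem piOf_eq_of_iso (hlam : IsPrincipalSeq r k lam) (hS : IsNormalized k S)
    (hS' : IsNormalized k S') (h : Iso (stdModule k lam S) (stdModule k lam S')) {i j : ℕ}
    (hi : 1 ≤ i) (hij : i < j) (hj : j + 2 ≤ k) : piOf lam S i j = piOf lam S' i j := by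
  rw [piOf, piOf, gammaOf_eq_of_iso hlam hS hS' h hi (by omega),
    gammaOf_eq_of_iso hlam hS hS' h (by omega) hj]

/-- In an adapted presentation, F_{h+2}/F_{h-1} is the standard module on the three corresponding
indices. Invariance of γ in rank 3, with shifted λ, takes care of every other presentation of it. -/
theorem isGammaAt_iff (hlam : IsPrincipalSeq r k lam) (hS : IsNormalized k S) {E : PreABModule}
    {F : ℕ → ABSub E} (φ : E ≃ₗ[ℂ⟦X⟧] stdModule k lam S)
    (hφ : ∀ x, φ (E.a x) = (stdModule k lam S).a (φ x))
    (hF : ∀ j ≤ k, ∀ x, x ∈ (F j).carrier ↔ φ x ∈ (stdFlag k lam S j).carrier)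
    {h : ℕ} (h1 : 1 ≤ h) (hk : h + 2 ≤ k) (g : ℂ) :
    IsGammaAt lam F h g ↔ g = gammaOf lam S h := by
  obtain ⟨h, rfl⟩ : ∃ h', h = h' + 1 := ⟨h - 1, by omega⟩
  have hiso : Iso (subquot (F (h + 1 + 2)) (F h))
      (stdModule 3 (fun m => lam (h + m)) fun m => S (h + m)) :=
    iso_subquot_std (h := h) (n := 3) φ hφ hk (hF _ hk) (hF _ (by omega)) _ _ (fun _ _ => rfl)
      fun _ _ => rfl
  have hgamma : gammaOf (fun m => lam (h + m)) (fun m => S (h + m)) 1 = gammaOf lam S (h + 1) :=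
    rfl
  have hnorm : IsNormalized 3 fun m => S (h + m) := fun n h1 h2 => hS _ (by omega) (by omega)
  rw [IsGammaAt, Nat.add_sub_cancel, ← hgamma]
  constructor
  · rintro ⟨T, hT1, hT2, hT, rfl⟩
    have hTn : IsNormalized 3 T := fun n h1 h2 => by
      obtain rfl | rfl : n = 1 ∨ n = 2 := by omega
      exacts [hT1, hT2]
    exact gammaOf_eq_of_iso (hlam.shift (h := h) (n := 3) hk) hTn hnorm (hT.symm.trans hiso) le_rfl
      le_rfl
  · rintro rfl
    exact ⟨_, hnorm 1 le_rfl (by omega), hnorm 2 (by omega) (by omega), hiso, rfl⟩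

theorem isPiValue_std_iff (hS : IsNormalized k S) {i j : ℕ} (hi : 1 ≤ i) (hij : i < j)
    (hj : j + 2 ≤ k) (hc : classOf (stdModule k lam S) ∈ frescoClasses r k lam) (z : ℂ) :
    IsPiValue r k lam i j (classOf (stdModule k lam S)) z ↔ z = piOf lam S i j := by
  have hlam := (exists_std_of_mem_frescoClasses hc).1
  constructor
  · rintro ⟨E, F, gi, gj, hE, hF, hgi, hgj, rfl⟩
    obtain ⟨T, hT, φ, hφ, hflag⟩ := exists_iso_std (isMonogenic_of_mem_frescoClasses (hE ▸ hc)) hF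
    rw [isGammaAt_iff hlam hT φ hφ hflag hi (by omega)] at hgi
    rw [isGammaAt_iff hlam hT φ hφ hflag (by omega) hj] at hgj
    rw [hgi, hgj]
    exact piOf_eq_of_iso hlam hT hS (Iso.trans (Iso.symm ⟨φ, hφ⟩) (classOf_eq_iff.1 hE)) hi hij hj
  · rintro rfl
    have key : ∀ l, 1 ≤ l → l + 2 ≤ k →
        IsGammaAt lam (stdFlag k lam S) l (gammaOf lam S l) := fun l h1 h2 =>
      (isGammaAt_iff hlam hS (LinearEquiv.refl _ _) (fun _ => rfl) (fun _ _ _ => Iff.rfl) h1 h2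
        _).2 rfl
    exact ⟨_, stdFlag k lam S, _, _, rfl, isPrincipalJH_std hlam, key i hi (by omega),
      key j (by omega) hj, rfl⟩

end

/-! ### Holomorphy -/

section

variable {k : ℕ} {lam : ℕ → ℚ}

theorem isNormalized_versalSeries (s : VersalBase k lam) : IsNormalized k (versalSeries s) :=
  fun n _ _ => by rw [versalSeries, coeff_mk, if_pos rfl]

theorem differentiable_coeff_versalSeries (j : ℕ) :
    Differentiable ℂ fun s : VersalBase k lam => coeff 1 (versalSeries s j) := by
  simp only [versalSeries, coeff_mk, one_ne_zero, if_false]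
  split_ifs
  · exact differentiable_apply _
  · exact differentiable_const _

theorem differentiable_gammaOf_versalSeries (h : ℕ) :
    Differentiable ℂ fun s : VersalBase k lam => gammaOf lam (versalSeries s) h :=
  ((differentiable_coeff_versalSeries h).const_mul _).sub
    ((differentiable_coeff_versalSeries (h + 1)).const_mul _)

theorem differentiable_piOf_versalSeries (i j : ℕ) :
    Differentiable ℂ fun s : VersalBase k lam => piOf lam (versalSeries s) i j :=
  ((differentiable_gammaOf_versalSeries i).const_mul _).sub
    ((differentiable_gammaOf_versalSeries j).const_mul _)

/-- The whole affine space serves as 𝒢₀, being analytic with no equations. -/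
theorem isHolomorphicParameter_of_differentiable {F₀ : Set IsoClass} {f : F₀ → ℂ}
    {Φ : VersalBase k lam → ℂ} (hΦ : Differentiable ℂ Φ)
    (h : ∀ (s : VersalBase k lam) (hs : versalClass s ∈ F₀), f ⟨versalClass s, hs⟩ = Φ s) :
    IsHolomorphicParameter k lam f := by
  refine ⟨Set.univ, fun x _ => ⟨Set.univ, isOpen_univ, trivial, 0, fun m => m.elim0,
    fun m => m.elim0, ?_⟩, fun _ _ => trivial, fun s => Φ s, fun x _ => ⟨Set.univ, isOpen_univ,
    trivial, Φ, hΦ.differentiableOn, fun _ _ => rfl⟩, fun s hs => h s hs⟩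
  ext y
  exact ⟨fun _ => ⟨trivial, fun m => m.elim0⟩, fun _ => ⟨trivial, trivial⟩⟩

end

end Fresco

end

/-! ### The main theorem -/

theorem mainTheorem5
    (r : AddCircle (1 : ℚ) → AddCircle (1 : ℚ) → Prop) [IsStrictTotalOrder (AddCircle (1 : ℚ)) r]
    (k : ℕ) (lam : ℕ → ℚ) (i j : ℕ) (hi : 1 ≤ i) (hij : i < j) (hj : j + 2 ≤ k) :
    ∃ π : Fresco.frescoClasses r k lam → ℂ,
      (∀ (c : Fresco.frescoClasses r k lam) (z : ℂ),
        Fresco.IsPiValue r k lam i j c z ↔ z = π c) ∧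
      Fresco.IsHolomorphicParameter k lam π ∧
      Fresco.IsQuasiInvariant 1 π := by
  open Fresco PowerSeries in
  have hex : ∀ c : frescoClasses r k lam, ∃ S, IsNormalized k S ∧
      classOf (stdModule k lam S) = c := fun c => (exists_std_of_mem_frescoClasses c.2).2.2
  -- π is defined by one chosen normalized presentation of each class; `hpi` makes the choice
  -- irrelevant.
  choose S hS hSc using hex
  have hpi : ∀ (c : frescoClasses r k lam) (T : ℕ → ℂ⟦X⟧), IsNormalized k T →
      classOf (stdModule k lam T) = c → piOf lam (S c) i j = piOf lam T i j := fun c T hT hTc =>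
    piOf_eq_of_iso (exists_std_of_mem_frescoClasses c.2).1 (hS c) hT
      (classOf_eq_iff.1 ((hSc c).trans hTc.symm)) hi hij hj
  refine ⟨fun c => piOf lam (S c) i j, fun c z => ?_, ?_, ?_⟩
  · have h := isPiValue_std_iff (r := r) (hS c) hi hij hj (by rw [hSc]; exact c.2) z
    rwa [hSc] at h
  · exact isHolomorphicParameter_of_differentiable (differentiable_piOf_versalSeries i j)
      fun s hs => hpi _ _ (isNormalized_versalSeries s) rfl
  · intro θ hθ E hE
    obtain ⟨hlam, hsat, -⟩ := exists_std_of_mem_frescoClasses hE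
    have hEiso : Iso E (stdModule k lam (S ⟨_, hE⟩)) := (classOf_eq_iff.1 (hSc ⟨_, hE⟩)).symm
    obtain ⟨e, S', hS'⟩ := exists_isNewPresentation (lam := lam) hθ (hS ⟨_, hE⟩)
    have hp := (hS'.isPushforward hθ.2).of_iso hEiso
    have hnorm : IsNormalized k S' := fun n h1 h2 => hS'.coeff_zero n h1 h2.le
    refine ⟨⟨_, isABModule_std, hp⟩, fun E' hE' hp' => ?_⟩
    have hclass : classOf (stdModule k lam S') = classOf E' := classOf_eq_iff.2
      (hp.unique (isABModule_std.of_iso hEiso.symm) hE' hp')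
    have hmem : classOf E' ∈ frescoClasses r k lam :=
      hclass ▸ classOf_std_mem_frescoClasses hlam hsat hnorm
    refine ⟨hmem, ?_⟩
    have hi' := hS'.gammaOf_eq hθ (hS ⟨_, hE⟩) hi (by omega)
    have hj' := hS'.gammaOf_eq hθ (hS ⟨_, hE⟩) (by omega) hj
    beta_reduce
    rw [hpi ⟨_, hmem⟩ S' hnorm hclass, pow_one, piOf, piOf]
    -- The two corrections are (τ/χ) w_i and (τ/χ) w_j, and they cancel in w_j γ_i - w_i γ_j.
    linear_combination weightFactor lam i * hj' - weightFactor lam j * hi'
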